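/- **Second coefficient of the motivic Donaldson–Thomas series of the homogenized Weyl algebra.** *Motives.* Let $K_0^{\hat\mu}(\mathrm{Var}_{\mathbb C})$ be the Grothendieck group of complex varieties with a good action of $\hat\mu=\varprojlim\mu_n$, with the scissor relations and with $[X\times\mathbb A^1]$ independent of the linear action chosen on the factor $\mathbb A^1$. It is a commutative ring under the convolution product, i.e. the product for which $$[X,f]\longmapsto [f^{-1}(0)]-[f^{-1}(1)]$$ is a ring isomorphism from the Grothendieck ring of varieties $X$ with a $\mathbb G_m$-action and a function $f:X\to\mathbb A^1$ homogeneous of positive weight ($\hat\mu$ acting on the fibres through the stabilizer $\mu_d\subset\mathbb G_m$, $d$ the weight of $f$), modulo the classes $[Y\times\mathbb A^1,\mathrm{pr}_2]$, with product $[X,f]\cdot[Y,g]=[X\times Y,\,f\boxplus g]$, $(f\boxplus g)(x,y)=f(x)+g(y)$. (For varieties with trivial action this is $[X][Y]=[X\times Y]$.) Let $\mathbb L=[\mathbb A^1]$ and $$\mathcal M=K_0^{\hat\mu}(\mathrm{Var}_{\mathbb C})\bigl[\mathbb L^{-1},(\mathbb L^n-1)^{-1}:n\ge 1\bigr].$$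 The symmetric square $\sigma_2([X,f])=[\mathrm{Sym}^2X,\mathrm{Sym}^2 f]$, where $\mathrm{Sym}^2f$ sends $\{x,y\}$ to $f(x)+f(y)$, extends uniquely to an operation $\sigma_2$ on $\mathcal M$ with $\sigma_2(a+b)=\sigma_2(a)+ab+\sigma_2(b)$ and $\sigma_2(\mathbb L a)=\mathbb L^2\sigma_2(a)$. The plethystic exponential is $\mathrm{Exp}(\sum_{n\ge1}a_nt^n)=\prod_{n\ge1}\sigma_{t^n}(a_n)$ with $\sigma_T(a)=1+aT+\sigma_2(a)T^2+\cdots$, so that its coefficient of $t^2$ is $\sigma_2(a_1)+a_2$. *The series.* Let $W=XYZ-XZY-\tfrac13X^3$, homogeneous of degree $3$, and for $n\ge 0$ let $\mathrm{Tr}(W):M_n(\mathbb C)^{3}\to\mathbb C$ be the trace of the value of $W$. Put $\mathbb M_{3,n}^W(\lambda)=\mathrm{Tr}(W)^{-1}(\lambda)$, with the trivial action for $\lambda=0$ and, for $\lambda=1$, with $\hat\mu$ acting through the multiplication by scalars in $\mu_3$, and $$U_W(t)=\sum_{n\ge0}\mathbb L^{-n^2}\,\frac{[\mathbb M_{3,n}^W(0)]-[\mathbb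 M_{3,n}^W(1)]}{[GL_n]}\,t^n .$$ *Statement.* Let $\tilde{\mathbf M}=1-[\mu_3]$, where $\mu_3=\{x^3=1\}\subset\mathbb A^1$ carries the canonical action of $\mu_3$. In $\mathcal M$ the elements $\mathbb L$, $\mathbb L-1$, $\mathbb L^2-1$ and $[GL_2]$ are invertible, the coefficient of $t^2$ in $U_W(t)$ equals $$\frac{\mathbb L^3(\mathbb L-1)+\tilde{\mathbf M}\,\mathbb L(\mathbb L^2-1)+\tilde{\mathbf M}^2\,\mathbb L^2}{(\mathbb L^2-1)(\mathbb L-1)},$$ and it equals the coefficient of $t^2$ in $$\mathrm{Exp}\Bigl(\frac{\mathbb L\tilde{\mathbf M}}{\mathbb L-1}\cdot\frac{t}{1-t}\Bigr).$$ -/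

import Mathlib

namespace Motivic

noncomputable section

open AddMonoidAlgebra (single mapAlgHom)

/-- An affine variety (of finite type over `ℂ`) with an action of the diagonalizable group with
character group `Γ`: its coordinate ring `A`, a finitely generated algebra, with the `Γ`-grading
that is given by the coaction `a ↦ ∑ q, (component of a of degree q) ⊗ q`. The grading is encoded
by the requirement that `A` is generated by finitely many homogeneous elements. -/
structure GrAlg (Γ : Type) [AddCommGroup Γ] where
  /-- the coordinate ring -/
  A : Type
  [commRing : CommRing A]
  [algebra : Algebra ℂ A]
  /-- the coaction -/
  co : A →ₐ[ℂ] AddMonoidAlgebra A Γ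
  gen : ∃ S : Set A, S.Finite ∧ Algebra.adjoin ℂ S = ⊤ ∧ ∀ s ∈ S, ∃ q, co s = single q s

attribute [instance] GrAlg.commRing GrAlg.algebra

namespace GrAlg

variable {Γ : Type} [AddCommGroup Γ]

/-- `a` is homogeneous of degree `q`. -/
def IsHom (X : GrAlg Γ) (q : Γ) (a : X.A) : Prop := X.co a = single q a

/-- The homogeneous component of degree `q`. -/
def comp (X : GrAlg Γ) (q : Γ) (a : X.A) : X.A := (X.co a).coeff q

/-- Equivariant maps: algebra homomorphisms that preserve degrees. -/
def IsGr {X Y : GrAlg Γ} (φ : X.A →ₐ[ℂ] Y.A) : Prop :=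
  ∀ q a, X.IsHom q a → Y.IsHom q (φ a)

/-- Equivariant isomorphism. -/
def Iso (X Y : GrAlg Γ) : Prop := ∃ e : X.A ≃ₐ[ℂ] Y.A, IsGr (e : X.A →ₐ[ℂ] Y.A)

variable {X Y Z : GrAlg Γ}

theorem IsHom.add {q : Γ} {a b : X.A} (ha : X.IsHom q a) (hb : X.IsHom q b) :
    X.IsHom q (a + b) := by
  unfold IsHom at *; rw [map_add, ha, hb, AddMonoidAlgebra.single_add]

theorem isHom_zero (q : Γ) : X.IsHom q 0 := by simp [IsHom]

theorem isHom_one : X.IsHom 0 1 := by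
  simp [IsHom, AddMonoidAlgebra.one_def]

theorem IsHom.neg {q : Γ} {a : X.A} (ha : X.IsHom q a) : X.IsHom q (-a) := by
  unfold IsHom at *; rw [map_neg, ha, AddMonoidAlgebra.single_neg]

theorem IsHom.sub {q : Γ} {a b : X.A} (ha : X.IsHom q a) (hb : X.IsHom q b) :
    X.IsHom q (a - b) := by
  rw [sub_eq_add_neg]; exact ha.add hb.neg

theorem IsHom.mul {q r : Γ} {a b : X.A} (ha : X.IsHom q a) (hb : X.IsHom r b) :
    X.IsHom (q + r) (a * b) := by
  unfold IsHom at *; rw [map_mul, ha, hb, AddMonoidAlgebra.single_mul_single]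

theorem IsHom.pow {q : Γ} {a : X.A} (ha : X.IsHom q a) (n : ℕ) :
    X.IsHom (n • q) (a ^ n) := by
  unfold IsHom at *; rw [map_pow, ha, AddMonoidAlgebra.single_pow]

theorem IsHom.smul {q : Γ} {a : X.A} (c : ℂ) (ha : X.IsHom q a) : X.IsHom q (c • a) := by
  unfold IsHom at *; rw [map_smul, ha, AddMonoidAlgebra.smul_single]

theorem isHom_algebraMap (c : ℂ) : X.IsHom 0 (algebraMap ℂ X.A c) := by
  rw [Algebra.algebraMap_eq_smul_one]; exact isHom_one.smul c

theorem isHom_sum {ι : Type*} {q : Γ} (s : Finset ι) (a : ι → X.A)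
    (h : ∀ i ∈ s, X.IsHom q (a i)) : X.IsHom q (∑ i ∈ s, a i) := by
  classical
  induction s using Finset.induction_on with
  | empty => simpa using isHom_zero q
  | insert i s hi ih =>
    rw [Finset.sum_insert hi]
    exact (h i (by simp)).add (ih fun j hj => h j (by simp [hj]))

theorem hom_span (a : X.A) : a ∈ Submodule.span ℂ {a | ∃ q, X.IsHom q a} := by
  obtain ⟨S, -, hS, h⟩ := X.gen
  have ha : a ∈ (Algebra.adjoin ℂ S).toSubmodule := by rw [hS]; trivial
  rw [Algebra.adjoin_eq_span] at ha
  refine Submodule.span_mono ?_ ha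
  intro b hb
  induction hb using Submonoid.closure_induction with
  | mem x hx => exact h x hx
  | one => exact ⟨0, isHom_one⟩
  | mul x y _ _ hx hy =>
    obtain ⟨q, hq⟩ := hx
    obtain ⟨r, hr⟩ := hy
    exact ⟨_, hq.mul hr⟩

theorem hom_induction {P : X.A → Prop} (hom : ∀ q a, X.IsHom q a → P a)
    (add : ∀ a b, P a → P b → P (a + b)) (a : X.A) : P a := by
  have key : ∀ c : ℂ, P (c • a) := by
    induction hom_span a using Submodule.span_induction with
    | mem x hx => exact fun c => hom _ _ (hx.choose_spec.smul c)
    | zero => intro c; rw [smul_zero]; exact hom 0 0 (isHom_zero 0)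
    | add x y _ _ hx hy => intro c; rw [smul_add]; exact add _ _ (hx c) (hy c)
    | smul d x _ hx => intro c; rw [smul_smul]; exact hx _
  simpa using key 1

theorem comp_add (q : Γ) (a b : X.A) : X.comp q (a + b) = X.comp q a + X.comp q b := by
  simp [comp]

theorem comp_zero (q : Γ) : X.comp q 0 = 0 := by simp [comp]

theorem comp_sub (q : Γ) (a b : X.A) : X.comp q (a - b) = X.comp q a - X.comp q b := by
  simp [comp]

theorem IsHom.comp_self {q : Γ} {a : X.A} (h : X.IsHom q a) : X.comp q a = a := by
  rw [comp, h]; simp [AddMonoidAlgebra.coeff_single]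

theorem IsHom.comp_ne {q r : Γ} {a : X.A} (h : X.IsHom q a) (hr : q ≠ r) : X.comp r a = 0 := by
  rw [comp, h]; simp [AddMonoidAlgebra.coeff_single, hr]

theorem IsHom.eq_zero {q r : Γ} {a : X.A} (h : X.IsHom q a) (h' : X.IsHom r a) (hr : q ≠ r) :
    a = 0 := by rw [← h'.comp_self, h.comp_ne hr]

theorem isHom_comp (q : Γ) (a : X.A) : X.IsHom q (X.comp q a) := by
  induction a using hom_induction with
  | hom r a h =>
    by_cases hr : r = q
    · subst hr; rwa [h.comp_self]
    · rw [h.comp_ne hr]; exact isHom_zero q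
  | add a b ha hb => rw [comp_add]; exact ha.add hb

/-- The finite set of degrees in which `a` has a nonzero component. -/
def degs (X : GrAlg Γ) (a : X.A) : Finset Γ := (X.co a).coeff.support

theorem comp_of_notMem {q : Γ} {a : X.A} (h : q ∉ X.degs a) : X.comp q a = 0 := by
  simpa [degs, comp] using h

theorem co_eq_sum (a : X.A) : X.co a = ∑ q ∈ X.degs a, single q (X.comp q a) := by
  ext q
  classical
  simp only [AddMonoidAlgebra.coeff_sum, AddMonoidAlgebra.coeff_single, Finsupp.finsetSum_apply,
    Finsupp.single_apply]
  rw [Finset.sum_ite_eq' (X.degs a) q]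
  split_ifs with h
  · rfl
  · exact comp_of_notMem h

theorem sum_comp_of_subset (a : X.A) (s : Finset Γ) (hs : X.degs a ⊆ s) :
    ∑ q ∈ s, X.comp q a = a := by
  classical
  induction a using hom_induction generalizing s with
  | hom r a h =>
    by_cases ha : a = 0
    · subst ha; simp [comp_zero]
    have hr : r ∈ s := hs (by
      by_contra hr
      exact ha (h.comp_self ▸ comp_of_notMem hr))
    rw [Finset.sum_eq_single r (fun q _ hq => h.comp_ne (Ne.symm hq)) (fun h => absurd hr h),
      h.comp_self]
  | add a b ha hb =>
    have e : ∀ c, X.degs c ⊆ s → ∑ q ∈ s ∪ X.degs a ∪ X.degs b, X.comp q c = ∑ q ∈ s, X.comp q c :=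
      fun c hc => (Finset.sum_subset (fun q hq => by simp [hq])
        (fun q _ hq => comp_of_notMem (fun h => hq (hc h)))).symm
    have h1 : X.degs a ⊆ s ∪ X.degs a ∪ X.degs b := fun q hq => by simp [hq]
    have h2 : X.degs b ⊆ s ∪ X.degs a ∪ X.degs b := fun q hq => by simp [hq]
    rw [← e _ hs]
    generalize s ∪ X.degs a ∪ X.degs b = u at h1 h2 ⊢
    rw [Finset.sum_congr rfl fun q _ => comp_add q a b, Finset.sum_add_distrib, ha u h1, hb u h2]

theorem sum_comp (a : X.A) : ∑ q ∈ X.degs a, X.comp q a = a :=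
  sum_comp_of_subset a _ subset_rfl

theorem ext_comp {a b : X.A} (h : ∀ q, X.comp q a = X.comp q b) : a = b := by
  classical
  exact (sum_comp_of_subset a (X.degs a ∪ X.degs b) Finset.subset_union_left).symm.trans
    ((Finset.sum_congr rfl fun q _ => h q).trans
      (sum_comp_of_subset b (X.degs a ∪ X.degs b) Finset.subset_union_right))

theorem IsHom.comp_mul {q : Γ} {g : X.A} (hg : X.IsHom q g) (r : Γ) (a : X.A) :
    X.comp (r + q) (a * g) = X.comp r a * g := by
  induction a using hom_induction with
  | hom s a h =>
    by_cases hs : s = r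
    · subst hs; rw [(h.mul hg).comp_self, h.comp_self]
    · rw [(h.mul hg).comp_ne (by simpa using hs), h.comp_ne hs, zero_mul]
  | add a b ha hb => rw [add_mul, comp_add, comp_add, add_mul, ha, hb]

theorem IsGr.comp_apply {φ : X.A →ₐ[ℂ] Y.A} (h : IsGr φ) (q : Γ) (a : X.A) :
    Y.comp q (φ a) = φ (X.comp q a) := by
  induction a using hom_induction with
  | hom r a ha =>
    by_cases hr : r = q
    · subst hr; rw [ha.comp_self, (h _ _ ha).comp_self]
    · rw [ha.comp_ne hr, (h _ _ ha).comp_ne hr, map_zero]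
  | add a b ha hb => rw [map_add, comp_add, comp_add, map_add, ha, hb]

theorem isGr_iff {φ : X.A →ₐ[ℂ] Y.A} :
    IsGr φ ↔ Y.co.comp φ = (mapAlgHom Γ φ).comp X.co := by
  constructor
  · intro h
    ext a q
    have := h.comp_apply q a
    simpa [comp] using this
  · intro h q a ha
    have := DFunLike.congr_fun h a
    simp only [AlgHom.comp_apply] at this
    rw [IsHom, this, ha, AddMonoidAlgebra.mapAlgHom_single]

theorem isGr_of_adjoin {φ : X.A →ₐ[ℂ] Y.A} {S : Set X.A} (hS : Algebra.adjoin ℂ S = ⊤)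
    (h : ∀ s ∈ S, ∃ q, X.IsHom q s ∧ Y.IsHom q (φ s)) : IsGr φ := by
  rw [isGr_iff]
  refine AlgHom.ext_of_adjoin_eq_top hS fun s hs => ?_
  obtain ⟨q, hq, hq'⟩ := h s hs
  simp only [AlgHom.comp_apply]
  rw [hq', hq, AddMonoidAlgebra.mapAlgHom_single]

theorem IsGr.comp {φ : X.A →ₐ[ℂ] Y.A} {ψ : Y.A →ₐ[ℂ] Z.A} (hψ : IsGr ψ) (hφ : IsGr φ) :
    IsGr (ψ.comp φ) := fun q a h => hψ q _ (hφ q a h)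

theorem IsGr.id : IsGr (AlgHom.id ℂ X.A) := fun _ _ h => h

theorem IsGr.reflect {φ : X.A →ₐ[ℂ] Y.A} (h : IsGr φ) (hi : Function.Injective φ) {q : Γ} {a : X.A}
    (ha : Y.IsHom q (φ a)) : X.IsHom q a := by
  have : X.comp q a = a := hi (by rw [← h.comp_apply, ha.comp_self])
  rw [← this]; exact isHom_comp q a

theorem IsGr.symm {e : X.A ≃ₐ[ℂ] Y.A} (h : IsGr (e : X.A →ₐ[ℂ] Y.A)) :
    IsGr (e.symm : Y.A →ₐ[ℂ] X.A) := fun q b hb =>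
  h.reflect e.injective (by simpa using hb)

theorem Iso.refl (X : GrAlg Γ) : Iso X X := ⟨AlgEquiv.refl, fun _ _ h => h⟩

theorem Iso.symm (h : Iso X Y) : Iso Y X := by
  obtain ⟨e, he⟩ := h; exact ⟨e.symm, he.symm⟩

theorem Iso.trans (h : Iso X Y) (h' : Iso Y Z) : Iso X Z := by
  obtain ⟨e, he⟩ := h
  obtain ⟨e', he'⟩ := h'
  exact ⟨e.trans e', fun q a ha => he' q _ (he q a ha)⟩

/-! ### Constructions -/

/-- The trivial grading on a finitely generated algebra. -/
abbrev triv (A : Type) [CommRing A] [Algebra ℂ A] (h : Algebra.FiniteType ℂ A) : GrAlg Γ where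
  A := A
  co := AddMonoidAlgebra.singleZeroAlgHom
  gen := by
    obtain ⟨S, hS⟩ := h.out
    exact ⟨S, S.finite_toSet, hS, fun s _ => ⟨0, rfl⟩⟩

/-- Change of the grading group. -/
abbrev push {Γ' : Type} [AddCommGroup Γ'] (h : Γ →+ Γ') (X : GrAlg Γ) : GrAlg Γ' where
  A := X.A
  co := (AddMonoidAlgebra.mapDomainAlgHom ℂ X.A h).comp X.co
  gen := by
    obtain ⟨S, hf, hS, hq⟩ := X.gen
    refine ⟨S, hf, hS, fun s hs => ?_⟩
    obtain ⟨q, hq⟩ := hq s hs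
    exact ⟨h q, by simp [hq]⟩

theorem IsHom.push {Γ' : Type} [AddCommGroup Γ'] (h : Γ →+ Γ') {q : Γ} {a : X.A}
    (ha : X.IsHom q a) : (X.push h).IsHom (h q) a := by
  unfold IsHom at *
  simp [GrAlg.push, ha]

/-- The closed subvariety cut out by a homogeneous function. -/
abbrev quot (X : GrAlg Γ) (g : X.A) {q : Γ} (hg : X.IsHom q g) : GrAlg Γ where
  A := X.A ⧸ Ideal.span {g}
  co := Ideal.Quotient.liftₐ _ ((mapAlgHom Γ (Ideal.Quotient.mkₐ ℂ (Ideal.span {g}))).comp X.co) (by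
    intro a ha
    obtain ⟨b, rfl⟩ := Ideal.mem_span_singleton'.1 ha
    have : (Ideal.Quotient.mkₐ ℂ (Ideal.span {g})) g = 0 :=
      Ideal.Quotient.eq_zero_iff_mem.2 (Ideal.mem_span_singleton_self g)
    rw [AlgHom.comp_apply, map_mul, map_mul, hg, AddMonoidAlgebra.mapAlgHom_single, this]
    simp)
  gen := by
    obtain ⟨S, hf, hS, hq⟩ := X.gen
    refine ⟨Ideal.Quotient.mkₐ ℂ (Ideal.span {g}) '' S, hf.image _, ?_, ?_⟩
    · rw [← AlgHom.map_adjoin, hS, Algebra.map_top]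
      exact (AlgHom.range_eq_top _).2 (Ideal.Quotient.mkₐ_surjective ℂ _)
    · rintro _ ⟨s, hs, rfl⟩
      obtain ⟨q, hq⟩ := hq s hs
      refine ⟨q, ?_⟩
      change mapAlgHom Γ (Ideal.Quotient.mkₐ ℂ (Ideal.span {g})) (X.co s) = _
      rw [hq, AddMonoidAlgebra.mapAlgHom_single]

/-- The projection onto the coordinate ring of a closed subvariety. -/
def toQuot (X : GrAlg Γ) (g : X.A) {q : Γ} (hg : X.IsHom q g) : X.A →ₐ[ℂ] (X.quot g hg).A :=
  Ideal.Quotient.mkₐ ℂ (Ideal.span {g})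

theorem isGr_toQuot (X : GrAlg Γ) (g : X.A) {q : Γ} (hg : X.IsHom q g) :
    IsGr (X.toQuot g hg) := by
  intro r a ha
  change mapAlgHom Γ (Ideal.Quotient.mkₐ ℂ (Ideal.span {g})) (X.co a) = _
  rw [ha, AddMonoidAlgebra.mapAlgHom_single]
  rfl

theorem toQuot_surjective (X : GrAlg Γ) (g : X.A) {q : Γ} (hg : X.IsHom q g) :
    Function.Surjective (X.toQuot g hg) := Ideal.Quotient.mkₐ_surjective ℂ _

theorem toQuot_eq_zero {X : GrAlg Γ} {g : X.A} {q : Γ} {hg : X.IsHom q g} {a : X.A} :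
    X.toQuot g hg a = 0 ↔ ∃ b, a = g * b := by
  rw [toQuot, Ideal.Quotient.mkₐ_eq_mk, Ideal.Quotient.eq_zero_iff_mem,
    Ideal.mem_span_singleton]
  rfl

/-- The product with an affine line on which the coordinate has degree `q`. -/
abbrev poly (X : GrAlg Γ) (q : Γ) : GrAlg Γ where
  A := Polynomial X.A
  co := Polynomial.eval₂AlgHom ((mapAlgHom Γ Polynomial.CAlgHom).comp X.co)
    (single q Polynomial.X) (fun _ => Commute.all _ _)
  gen := by
    obtain ⟨S, hf, hS, hq⟩ := X.gen
    refine ⟨insert Polynomial.X (Polynomial.CAlgHom (R := ℂ) '' S), (hf.image _).insert _, ?_, ?_⟩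
    · rw [eq_top_iff]
      intro p _
      have hC : ∀ a : X.A, Polynomial.C a ∈ Algebra.adjoin ℂ
          (insert Polynomial.X (Polynomial.CAlgHom (R := ℂ) '' S)) := fun a => by
        refine Algebra.adjoin_mono (Set.subset_insert _ _) ?_
        rw [← AlgHom.map_adjoin, hS]
        exact ⟨a, trivial, rfl⟩
      induction p using Polynomial.induction_on' with
      | add p r hp hr => exact add_mem (hp trivial) (hr trivial)
      | monomial n a =>
        rw [← Polynomial.C_mul_X_pow_eq_monomial]
        exact mul_mem (hC a) (pow_mem (Algebra.subset_adjoin (Set.mem_insert _ _)) n)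
    · rintro _ (rfl | ⟨s, hs, rfl⟩)
      · exact ⟨q, by simp⟩
      · obtain ⟨r, hr⟩ := hq s hs
        exact ⟨r, by simp [hr]⟩

theorem isGr_polyC (X : GrAlg Γ) (q : Γ) :
    IsGr (X := X) (Y := X.poly q) (Polynomial.CAlgHom : X.A →ₐ[ℂ] Polynomial X.A) := by
  intro r a ha
  unfold IsHom at *
  simp [poly, ha]

theorem isHom_polyX (X : GrAlg Γ) (q : Γ) :
    (X.poly q).IsHom q (Polynomial.X : Polynomial X.A) := by
  simp [IsHom, poly]

open TensorProduct in
/-- The product of two varieties. -/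
abbrev tensor (X Y : GrAlg Γ) : GrAlg Γ where
  A := X.A ⊗[ℂ] Y.A
  co := Algebra.TensorProduct.lift
    ((mapAlgHom Γ Algebra.TensorProduct.includeLeft).comp X.co)
    ((mapAlgHom Γ Algebra.TensorProduct.includeRight).comp Y.co) (fun _ _ => Commute.all _ _)
  gen := by
    obtain ⟨S, hf, hS, hq⟩ := X.gen
    obtain ⟨T, hf', hT, hq'⟩ := Y.gen
    refine ⟨(Algebra.TensorProduct.includeLeft (R := ℂ) (S := ℂ) (B := Y.A)) '' S ∪
      (Algebra.TensorProduct.includeRight (R := ℂ) (A := X.A)) '' T,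
      (hf.image _).union (hf'.image _), ?_, ?_⟩
    · rw [eq_top_iff]
      intro t _
      induction t using TensorProduct.induction_on with
      | zero => exact zero_mem _
      | add x y hx hy => exact add_mem (hx trivial) (hy trivial)
      | tmul a b =>
        have : a ⊗ₜ[ℂ] b = (Algebra.TensorProduct.includeLeft (R := ℂ) (S := ℂ) (B := Y.A) a) *
          (Algebra.TensorProduct.includeRight (R := ℂ) (A := X.A) b) := by simp
        rw [this]
        refine mul_mem (Algebra.adjoin_mono Set.subset_union_left ?_)
          (Algebra.adjoin_mono Set.subset_union_right ?_)
        · rw [← AlgHom.map_adjoin, hS]; exact ⟨a, trivial, rfl⟩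
        · rw [← AlgHom.map_adjoin, hT]; exact ⟨b, trivial, rfl⟩
    · rintro _ (⟨s, hs, rfl⟩ | ⟨s, hs, rfl⟩)
      · obtain ⟨r, hr⟩ := hq s hs
        exact ⟨r, by simp [hr]⟩
      · obtain ⟨r, hr⟩ := hq' s hs
        exact ⟨r, by simp [hr]⟩

open TensorProduct in
theorem IsHom.tmul {q r : Γ} {a : X.A} {b : Y.A} (ha : X.IsHom q a) (hb : Y.IsHom r b) :
    (X.tensor Y).IsHom (q + r) (a ⊗ₜ[ℂ] b) := by
  unfold IsHom at *
  simp [tensor, ha, hb, AddMonoidAlgebra.single_mul_single]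

end GrAlg

open TensorProduct

namespace GrAlg

variable {Γ : Type} [AddCommGroup Γ] {X Y Z U W : GrAlg Γ}

theorem isGr_inclLeft (X Y : GrAlg Γ) : IsGr (X := X) (Y := X.tensor Y)
    (Algebra.TensorProduct.includeLeft : X.A →ₐ[ℂ] X.A ⊗[ℂ] Y.A) := fun q a ha => by
  simpa using ha.tmul (isHom_one (X := Y))

theorem isGr_inclRight (X Y : GrAlg Γ) : IsGr (X := Y) (Y := X.tensor Y)
    (Algebra.TensorProduct.includeRight : Y.A →ₐ[ℂ] X.A ⊗[ℂ] Y.A) := fun q a ha => by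
  simpa using (isHom_one (X := X)).tmul ha

theorem isGr_tensor {φ : X.A ⊗[ℂ] Y.A →ₐ[ℂ] Z.A}
    (h1 : IsGr (X := X) (Y := Z) (φ.comp Algebra.TensorProduct.includeLeft))
    (h2 : IsGr (X := Y) (Y := Z) (φ.comp Algebra.TensorProduct.includeRight)) :
    IsGr (X := X.tensor Y) (Y := Z) φ := by
  rw [isGr_iff] at *
  refine Algebra.TensorProduct.ext ?_ ?_
  · rw [AlgHom.comp_assoc, h1, AlgHom.comp_assoc, isGr_iff.1 (isGr_inclLeft X Y)]
    ext a : 1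
    simp only [AlgHom.comp_apply]
    rw [← AlgHom.comp_apply (mapAlgHom Γ φ), ← AddMonoidAlgebra.mapRangeAlgHom_comp]
  · have e1 : ((Z.co.comp φ).restrictScalars ℂ).comp Algebra.TensorProduct.includeRight
        = Z.co.comp (φ.comp Algebra.TensorProduct.includeRight) := rfl
    have e2 : (((mapAlgHom Γ φ).comp (X.tensor Y).co).restrictScalars ℂ).comp
        Algebra.TensorProduct.includeRight = (mapAlgHom Γ φ).comp ((X.tensor Y).co.comp
          Algebra.TensorProduct.includeRight) := rfl
    rw [e1, e2, h2, isGr_iff.1 (isGr_inclRight X Y)]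
    ext a : 1
    simp only [AlgHom.comp_apply]
    rw [← AlgHom.comp_apply (mapAlgHom Γ φ), ← AddMonoidAlgebra.mapRangeAlgHom_comp]

theorem IsGr.tmap {X' Y' : GrAlg Γ} {φ : X.A →ₐ[ℂ] X'.A} {ψ : Y.A →ₐ[ℂ] Y'.A} (hφ : IsGr φ)
    (hψ : IsGr ψ) : IsGr (X := X.tensor Y) (Y := X'.tensor Y') (Algebra.TensorProduct.map φ ψ) := by
  apply isGr_tensor
  · intro q a ha
    simpa using (hφ q a ha).tmul (isHom_one (X := Y'))
  · intro q a ha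
    simpa using (isHom_one (X := X')).tmul (hψ q a ha)

/-- `φ` and `ψ` exhibit `Z` as the closed subvariety `g = 0` of `X` and `U` as its open complement
`g ≠ 0`, for a homogeneous function `g`. -/
structure IsScissors (X Z U : GrAlg Γ) (g : X.A) (φ : X.A →ₐ[ℂ] Z.A) (ψ : X.A →ₐ[ℂ] U.A) :
    Prop where
  hom : ∃ q, X.IsHom q g
  grφ : IsGr φ
  grψ : IsGr ψ
  surj : Function.Surjective φ
  ker : RingHom.ker φ = Ideal.span {g}
  loc : @IsLocalization.Away X.A _ g U.A _ ψ.toRingHom.toAlgebra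

theorem IsScissors.mk' {g : X.A} {φ : X.A →ₐ[ℂ] Z.A} {ψ : X.A →ₐ[ℂ] U.A} {q : Γ}
    (hom : X.IsHom q g) (grφ : IsGr φ) (grψ : IsGr ψ) (surj : Function.Surjective φ)
    (h0 : φ g = 0) (ker : ∀ a, φ a = 0 → ∃ b, a = g * b) (unit : IsUnit (ψ g))
    (lsurj : ∀ u, ∃ n a, u * ψ g ^ n = ψ a)
    (lker : ∀ a, ψ a = 0 → ∃ n, g ^ n * a = 0) : IsScissors X Z U g φ ψ where
  hom := ⟨q, hom⟩
  grφ := grφ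
  grψ := grψ
  surj := surj
  ker := by
    ext a
    rw [RingHom.mem_ker, Ideal.mem_span_singleton]
    exact ⟨fun h => ker a h, fun ⟨b, hb⟩ => by rw [hb, map_mul, h0, zero_mul]⟩
  loc := by
    let _ := ψ.toRingHom.toAlgebra
    have e : ∀ a, algebraMap X.A U.A a = ψ a := fun _ => rfl
    refine ⟨?_, ?_, ?_⟩
    · rintro ⟨_, n, rfl⟩
      rw [e]
      simpa using unit.pow n
    · intro u
      obtain ⟨n, a, h⟩ := lsurj u
      refine ⟨(a, ⟨g ^ n, n, rfl⟩), ?_⟩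
      simpa [e] using h
    · intro a b hab
      rw [e, e, ← sub_eq_zero, ← map_sub] at hab
      obtain ⟨n, h⟩ := lker _ hab
      exact ⟨⟨g ^ n, n, rfl⟩, by simpa [mul_sub, sub_eq_zero] using h⟩

namespace IsScissors

variable {g : X.A} {φ : X.A →ₐ[ℂ] Z.A} {ψ : X.A →ₐ[ℂ] U.A}

theorem map_g (h : IsScissors X Z U g φ ψ) : φ g = 0 := by
  rw [← RingHom.mem_ker, h.ker]; exact Ideal.mem_span_singleton_self g

theorem ker' (h : IsScissors X Z U g φ ψ) (a : X.A) (ha : φ a = 0) : ∃ b, a = g * b := by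
  rw [← RingHom.mem_ker, h.ker, Ideal.mem_span_singleton] at ha
  exact ha

theorem unit (h : IsScissors X Z U g φ ψ) : IsUnit (ψ g) := by
  let _ := ψ.toRingHom.toAlgebra
  have := h.loc
  exact IsLocalization.Away.algebraMap_isUnit (S := U.A) g

theorem lsurj (h : IsScissors X Z U g φ ψ) (u : U.A) : ∃ n a, u * ψ g ^ n = ψ a := by
  let _ := ψ.toRingHom.toAlgebra
  have := h.loc
  exact IsLocalization.Away.surj g u

theorem lker (h : IsScissors X Z U g φ ψ) (a : X.A) (ha : ψ a = 0) : ∃ n, g ^ n * a = 0 := by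
  let _ := ψ.toRingHom.toAlgebra
  have := h.loc
  obtain ⟨⟨_, n, rfl⟩, hc⟩ := IsLocalization.exists_of_eq (M := Submonoid.powers g) (S := U.A)
    (x := a) (y := 0) (by rw [map_zero]; exact ha)
  exact ⟨n, by simpa using hc⟩

theorem tensor (h : IsScissors X Z U g φ ψ) (W : GrAlg Γ) :
    IsScissors (X.tensor W) (Z.tensor W) (U.tensor W) (g ⊗ₜ[ℂ] 1)
    (Algebra.TensorProduct.map φ (AlgHom.id ℂ W.A))
    (Algebra.TensorProduct.map ψ (AlgHom.id ℂ W.A)) := by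
  let _ := ψ.toRingHom.toAlgebra
  have : IsScalarTower ℂ X.A U.A := IsScalarTower.of_algebraMap_eq fun c => (ψ.commutes c).symm
  have hl := h.loc
  have hm : IsLocalizedModule (Submonoid.powers g) (Algebra.linearMap X.A U.A) :=
    (isLocalizedModule_iff_isLocalization' _ _).2 hl
  have ht : IsLocalizedModule (Submonoid.powers g)
    (AlgebraTensorModule.rTensor ℂ W.A (Algebra.linearMap X.A U.A)) := inferInstance
  have e : ∀ t, AlgebraTensorModule.rTensor ℂ W.A (Algebra.linearMap X.A U.A) t =
      Algebra.TensorProduct.map ψ (AlgHom.id ℂ W.A) t := by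
    intro t
    induction t using TensorProduct.induction_on with
    | zero => simp
    | add a b ha hb => rw [map_add, map_add, ha, hb]
    | tmul a b => simp; rfl
  obtain ⟨q, hq⟩ := h.hom
  refine IsScissors.mk' (q := q) (by simpa using hq.tmul (isHom_one (X := W)))
    (h.grφ.tmap IsGr.id) (h.grψ.tmap IsGr.id) ?_ ?_ ?_ ?_ ?_ ?_
  · exact TensorProduct.map_surjective h.surj Function.surjective_id
  · simp [h.map_g]
  · intro t ht
    have := Algebra.TensorProduct.rTensor_ker (R := ℂ) (C := W.A) φ h.surj
    rw [← RingHom.mem_ker, this, h.ker, Ideal.map_span, Set.image_singleton,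
      Ideal.mem_span_singleton] at ht
    exact ht
  · rw [Algebra.TensorProduct.map_tmul]
    simpa using h.unit.map (Algebra.TensorProduct.includeLeft : U.A →ₐ[ℂ] U.A ⊗[ℂ] W.A)
  · intro u
    obtain ⟨⟨t, ⟨_, n, rfl⟩⟩, h1⟩ := ht.surj u
    refine ⟨n, t, ?_⟩
    rw [← e t]
    refine Eq.trans ?_ h1
    change _ = g ^ n • u
    clear h1
    induction u using TensorProduct.induction_on with
    | zero => simp
    | add a b ha hb => rw [add_mul, ha, hb, smul_add]
    | tmul a b =>
      rw [TensorProduct.smul_tmul', Algebra.smul_def]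
      change _ = (ψ (g ^ n) * a) ⊗ₜ[ℂ] b
      simp [mul_comm]
  · intro t h1
    rw [← e] at h1
    obtain ⟨⟨_, n, rfl⟩, h2⟩ := ht.exists_of_eq (x₁ := t) (x₂ := 0) (by rw [h1, map_zero])
    refine ⟨n, ?_⟩
    rw [smul_zero] at h2
    change g ^ n • t = 0 at h2
    rw [← h2, Algebra.smul_def]
    simp

end IsScissors

theorem isGr_poly {q : Γ} {φ : Polynomial X.A →ₐ[ℂ] Z.A}
    (h1 : IsGr (X := X) (Y := Z) (φ.comp Polynomial.CAlgHom))
    (h2 : Z.IsHom q (φ Polynomial.X)) : IsGr (X := X.poly q) (Y := Z) φ := by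
  rw [isGr_iff] at *
  have hX : (X.poly q).co Polynomial.X = single q Polynomial.X := isHom_polyX X q
  refine Polynomial.algHom_ext' ?_ ?_
  · rw [AlgHom.comp_assoc, h1, AlgHom.comp_assoc, isGr_iff.1 (isGr_polyC X q)]
    ext a : 1
    simp only [AlgHom.comp_apply]
    rw [← AlgHom.comp_apply (mapAlgHom Γ φ), ← AddMonoidAlgebra.mapRangeAlgHom_comp]
  · rw [AlgHom.comp_apply, AlgHom.comp_apply, hX, h2, AddMonoidAlgebra.mapAlgHom_single]

/-- `Y` is the product of `X` with an affine line with coordinate `y`. -/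
structure IsLine (X Y : GrAlg Γ) (i : X.A →ₐ[ℂ] Y.A) (y : Y.A) : Prop where
  hom : ∃ q, Y.IsHom q y
  gr : IsGr i
  bij : Function.Bijective (Polynomial.eval₂ (i : X.A →+* Y.A) y)

theorem IsLine.iso {i : X.A →ₐ[ℂ] Y.A} {y : Y.A} (h : IsLine X Y i y) {q : Γ} (hq : Y.IsHom q y) :
    ∃ e : (X.poly q).A ≃ₐ[ℂ] Y.A, IsGr (e : (X.poly q).A →ₐ[ℂ] Y.A) ∧
      (∀ a, e (Polynomial.C a) = i a) ∧ e Polynomial.X = y := by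
  let f : Polynomial X.A →ₐ[ℂ] Y.A := Polynomial.eval₂AlgHom i y (fun _ => Commute.all _ _)
  have h1 : ∀ a, f (Polynomial.C a) = i a := fun a => by simp [f]
  have h2 : f Polynomial.X = y := by simp [f]
  refine ⟨AlgEquiv.ofBijective f h.bij, ?_, h1, h2⟩
  refine isGr_poly (φ := f) ?_ (h2 ▸ hq)
  intro r a ha
  exact h1 a ▸ h.gr r a ha

end GrAlg

/-- An affine variety with an action of `G_m` and a function `f` on it that is homogeneous of
positive weight. After division of the weights by the weight of `f` these are the `ℚ`-graded
coordinate rings with a function of degree `1`. -/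
structure PotVar extends GrAlg ℚ where
  /-- the function -/
  f : A
  hf : toGrAlg.IsHom 1 f

namespace PotVar

open GrAlg

/-- Equivariant isomorphisms that respect the functions. -/
def Iso (P Q : PotVar) : Prop :=
  ∃ e : P.A ≃ₐ[ℂ] Q.A, IsGr (X := P.toGrAlg) (Y := Q.toGrAlg) (e : P.A →ₐ[ℂ] Q.A) ∧ e P.f = Q.f

theorem Iso.symm {P Q : PotVar} (h : Iso P Q) : Iso Q P := by
  obtain ⟨e, he, hf⟩ := h; exact ⟨e.symm, he.symm, by rw [← hf, e.symm_apply_apply]⟩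

theorem Iso.trans {P Q R : PotVar} (h : Iso P Q) (h' : Iso Q R) : Iso P R := by
  obtain ⟨e, he, hf⟩ := h
  obtain ⟨e', he', hf'⟩ := h'
  exact ⟨e.trans e', fun q a ha => he' q _ (he q a ha), by simp [hf, hf']⟩

theorem Iso.refl (P : PotVar) : Iso P P := ⟨AlgEquiv.refl, fun _ _ h => h, rfl⟩

instance setoid : Setoid PotVar := ⟨Iso, Iso.refl, Iso.symm, Iso.trans⟩

/-- `(X, f)` and `(Y, g)` have the product `(X × Y, f + g)`. -/
abbrev tensor (P Q : PotVar) : PotVar where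
  toGrAlg := P.toGrAlg.tensor Q.toGrAlg
  f := P.f ⊗ₜ[ℂ] 1 + 1 ⊗ₜ[ℂ] Q.f
  hf := (isGr_inclLeft _ _ _ _ P.hf).add (isGr_inclRight _ _ _ _ Q.hf)

/-- The point with potential zero. -/
abbrev pt : PotVar where
  toGrAlg := GrAlg.triv ℂ inferInstance
  f := 0
  hf := isHom_zero 1

/-- Isomorphism classes. -/
def Cls : Type 1 := Quotient setoid

theorem Iso.tensor {P P' Q Q' : PotVar} (h : Iso P P') (h' : Iso Q Q') :
    Iso (P.tensor Q) (P'.tensor Q') := by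
  obtain ⟨e, he, hf⟩ := h
  obtain ⟨e', he', hf'⟩ := h'
  exact ⟨Algebra.TensorProduct.congr e e', he.tmap he', by simp [hf, hf']⟩

theorem tensor_comm (P Q : PotVar) : Iso (P.tensor Q) (Q.tensor P) := by
  refine ⟨Algebra.TensorProduct.comm ℂ P.A Q.A, ?_, by simp [add_comm]⟩
  apply isGr_tensor
  · exact fun q a ha => isGr_inclRight Q.toGrAlg P.toGrAlg q a ha
  · exact fun q a ha => isGr_inclLeft Q.toGrAlg P.toGrAlg q a ha

theorem tensor_assoc (P Q R : PotVar) :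
    Iso ((P.tensor Q).tensor R) (P.tensor (Q.tensor R)) := by
  refine ⟨Algebra.TensorProduct.assoc ℂ ℂ ℂ P.A Q.A R.A, ?_, ?_⟩
  · apply isGr_tensor
    · apply isGr_tensor
      · exact fun q a ha => isGr_inclLeft P.toGrAlg (Q.tensor R).toGrAlg q a ha
      · exact fun q a ha => isGr_inclRight P.toGrAlg (Q.tensor R).toGrAlg q _
          (isGr_inclLeft Q.toGrAlg R.toGrAlg q a ha)
    · exact fun q a ha => isGr_inclRight P.toGrAlg (Q.tensor R).toGrAlg q _
          (isGr_inclRight Q.toGrAlg R.toGrAlg q a ha)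
  · have e : (1 : P.A ⊗[ℂ] Q.A) ⊗ₜ[ℂ] R.f = ((1 : P.A) ⊗ₜ[ℂ] (1 : Q.A)) ⊗ₜ[ℂ] R.f := rfl
    simp only [TensorProduct.add_tmul, TensorProduct.tmul_add, e, map_add,
      Algebra.TensorProduct.assoc_tmul, add_assoc]
    rfl

theorem pt_tensor (P : PotVar) : Iso (pt.tensor P) P := by
  refine ⟨Algebra.TensorProduct.lid ℂ P.A, ?_, by simp⟩
  apply isGr_tensor
  · intro q a ha
    change AddMonoidAlgebra.single (0 : ℚ) a = single q a at ha
    by_cases h0 : a = 0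
    · subst h0
      simpa using isHom_zero q
    obtain rfl : 0 = q := by
      by_contra hq
      have := congr_arg (fun p => p.coeff q) ha
      simp [AddMonoidAlgebra.coeff_single, hq] at this
      exact h0 this.symm
    simpa using (isHom_one (X := P.toGrAlg)).smul a
  · exact fun q a ha => by simpa using ha

instance : CommMonoid Cls where
  mul := Quotient.map₂ tensor (fun _ _ h _ _ h' => h.tensor h')
  one := Quotient.mk _ pt
  mul_assoc a b c := by
    induction a using Quotient.inductionOn
    induction b using Quotient.inductionOn
    induction c using Quotient.inductionOn
    exact Quotient.sound (tensor_assoc _ _ _)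
  mul_comm a b := by
    induction a using Quotient.inductionOn
    induction b using Quotient.inductionOn
    exact Quotient.sound (tensor_comm _ _)
  one_mul a := by
    induction a using Quotient.inductionOn
    exact Quotient.sound (pt_tensor _)
  mul_one a := by
    induction a using Quotient.inductionOn
    exact Quotient.sound ((tensor_comm _ _).trans (pt_tensor _))

/-- The product with an affine line on which `G_m` acts linearly, with the same function. -/
abbrev poly (P : PotVar) (q : ℚ) : PotVar where
  toGrAlg := P.toGrAlg.poly q
  f := Polynomial.C P.f
  hf := isGr_polyC _ q _ _ P.hf

/-- The product with the affine line, with the coordinate of the line as the function. -/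
abbrev pull (X : GrAlg ℚ) : PotVar where
  toGrAlg := X.poly 1
  f := Polynomial.X
  hf := isHom_polyX X 1

/-- The free abelian group on isomorphism classes, with the product of classes. -/
abbrev Free : Type 1 := FreeAbelianGroup Cls

/-- The isomorphism class. -/
def cls (P : PotVar) : Cls := Quotient.mk setoid P

/-- The generator of an isomorphism class. -/
def of (P : PotVar) : Free := FreeAbelianGroup.of (cls P)

theorem of_eq {P Q : PotVar} (h : Iso P Q) : of P = of Q :=
  congr_arg FreeAbelianGroup.of (Quotient.sound h)

theorem of_mul (P Q : PotVar) : of P * of Q = of (P.tensor Q) :=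
  (FreeAbelianGroup.of_mul_of (cls P) (cls Q)).symm

/-- The relations in the Grothendieck ring of varieties with homogeneous functions: scissor
relations, independence of the linear action on a line, and the vanishing of the classes that are
pulled back from a point along `𝔸¹ → pt`. -/
inductive Rel : Free → Prop
  | scissors (P Z U : PotVar) (g : P.A) (φ : P.A →ₐ[ℂ] Z.A) (ψ : P.A →ₐ[ℂ] U.A)
      (h : IsScissors P.toGrAlg Z.toGrAlg U.toGrAlg g φ ψ) (hφ : φ P.f = Z.f) (hψ : ψ P.f = U.f) :
      Rel (of P - of Z - of U)
  | line (P : PotVar) (q r : ℚ) : Rel (of (P.poly q) - of (P.poly r))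
  | pull (X : GrAlg ℚ) : Rel (of (pull X))

open Polynomial in
/-- `X[x] ⊗ W = (X ⊗ W)[x]`. -/
def polyTensor (A B : Type) [CommRing A] [Algebra ℂ A] [CommRing B] [Algebra ℂ B] :
    A[X] ⊗[ℂ] B ≃ₐ[ℂ] (A ⊗[ℂ] B)[X] :=
  AlgEquiv.ofAlgHom
    (Algebra.TensorProduct.lift (Polynomial.mapAlgHom Algebra.TensorProduct.includeLeft)
      (Polynomial.CAlgHom.comp Algebra.TensorProduct.includeRight) (fun _ _ => Commute.all _ _))
    (Polynomial.eval₂AlgHom (Algebra.TensorProduct.map Polynomial.CAlgHom (AlgHom.id ℂ B))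
      (Polynomial.X ⊗ₜ 1) (fun _ => Commute.all _ _))
    (by
      refine Polynomial.algHom_ext' ?_ (by simp [← Algebra.TensorProduct.one_def])
      refine Algebra.TensorProduct.ext ?_ ?_ <;> ext a : 1 <;>
        simp [← Algebra.TensorProduct.one_def])
    (by
      refine Algebra.TensorProduct.ext ?_ ?_
      · refine Polynomial.algHom_ext' ?_ (by simp)
        ext a; simp
      · ext a; simp)

theorem isGr_polyTensor (X W : GrAlg ℚ) (q : ℚ) :
    IsGr (X := (X.poly q).tensor W) (Y := (X.tensor W).poly q)
      (polyTensor X.A W.A : Polynomial X.A ⊗[ℂ] W.A →ₐ[ℂ] Polynomial (X.A ⊗[ℂ] W.A)) := by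
  apply isGr_tensor
  · apply isGr_poly
    · intro r a ha
      simpa [polyTensor, ← Algebra.TensorProduct.one_def] using isGr_polyC (X.tensor W) q _ _ (isGr_inclLeft X W _ _ ha)
    · simpa [polyTensor, ← Algebra.TensorProduct.one_def] using isHom_polyX (X.tensor W) q
  · intro r a ha
    simpa [polyTensor] using isGr_polyC (X.tensor W) q _ _ (isGr_inclRight X W _ _ ha)

theorem poly_tensor (P W : PotVar) (q : ℚ) :
    Iso ((P.poly q).tensor W) ((P.tensor W).poly q) :=
  ⟨polyTensor P.A W.A, isGr_polyTensor _ _ q, by simp [polyTensor, ← Algebra.TensorProduct.one_def]⟩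

theorem pull_tensor (X : GrAlg ℚ) (W : PotVar) :
    Iso ((pull X).tensor W) (pull (X.tensor W.toGrAlg)) := by
  refine Iso.trans (Q := ⟨(X.tensor W.toGrAlg).poly 1, Polynomial.X + Polynomial.C (1 ⊗ₜ[ℂ] W.f),
      (isHom_polyX _ 1).add (isGr_polyC (X.tensor W.toGrAlg) _ _ _
        (isGr_inclRight X W.toGrAlg _ _ W.hf))⟩)
    ⟨polyTensor X.A W.A, isGr_polyTensor _ _ 1, by simp [polyTensor, ← Algebra.TensorProduct.one_def]⟩ ?_
  refine ⟨Polynomial.algEquivAevalXAddC (- (1 ⊗ₜ[ℂ] W.f)) |>.restrictScalars ℂ, ?_, ?_⟩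
  · apply isGr_poly
    · intro r a ha
      simpa using isGr_polyC (X.tensor W.toGrAlg) 1 _ _ ha
    · simpa [← sub_eq_add_neg] using (isHom_polyX (X.tensor W.toGrAlg) 1).sub (isGr_polyC (X.tensor W.toGrAlg) _ _ _
        (isGr_inclRight X W.toGrAlg _ _ W.hf))
  · simp

theorem Rel.mul {r : Free} (h : Rel r) (W : PotVar) : Rel (r * of W) := by
  cases h with
  | scissors P Z U g φ ψ h hφ hψ =>
    rw [sub_mul, sub_mul, of_mul, of_mul, of_mul]
    exact Rel.scissors _ _ _ _ _ _ (h.tensor W.toGrAlg) (by simp [hφ]) (by simp [hψ])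
  | line P q r =>
    rw [sub_mul, of_mul, of_mul, of_eq (poly_tensor _ _ _), of_eq (poly_tensor _ _ _)]
    exact Rel.line _ q r
  | pull X =>
    rw [of_mul, of_eq (pull_tensor _ _)]
    exact Rel.pull _

/-- The Grothendieck ring of varieties with homogeneous functions, with the product
`[X, f] [Y, g] = [X × Y, f + g]`. -/
def K : Type 1 := Free ⧸ Ideal.span {r : Free | Rel r}

instance : CommRing K := inferInstanceAs (CommRing (Free ⧸ Ideal.span {r : Free | Rel r}))

/-- The projection. -/
def proj : Free →+* K := Ideal.Quotient.mk (Ideal.span {r : Free | Rel r})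

/-- The class. -/
def cl (P : PotVar) : K := proj (of P)

theorem free_induction {p : Free → Prop} (h0 : p 0) (h1 : ∀ P, p (of P)) (h2 : ∀ a, p a → p (-a))
    (h3 : ∀ a b, p a → p b → p (a + b)) (a : Free) : p a :=
  FreeAbelianGroup.induction_on a h0 (fun c => Quotient.inductionOn c h1)
    (fun c _ => Quotient.inductionOn c fun P => h2 _ (h1 P)) h3

theorem mem_span_iff {r : Free} :
    r ∈ Ideal.span {r : Free | Rel r} ↔ r ∈ AddSubgroup.closure {r : Free | Rel r} := by
  constructor
  · intro h
    induction h using Submodule.span_induction with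
    | mem x h => exact AddSubgroup.subset_closure h
    | zero => exact zero_mem _
    | add x y _ _ hx hy => exact add_mem hx hy
    | smul a x h0 hx =>
      clear h0
      induction hx using AddSubgroup.closure_induction with
      | mem x h =>
        induction a using free_induction with
        | h0 => simp
        | h1 P => rw [smul_eq_mul, mul_comm]; exact AddSubgroup.subset_closure (Rel.mul h P)
        | h2 a h => rw [neg_smul]; exact neg_mem h
        | h3 a b h h' => rw [add_smul]; exact add_mem h h'
      | zero => rw [smul_zero]; exact zero_mem _
      | add x y _ _ hx hy => rw [smul_add]; exact add_mem hx hy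
      | neg x _ hx => rw [smul_neg]; exact neg_mem hx
  · intro h
    induction h using AddSubgroup.closure_induction with
    | mem x h => exact Ideal.subset_span h
    | zero => exact zero_mem _
    | add x y _ _ hx hy => exact add_mem hx hy
    | neg x _ hx => exact neg_mem hx

theorem cl_eq {P Q : PotVar} (h : Iso P Q) : cl P = cl Q :=
  congr_arg proj (of_eq h)

theorem cl_mul (P Q : PotVar) : cl P * cl Q = cl (P.tensor Q) := by
  rw [cl, cl, cl, ← map_mul, of_mul]

theorem mk_rel {r : Free} (h : Rel r) : proj r = 0 :=
  Ideal.Quotient.eq_zero_iff_mem.2 (Ideal.subset_span h)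

theorem cl_scissors {P Z U : PotVar} {g : P.A} {φ : P.A →ₐ[ℂ] Z.A} {ψ : P.A →ₐ[ℂ] U.A}
    (h : IsScissors P.toGrAlg Z.toGrAlg U.toGrAlg g φ ψ) (hφ : φ P.f = Z.f) (hψ : ψ P.f = U.f) :
    cl P = cl Z + cl U := by
  have := mk_rel (Rel.scissors P Z U g φ ψ h hφ hψ)
  rw [map_sub, map_sub, sub_sub, sub_eq_zero] at this
  exact this

theorem cl_line (P : PotVar) (q r : ℚ) : cl (P.poly q) = cl (P.poly r) := by
  have := mk_rel (Rel.line P q r)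
  rwa [map_sub, sub_eq_zero] at this

theorem cl_pull (X : GrAlg ℚ) : cl (pull X) = 0 := mk_rel (Rel.pull X)

/-- Additive maps out of `Free`. -/
def freeLift {M : Type*} [AddCommGroup M] (F : PotVar → M) (hiso : ∀ P Q, Iso P Q → F P = F Q) :
    Free →+ M := FreeAbelianGroup.lift (Quotient.lift F hiso)

theorem freeLift_of {M : Type*} [AddCommGroup M] (F : PotVar → M) (hiso) (P : PotVar) :
    freeLift F hiso (of P) = F P :=
  FreeAbelianGroup.lift_apply_of _ _

/-- Additive maps out of `K`. -/
def lift {M : Type*} [AddCommGroup M] (F : PotVar → M) (hiso : ∀ P Q, Iso P Q → F P = F Q)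
    (hrel : ∀ r, Rel r → freeLift F hiso r = 0) : K →+ M :=
  QuotientAddGroup.lift _ (freeLift F hiso) (by
    intro r hr
    replace hr : r ∈ Ideal.span {r : Free | Rel r} := hr
    rw [mem_span_iff] at hr
    change freeLift F hiso r = 0
    induction hr using AddSubgroup.closure_induction with
    | mem x h => exact hrel x h
    | zero => exact map_zero _
    | add x y _ _ hx hy => rw [map_add, hx, hy, add_zero]
    | neg x _ hx => rw [map_neg, hx, neg_zero])

theorem lift_cl {M : Type*} [AddCommGroup M] (F : PotVar → M) (hiso hrel) (P : PotVar) :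
    lift F hiso hrel (cl P) = F P :=
  freeLift_of F hiso P

theorem hom_ext {M : Type*} [AddCommGroup M] {F G : K →+ M} (h : ∀ P, F (cl P) = G (cl P)) :
    F = G := by
  ext a
  obtain ⟨a, rfl⟩ := Ideal.Quotient.mk_surjective a
  change F (proj a) = G (proj a)
  induction a using free_induction with
  | h0 => simp
  | h1 P => exact h P
  | h2 a h => simp [h]
  | h3 a b h h' => simp [h, h']

end PotVar

/-- The character group of `μ̂ = lim μ_n`. -/
abbrev QZ : Type := ℚ ⧸ AddSubgroup.zmultiples (1 : ℚ)

/-- The restriction of characters from the torus to `μ̂`. -/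
abbrev QZ.mk : ℚ →+ QZ := QuotientAddGroup.mk' _

theorem QZ.mk_one : QZ.mk 1 = 0 :=
  (QuotientAddGroup.eq_zero_iff _).2 (AddSubgroup.mem_zmultiples 1)

/-- Affine varieties with a good action of `μ̂ = lim μ_n`. -/
abbrev MuVar : Type 1 := GrAlg QZ

namespace MuVar

open FreeAbelianGroup (of)
open GrAlg

/-- The relations in the Grothendieck group of `μ̂`-varieties: isomorphisms, scissor relations,
and independence of the linear action on an affine line. -/
inductive Rel : FreeAbelianGroup MuVar → Prop
  | iso (X Y : MuVar) (h : Iso X Y) : Rel (of X - of Y)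
  | scissors (X Z U : MuVar) (g : X.A) (φ : X.A →ₐ[ℂ] Z.A) (ψ : X.A →ₐ[ℂ] U.A)
      (h : IsScissors X Z U g φ ψ) : Rel (of X - of Z - of U)
  | line (X : MuVar) (q r : QZ) : Rel (of (X.poly q) - of (X.poly r))

/-- The Grothendieck group `K₀^μ̂(Var_ℂ)` of varieties with a good action of `μ̂`. -/
def K0 : Type 1 := FreeAbelianGroup MuVar ⧸ AddSubgroup.closure {r | Rel r}

instance : AddCommGroup K0 :=
  inferInstanceAs (AddCommGroup (FreeAbelianGroup MuVar ⧸ AddSubgroup.closure {r | Rel r}))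

/-- The projection from the free group. -/
def proj : FreeAbelianGroup MuVar →+ K0 := QuotientAddGroup.mk' _

/-- The class `[X]`. -/
def cl (X : MuVar) : K0 := proj (of X)

theorem proj_rel {r : FreeAbelianGroup MuVar} (h : Rel r) : proj r = 0 :=
  (QuotientAddGroup.eq_zero_iff _).2 (AddSubgroup.subset_closure h)

theorem cl_eq {X Y : MuVar} (h : Iso X Y) : cl X = cl Y := by
  have := proj_rel (Rel.iso X Y h)
  rwa [map_sub, sub_eq_zero] at this

theorem cl_scissors {X Z U : MuVar} {g : X.A} {φ : X.A →ₐ[ℂ] Z.A} {ψ : X.A →ₐ[ℂ] U.A}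
    (h : IsScissors X Z U g φ ψ) : cl X = cl Z + cl U := by
  have := proj_rel (Rel.scissors X Z U g φ ψ h)
  rwa [map_sub, map_sub, sub_sub, sub_eq_zero] at this

theorem cl_line (X : MuVar) (q r : QZ) : cl (X.poly q) = cl (X.poly r) := by
  have := proj_rel (Rel.line X q r)
  rwa [map_sub, sub_eq_zero] at this

/-- The universal property. -/
def lift {M : Type*} [AddCommGroup M] (F : MuVar → M)
    (hrel : ∀ r, Rel r → FreeAbelianGroup.lift F r = 0) : K0 →+ M :=
  QuotientAddGroup.lift _ (FreeAbelianGroup.lift F) ((AddSubgroup.closure_le _).2 hrel)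

theorem lift_cl {M : Type*} [AddCommGroup M] (F : MuVar → M) (hrel) (X : MuVar) :
    lift F hrel (cl X) = F X :=
  FreeAbelianGroup.lift_apply_of _ _

theorem hom_ext {M : Type*} [AddCommGroup M] {F G : K0 →+ M} (h : ∀ X, F (cl X) = G (cl X)) :
    F = G := by
  have : F.comp proj = G.comp proj := FreeAbelianGroup.lift_ext _ _ fun X => h X
  ext a
  obtain ⟨a, rfl⟩ := QuotientAddGroup.mk'_surjective _ a
  exact DFunLike.congr_fun this a

end MuVar

namespace GrAlg

variable {Γ Γ' : Type} [AddCommGroup Γ] [AddCommGroup Γ'] {X Y Z U : GrAlg Γ}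

theorem IsGr.of_comp_surj {φ : X.A →ₐ[ℂ] Y.A} {ψ : Y.A →ₐ[ℂ] Z.A} (hφ : IsGr φ)
    (hs : Function.Surjective φ) (h : IsGr (ψ.comp φ)) : IsGr ψ := by
  intro q b hb
  obtain ⟨a, rfl⟩ := hs b
  rw [← hb.comp_self, hφ.comp_apply]
  exact h q _ (isHom_comp q a)

theorem IsGr.push (h : Γ →+ Γ') {φ : X.A →ₐ[ℂ] Y.A} (hφ : IsGr φ) :
    IsGr (X := X.push h) (Y := Y.push h) φ := by
  obtain ⟨S, -, hS, hq⟩ := X.gen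
  refine isGr_of_adjoin (X := X.push h) (Y := Y.push h) hS fun s hs => ?_
  obtain ⟨q, hq⟩ := hq s hs
  exact ⟨h q, IsHom.push h hq, (hφ q s hq).push h⟩

/-- The induced map between the closed subvarieties. -/
def quotMap (φ : X.A →ₐ[ℂ] Y.A) {g : X.A} {q : Γ} (hg : X.IsHom q g) {g' : Y.A}
    {q' : Γ} (hg' : Y.IsHom q' g') (e : φ g = g') : (X.quot g hg).A →ₐ[ℂ] (Y.quot g' hg').A :=
  Ideal.Quotient.liftₐ _ ((Y.toQuot g' hg').comp φ) (by
    intro a ha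
    obtain ⟨b, rfl⟩ := Ideal.mem_span_singleton'.1 ha
    rw [AlgHom.comp_apply, toQuot_eq_zero, map_mul, e]
    exact ⟨φ b, mul_comm _ _⟩)

section
variable {φ : X.A →ₐ[ℂ] Y.A} {g : X.A} {q : Γ} {hg : X.IsHom q g} {g' : Y.A}
    {q' : Γ} {hg' : Y.IsHom q' g'} {e : φ g = g'}

theorem quotMap_toQuot (a : X.A) :
    quotMap φ hg hg' e (X.toQuot g hg a) = Y.toQuot g' hg' (φ a) := rfl

theorem isGr_quotMap (hφ : IsGr φ) : IsGr (quotMap φ hg hg' e) := by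
  refine IsGr.of_comp_surj (isGr_toQuot X g hg) (toQuot_surjective X g hg) ?_
  exact (isGr_toQuot Y g' hg').comp hφ

end

theorem IsScissors.push (h : Γ →+ Γ') {g : X.A} {φ : X.A →ₐ[ℂ] Z.A} {ψ : X.A →ₐ[ℂ] U.A}
    (hs : IsScissors X Z U g φ ψ) :
    IsScissors (X.push h) (Z.push h) (U.push h) g φ ψ where
  hom := by obtain ⟨q, hq⟩ := hs.hom; exact ⟨_, hq.push h⟩
  grφ := hs.grφ.push h
  grψ := hs.grψ.push h
  surj := hs.surj
  ker := hs.ker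
  loc := hs.loc

theorem IsScissors.quot {g : X.A} {φ : X.A →ₐ[ℂ] Z.A} {ψ : X.A →ₐ[ℂ] U.A}
    (hs : IsScissors X Z U g φ ψ) {f : X.A} {r : Γ} (hf : X.IsHom r f) {f₁ : Z.A}
    {r₁ : Γ} (hf₁ : Z.IsHom r₁ f₁) (e₁ : φ f = f₁) {f₂ : U.A}
    {r₂ : Γ} (hf₂ : U.IsHom r₂ f₂) (e₂ : ψ f = f₂) :
    IsScissors (X.quot f hf) (Z.quot f₁ hf₁) (U.quot f₂ hf₂) (X.toQuot f hf g)
      (quotMap φ hf hf₁ e₁) (quotMap ψ hf hf₂ e₂) := by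
  obtain ⟨q, hq⟩ := hs.hom
  refine IsScissors.mk' (isGr_toQuot _ _ _ _ _ hq) (isGr_quotMap hs.grφ) (isGr_quotMap hs.grψ)
    ?_ ?_ ?_ ?_ ?_ ?_
  · intro z
    obtain ⟨z, rfl⟩ := toQuot_surjective _ _ _ z
    obtain ⟨a, rfl⟩ := hs.surj z
    exact ⟨X.toQuot f hf a, rfl⟩
  · rw [quotMap_toQuot, hs.map_g, map_zero]
  · intro a ha
    obtain ⟨a, rfl⟩ := toQuot_surjective _ _ _ a
    rw [quotMap_toQuot, toQuot_eq_zero] at ha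
    obtain ⟨b, hb⟩ := ha
    obtain ⟨b, rfl⟩ := hs.surj b
    rw [← e₁, ← map_mul, ← sub_eq_zero, ← map_sub] at hb
    obtain ⟨c, hc⟩ := hs.ker' _ hb
    refine ⟨X.toQuot f hf c, ?_⟩
    rw [← map_mul, ← hc, map_sub, eq_comm, sub_eq_self, toQuot_eq_zero]
    exact ⟨b, rfl⟩
  · rw [quotMap_toQuot]
    exact hs.unit.map _
  · intro u
    obtain ⟨u, rfl⟩ := toQuot_surjective _ _ _ u
    obtain ⟨n, a, h⟩ := hs.lsurj u
    exact ⟨n, X.toQuot f hf a, by rw [quotMap_toQuot, quotMap_toQuot, ← h, map_mul, map_pow]⟩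
  · intro a ha
    obtain ⟨a, rfl⟩ := toQuot_surjective _ _ _ a
    rw [quotMap_toQuot, toQuot_eq_zero] at ha
    obtain ⟨b, hb⟩ := ha
    obtain ⟨n, c, hc⟩ := hs.lsurj b
    have : ψ (g ^ n * a - f * c) = 0 := by
      rw [map_sub, map_mul, map_mul, map_pow, hb, ← hc, e₂]; ring
    obtain ⟨m, hm⟩ := hs.lker _ this
    refine ⟨m + n, ?_⟩
    rw [← map_pow, ← map_mul, toQuot_eq_zero]
    exact ⟨g ^ m * c, by linear_combination hm⟩

theorem iso_quot {φ : X.A →ₐ[ℂ] Z.A} (gr : IsGr φ) (surj : Function.Surjective φ) {g : X.A} {q : Γ}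
    (hg : X.IsHom q g) (ker : ∀ a, φ a = 0 ↔ g ∣ a) : Iso (X.quot g hg) Z := by
  let f : (X.quot g hg).A →ₐ[ℂ] Z.A := Ideal.Quotient.liftₐ _ φ (fun a ha =>
    (ker a).2 (Ideal.mem_span_singleton.1 ha))
  have e : ∀ a, f (X.toQuot g hg a) = φ a := fun a => rfl
  refine ⟨AlgEquiv.ofBijective f ⟨?_, ?_⟩, ?_⟩
  · rw [injective_iff_map_eq_zero]
    intro a ha
    obtain ⟨a, rfl⟩ := toQuot_surjective _ _ _ a
    rw [e, ker] at ha
    exact toQuot_eq_zero.2 ha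
  · intro z
    obtain ⟨a, rfl⟩ := surj z
    exact ⟨_, e a⟩
  · exact IsGr.of_comp_surj (isGr_toQuot X g hg) (toQuot_surjective X g hg) gr

theorem Iso.quot {e : X.A ≃ₐ[ℂ] Y.A} (he : IsGr (e : X.A →ₐ[ℂ] Y.A)) {g : X.A} {q : Γ}
    (hg : X.IsHom q g) {g' : Y.A} {q' : Γ} (hg' : Y.IsHom q' g') (h1 : e g = g') :
    Iso (X.quot g hg) (Y.quot g' hg') := by
  refine iso_quot (φ := (Y.toQuot g' hg').comp (e : X.A →ₐ[ℂ] Y.A))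
    ((isGr_toQuot _ _ _).comp he) ((toQuot_surjective _ _ _).comp e.surjective) _ fun a => ?_
  rw [AlgHom.comp_apply, toQuot_eq_zero, ← h1]
  constructor
  · rintro ⟨b, hb⟩
    exact ⟨e.symm b, e.injective (by rw [map_mul, e.apply_symm_apply]; exact hb)⟩
  · rintro ⟨b, rfl⟩
    exact ⟨e b, map_mul e _ _⟩

theorem co_poly_push (X : GrAlg Γ) (h : Γ →+ Γ') (q : Γ) :
    ((X.poly q).push h).co = ((X.push h).poly (h q)).co := by
  have hX : (X.poly q).IsHom q Polynomial.X := isHom_polyX X q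
  refine Polynomial.algHom_ext' ?_ ((hX.push h).trans (isHom_polyX (X.push h) (h q)).symm)
  refine AlgHom.ext fun a => ?_
  induction a using hom_induction with
  | hom r a ha =>
    exact (IsHom.push h (isGr_polyC X q r a ha)).trans
      (isGr_polyC (X.push h) (h q) _ _ (ha.push h)).symm
  | add a b ha hb => rw [map_add, map_add, ha, hb]

theorem isGr_poly_push {h : Γ →+ Γ'} {q : Γ} {Z : GrAlg Γ'} {φ : Polynomial X.A →ₐ[ℂ] Z.A}
    (h1 : IsGr (X := X.push h) (Y := Z) (φ.comp Polynomial.CAlgHom))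
    (h2 : Z.IsHom (h q) (φ Polynomial.X)) : IsGr (X := (X.poly q).push h) (Y := Z) φ := by
  intro r a ha
  refine isGr_poly (X := X.push h) h1 h2 r a ?_
  rw [IsHom, ← co_poly_push]
  exact ha

end GrAlg

namespace PotVar

open GrAlg

theorem hom_sub (P : PotVar) (c : ℂ) :
    (P.toGrAlg.push QZ.mk).IsHom 0 (P.f - algebraMap ℂ P.A c) :=
  IsHom.sub (QZ.mk_one ▸ P.hf.push QZ.mk) (isHom_algebraMap c)

/-- The fibre `f = c` with its action of `μ̂`. -/
abbrev fib (P : PotVar) (c : ℂ) : MuVar :=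
  (P.toGrAlg.push QZ.mk).quot (P.f - algebraMap ℂ P.A c) (P.hom_sub c)

theorem fib_iso {P Q : PotVar} (h : Iso P Q) (c : ℂ) : GrAlg.Iso (P.fib c) (Q.fib c) := by
  obtain ⟨e, he, hf⟩ := h
  exact GrAlg.Iso.quot (he.push QZ.mk) _ _ (by simp [hf])

theorem fib_poly (P : PotVar) (q : ℚ) (c : ℂ) :
    GrAlg.Iso ((P.poly q).fib c) ((P.fib c).poly (QZ.mk q)) := by
  refine iso_quot (φ := (Polynomial.mapAlgHom (Ideal.Quotient.mkₐ ℂ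
    (Ideal.span {P.f - algebraMap ℂ P.A c})))) ?_ ?_ _ ?_
  · apply isGr_poly_push
    · intro r a ha
      rw [AlgHom.comp_apply, Polynomial.CAlgHom_apply, Polynomial.coe_mapAlgHom, Polynomial.map_C]
      exact isGr_polyC (P.fib c) (QZ.mk q) _ _ (isGr_toQuot _ _ (P.hom_sub c) _ _ ha)
    · simpa using isHom_polyX (P.fib c) (QZ.mk q)
  · exact Polynomial.map_surjective _ Ideal.Quotient.mk_surjective
  · intro p
    have e : (P.poly q).f - algebraMap ℂ (Polynomial P.A) c =
      Polynomial.C (P.f - algebraMap ℂ P.A c) := by simp [Polynomial.algebraMap_apply]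
    rw [e, Polynomial.C_dvd_iff_dvd_coeff, Polynomial.ext_iff]
    simp [Ideal.Quotient.eq_zero_iff_mem, Ideal.mem_span_singleton]

theorem fib_pull (X : GrAlg ℚ) (c : ℂ) :
    GrAlg.Iso ((pull X).fib c) (X.push QZ.mk) := by
  refine iso_quot (φ := Polynomial.eval₂AlgHom (AlgHom.id ℂ X.A) (algebraMap ℂ X.A c)
    (fun _ => Commute.all _ _)) ?_ ?_ _ ?_
  · apply isGr_poly_push
    · intro r a ha
      simpa using ha
    · rw [QZ.mk_one]
      simpa using isHom_algebraMap (X := X.push QZ.mk) c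
  · exact fun a => ⟨Polynomial.C a, by simp⟩
  · intro p
    change Polynomial.eval₂ (RingHom.id X.A) (algebraMap ℂ X.A c) p = 0 ↔
      Polynomial.X - algebraMap ℂ (Polynomial X.A) c ∣ p
    rw [Polynomial.algebraMap_apply, Polynomial.dvd_iff_isRoot, Polynomial.IsRoot,
      ← Polynomial.eval₂_id]

/-- `[X, f] ↦ [f = 0] - [f = 1]`. -/
def phi : K →+ MuVar.K0 :=
  lift (fun P => MuVar.cl (P.fib 0) - MuVar.cl (P.fib 1))
    (fun P Q h => by rw [MuVar.cl_eq (fib_iso h 0), MuVar.cl_eq (fib_iso h 1)])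
    (by
      intro r hr
      cases hr with
      | scissors P Z U g φ ψ h hφ hψ =>
        have e (c) : MuVar.cl (P.fib c) = MuVar.cl (Z.fib c) + MuVar.cl (U.fib c) :=
          MuVar.cl_scissors ((h.push QZ.mk).quot (P.hom_sub c) (Z.hom_sub c) (by simp [hφ])
            (U.hom_sub c) (by simp [hψ]))
        rw [map_sub, map_sub, freeLift_of, freeLift_of, freeLift_of, e, e]
        abel
      | line P q r =>
        have e (c) : MuVar.cl ((P.poly q).fib c) = MuVar.cl ((P.poly r).fib c) := by
          rw [MuVar.cl_eq (fib_poly P q c), MuVar.cl_eq (fib_poly P r c), MuVar.cl_line]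
        rw [map_sub, freeLift_of, freeLift_of, e, e, sub_self]
      | pull X =>
        rw [freeLift_of, MuVar.cl_eq (fib_pull X 0), MuVar.cl_eq (fib_pull X 1), sub_self])

theorem phi_cl (P : PotVar) : phi (cl P) = MuVar.cl (P.fib 0) - MuVar.cl (P.fib 1) :=
  lift_cl _ _ _ P

end PotVar

section restrict

variable {Γ A : Type} [AddCommGroup Γ] [CommRing A] [Algebra ℂ A]
  (co : A →ₐ[ℂ] AddMonoidAlgebra A Γ) (F : Subalgebra ℂ A)

theorem mapAlgHom_val_injective : Function.Injective (mapAlgHom Γ F.val) :=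
  AddMonoidAlgebra.map_injective (F.val : F →+ A) Subtype.val_injective

theorem restrict_aux (hF : ∀ a ∈ F, ∀ q, (co a).coeff q ∈ F) (a : F) :
    (co.comp F.val) a ∈ (mapAlgHom Γ F.val).range := by
  have : co a ∈ Set.range (AddMonoidAlgebra.map (M := Γ) (F.val : F →+ A)) := by
    rw [AddMonoidAlgebra.range_map]
    exact fun q => ⟨⟨_, hF a a.2 q⟩, rfl⟩
  exact this

/-- Restriction of a coaction to a subalgebra that is stable under taking components. -/
def restrictCo (hF : ∀ a ∈ F, ∀ q, (co a).coeff q ∈ F) : F →ₐ[ℂ] AddMonoidAlgebra F Γ :=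
  ((AlgEquiv.ofInjective (mapAlgHom Γ F.val) (mapAlgHom_val_injective F)).symm :
    (mapAlgHom Γ F.val).range →ₐ[ℂ] AddMonoidAlgebra F Γ).comp
    ((co.comp F.val).codRestrict (mapAlgHom Γ F.val).range (restrict_aux co F hF))

theorem restrictCo_spec (hF : ∀ a ∈ F, ∀ q, (co a).coeff q ∈ F) (a : F) :
    mapAlgHom Γ F.val (restrictCo co F hF a) = co a := by
  have := (AlgEquiv.ofInjective (mapAlgHom Γ F.val) (mapAlgHom_val_injective F)).apply_symm_apply
    (((co.comp F.val).codRestrict (mapAlgHom Γ F.val).range (restrict_aux co F hF)) a)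
  exact congr_arg Subtype.val this

theorem restrictCo_eq_single (hF : ∀ a ∈ F, ∀ q, (co a).coeff q ∈ F) {a : F} {q : Γ} :
    restrictCo co F hF a = single q a ↔ co a = single q (a : A) := by
  rw [← (mapAlgHom_val_injective (Γ := Γ) F).eq_iff, restrictCo_spec,
    AddMonoidAlgebra.mapAlgHom_single]
  rfl

end restrict

namespace MuVar

open GrAlg

theorem eq_sum_single {B Γ : Type} [CommRing B] (p : AddMonoidAlgebra B Γ) :
    p = ∑ q ∈ p.coeff.support, single q (p.coeff q) := by
  classical
  ext q
  simp only [AddMonoidAlgebra.coeff_sum, AddMonoidAlgebra.coeff_single, Finsupp.finsetSum_apply,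
    Finsupp.single_apply]
  rw [Finset.sum_ite_eq' p.coeff.support q]
  split_ifs with h
  · rfl
  · simpa using h

/-- The coordinate ring `⨁ q : ℚ, (functions on Y of degree q mod ℤ) z^q` of `G_m ×^μ̂ Y`. -/
def total (B : MuVar) : Subalgebra ℂ (AddMonoidAlgebra B.A ℚ) where
  carrier := {p | ∀ q, B.IsHom (QZ.mk q) (p.coeff q)}
  add_mem' := fun {p r} hp hr q => by
    rw [AddMonoidAlgebra.coeff_add]; exact (hp q).add (hr q)
  mul_mem' := fun {p r} hp hr q => by
    classical
    rw [eq_sum_single p, eq_sum_single r, Finset.sum_mul_sum]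
    simp only [AddMonoidAlgebra.coeff_sum, Finsupp.finsetSum_apply,
      AddMonoidAlgebra.single_mul_single, AddMonoidAlgebra.coeff_single]
    refine isHom_sum _ _ fun i _ => isHom_sum _ _ fun j _ => ?_
    rw [Finsupp.single_apply]
    split_ifs with h
    · rw [← h, map_add]; exact (hp i).mul (hr j)
    · exact isHom_zero _
  algebraMap_mem' := fun c q => by
    classical
    rw [Algebra.algebraMap_eq_smul_one, AddMonoidAlgebra.one_def, AddMonoidAlgebra.smul_single,
      AddMonoidAlgebra.coeff_single, Finsupp.single_apply]
    split_ifs with h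
    · rw [← h, map_zero]; exact isHom_one.smul c
    · exact isHom_zero _

theorem mem_total {B : MuVar} {p : AddMonoidAlgebra B.A ℚ} :
    p ∈ B.total ↔ ∀ q, B.IsHom (QZ.mk q) (p.coeff q) := Iff.rfl

theorem single_mem_total {B : MuVar} {q : ℚ} {b : B.A} (h : B.IsHom (QZ.mk q) b) :
    single q b ∈ B.total := by
  classical
  intro r
  rw [AddMonoidAlgebra.coeff_single, Finsupp.single_apply]
  split_ifs with e
  · exact e ▸ h
  · exact isHom_zero _

/-- `b z^q ↦ b z^q ⊗ T^q`. -/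
def bigCo (B : Type) [CommRing B] [Algebra ℂ B] :
    AddMonoidAlgebra B ℚ →ₐ[ℂ] AddMonoidAlgebra (AddMonoidAlgebra B ℚ) ℚ :=
  AddMonoidAlgebra.liftNCAlgHom
    (AddMonoidAlgebra.singleZeroAlgHom.comp AddMonoidAlgebra.singleZeroAlgHom)
    { toFun := fun q => single q.toAdd (single q.toAdd 1)
      map_one' := rfl
      map_mul' := fun q r => by simp [AddMonoidAlgebra.single_mul_single] }
    (fun _ _ => Commute.all _ _)

theorem bigCo_single (B : Type) [CommRing B] [Algebra ℂ B] (q : ℚ) (b : B) :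
    bigCo B (single q b) = single q (single q b) := by
  simp [bigCo, AddMonoidAlgebra.single_mul_single]

theorem bigCo_coeff (B : Type) [CommRing B] [Algebra ℂ B] (p : AddMonoidAlgebra B ℚ) (q : ℚ) :
    (bigCo B p).coeff q = single q (p.coeff q) := by
  classical
  rw [eq_sum_single p]
  simp only [map_sum, bigCo_single, AddMonoidAlgebra.coeff_sum, Finsupp.finsetSum_apply,
    AddMonoidAlgebra.coeff_single, Finsupp.single_apply]
  rw [Finset.sum_ite_eq' p.coeff.support q, Finset.sum_ite_eq' p.coeff.support q]
  split_ifs <;> simp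

theorem bigCo_mem (B : MuVar) : ∀ p ∈ B.total, ∀ q, (bigCo B.A p).coeff q ∈ B.total :=
  fun p hp q => by rw [bigCo_coeff]; exact single_mem_total (hp q)

/-- The powers of `z`. -/
theorem z_mem (B : MuVar) {q : ℚ} (hq : QZ.mk q = 0) :
    (single q 1 : AddMonoidAlgebra B.A ℚ) ∈ B.total :=
  single_mem_total (by rw [hq]; exact isHom_one)

theorem comp_mul_eq {Γ : Type} [AddCommGroup Γ] {X : GrAlg Γ} (q : Γ) (a b : X.A) :
    X.comp q (a * b) = ∑ r ∈ X.degs a, X.comp r a * X.comp (q - r) b := by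
  have h : ∀ s : Finset Γ, X.comp q ((∑ r ∈ s, X.comp r a) * b) =
      ∑ r ∈ s, X.comp r a * X.comp (q - r) b := by
    classical
    intro s
    induction s using Finset.induction_on with
    | empty => simp [comp_zero]
    | insert i s hi ih =>
      rw [Finset.sum_insert hi, Finset.sum_insert hi, add_mul, comp_add, ih]
      have := (isHom_comp i a).comp_mul (q - i) b
      rw [sub_add_cancel, mul_comm] at this
      rw [this, mul_comm]
  rw [← h, sum_comp]

/-- A section of `ℚ → ℚ/ℤ`. -/
def QZ.sec (q : QZ) : ℚ := Function.surjInv (QuotientAddGroup.mk'_surjective _) q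

theorem QZ.mk_sec (q : QZ) : QZ.mk (QZ.sec q) = q :=
  Function.surjInv_eq (QuotientAddGroup.mk'_surjective _) q

theorem QZ.exists_int {q : ℚ} (h : QZ.mk q = 0) : ∃ n : ℤ, q = n := by
  obtain ⟨n, hn⟩ := AddSubgroup.mem_zmultiples_iff.1 ((QuotientAddGroup.eq_zero_iff _).1 h)
  exact ⟨n, by simpa using hn.symm⟩

theorem adjoin_aux {A : Type} [CommRing A] [Algebra ℂ A] (F : Subalgebra ℂ A) (G : Set A)
    (h1 : G ⊆ F) (h2 : F ≤ Algebra.adjoin ℂ G) :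
    Algebra.adjoin ℂ (F.val ⁻¹' G) = ⊤ := by
  rw [eq_top_iff]
  intro p _
  have h3 : (Algebra.adjoin ℂ (F.val ⁻¹' G)).map F.val = Algebra.adjoin ℂ G := by
    rw [AlgHom.map_adjoin, Set.image_preimage_eq_of_subset]
    simpa using h1
  obtain ⟨p', hp', e⟩ : (p : A) ∈ (Algebra.adjoin ℂ (F.val ⁻¹' G)).map F.val := by
    rw [h3]; exact h2 p.2
  rwa [← Subtype.val_injective e]

theorem total_gen (B : MuVar) : ∃ G : Set (AddMonoidAlgebra B.A ℚ), G.Finite ∧ G ⊆ B.total ∧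
    B.total ≤ Algebra.adjoin ℂ G ∧ ∀ g ∈ G, ∃ q, bigCo B.A g = single q g := by
  classical
  obtain ⟨S, hf, hS, hq⟩ := B.gen
  choose! d hd using hq
  let G : Set (AddMonoidAlgebra B.A ℚ) :=
    {single 1 1, single (-1) 1} ∪ (fun s => single (QZ.sec (d s)) s) '' S
  have hz : ∀ q, QZ.mk q = 0 → (single q 1 : AddMonoidAlgebra B.A ℚ) ∈ Algebra.adjoin ℂ G := by
    intro q h
    obtain ⟨n, rfl⟩ := QZ.exists_int h
    obtain ⟨n, rfl | rfl⟩ := n.eq_nat_or_neg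
    · have : (single ((n : ℤ) : ℚ) 1 : AddMonoidAlgebra B.A ℚ) = single 1 1 ^ n := by
        rw [AddMonoidAlgebra.single_pow]; simp
      rw [this]
      exact pow_mem (Algebra.subset_adjoin (by simp [G])) n
    · have : (single ((-n : ℤ) : ℚ) 1 : AddMonoidAlgebra B.A ℚ) = single (-1) 1 ^ n := by
        rw [AddMonoidAlgebra.single_pow]; simp
      rw [this]
      exact pow_mem (Algebra.subset_adjoin (by simp [G])) n
  have key : ∀ (b : B.A) (q : ℚ), single q (B.comp (QZ.mk q) b) ∈ Algebra.adjoin ℂ G := by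
    intro b
    have hb : b ∈ Algebra.adjoin ℂ S := by rw [hS]; trivial
    induction hb using Algebra.adjoin_induction with
    | mem s hs =>
      intro q
      by_cases h : d s = QZ.mk q
      · rw [← h, IsHom.comp_self (hd s hs)]
        have : single q s = single (QZ.sec (d s)) s * single (q - QZ.sec (d s)) 1 := by
          rw [AddMonoidAlgebra.single_mul_single]; simp
        rw [this]
        refine mul_mem (Algebra.subset_adjoin (Or.inr ⟨s, hs, rfl⟩)) (hz _ ?_)
        rw [map_sub, QZ.mk_sec, h, sub_self]
      · rw [IsHom.comp_ne (hd s hs) h, AddMonoidAlgebra.single_zero]; exact zero_mem _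
    | algebraMap c =>
      intro q
      by_cases h : 0 = QZ.mk q
      · rw [← h, (isHom_algebraMap c).comp_self, Algebra.algebraMap_eq_smul_one,
          ← AddMonoidAlgebra.smul_single]
        exact Subalgebra.smul_mem _ (hz q h.symm) c
      · rw [IsHom.comp_ne (isHom_algebraMap c) h, AddMonoidAlgebra.single_zero]; exact zero_mem _
    | add x y _ _ hx hy =>
      intro q
      rw [comp_add, AddMonoidAlgebra.single_add]
      exact add_mem (hx q) (hy q)
    | mul x y _ _ hx hy =>
      intro q
      rw [comp_mul_eq]
      have : single q (∑ r ∈ B.degs x, B.comp r x * B.comp (QZ.mk q - r) y) =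
          ∑ r ∈ B.degs x, single (QZ.sec r) (B.comp (QZ.mk (QZ.sec r)) x) *
            single (q - QZ.sec r) (B.comp (QZ.mk (q - QZ.sec r)) y) := by
        have e := map_sum (AddMonoidAlgebra.singleAddHom (R := B.A) q)
          (fun r => B.comp r x * B.comp (QZ.mk q - r) y) (B.degs x)
        refine e.trans (Finset.sum_congr rfl fun r _ => ?_)
        rw [AddMonoidAlgebra.single_mul_single, map_sub, QZ.mk_sec, add_sub_cancel]
        rfl
      rw [this]
      exact sum_mem fun r _ => mul_mem (hx _) (hy _)
  refine ⟨G, ?_, ?_, ?_, ?_⟩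
  · exact (Set.toFinite _).union (hf.image _)
  · rintro _ ((rfl | rfl) | ⟨s, hs, rfl⟩)
    · exact B.z_mem QZ.mk_one
    · exact B.z_mem (by rw [map_neg, QZ.mk_one, neg_zero])
    · exact single_mem_total (by rw [QZ.mk_sec]; exact hd s hs)
  · intro p hp
    rw [eq_sum_single p]
    refine sum_mem fun q _ => ?_
    rw [← (hp q).comp_self]
    exact key _ q
  · rintro _ ((rfl | rfl) | ⟨s, hs, rfl⟩)
    · exact ⟨_, bigCo_single _ _ _⟩
    · exact ⟨_, bigCo_single _ _ _⟩
    · exact ⟨_, bigCo_single _ _ _⟩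

/-- The variety `G_m ×^μ̂ Y`, with the function `z`, whose fibre over `1` is `Y`. -/
abbrev tot (B : MuVar) : PotVar where
  A := B.total
  co := restrictCo (bigCo B.A) B.total B.bigCo_mem
  gen := by
    obtain ⟨G, hf, h1, h2, h3⟩ := B.total_gen
    refine ⟨B.total.val ⁻¹' G, hf.preimage Subtype.val_injective.injOn, adjoin_aux _ _ h1 h2, ?_⟩
    intro g hg
    obtain ⟨q, hq⟩ := h3 _ hg
    exact ⟨q, (restrictCo_eq_single (bigCo B.A) B.total B.bigCo_mem).2 hq⟩
  f := ⟨single 1 1, B.z_mem QZ.mk_one⟩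
  hf := (restrictCo_eq_single (bigCo B.A) B.total B.bigCo_mem).2 (bigCo_single _ _ _)

end MuVar

namespace MuVar

open GrAlg

/-- The function `b z^q`. -/
def tz (B : MuVar) (q : ℚ) (b : B.A) (h : B.IsHom (QZ.mk q) b) : B.total :=
  ⟨single q b, single_mem_total h⟩

theorem total_induction {B : MuVar} {P : B.total → Prop} (h1 : ∀ q b h, P (B.tz q b h))
    (h2 : ∀ p r, P p → P r → P (p + r)) (p : B.total) : P p := by
  classical
  have key : ∀ s : Finset ℚ, P (∑ q ∈ s, B.tz q (p.1.coeff q) (p.2 q)) := by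
    intro s
    induction s using Finset.induction_on with
    | empty =>
      have := h1 0 0 (isHom_zero _)
      rw [Finset.sum_empty]
      convert this
      exact Subtype.ext (by simp [tz])
    | insert i s hi ih => rw [Finset.sum_insert hi]; exact h2 _ _ (h1 _ _ _) ih
  have e : p = ∑ q ∈ p.1.coeff.support, B.tz q (p.1.coeff q) (p.2 q) := by
    refine Subtype.ext ?_
    refine (eq_sum_single p.1).trans ?_
    rw [AddSubmonoidClass.coe_finsetSum]
    rfl
  rw [e]; exact key _

theorem tot_isHom_iff {B : MuVar} {p : B.total} {q : ℚ} :
    B.tot.IsHom q p ↔ (p : AddMonoidAlgebra B.A ℚ) = single q (p.1.coeff q) := by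
  refine (restrictCo_eq_single (bigCo B.A) B.total B.bigCo_mem).trans ⟨fun h => ?_, fun h => ?_⟩
  · have := congr_arg (fun t => t.coeff q) h
    simpa [bigCo_coeff, AddMonoidAlgebra.coeff_single] using this.symm
  · rw [h, bigCo_single]

theorem tz_isHom {B : MuVar} (q : ℚ) (b : B.A) (h : B.IsHom (QZ.mk q) b) :
    B.tot.IsHom q (B.tz q b h) := by
  rw [tot_isHom_iff]; simp [tz, AddMonoidAlgebra.coeff_single]

theorem tz_add {B : MuVar} (q : ℚ) (b b' : B.A) (h : B.IsHom (QZ.mk q) b)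
    (h' : B.IsHom (QZ.mk q) b') : B.tz q b h + B.tz q b' h' = B.tz q (b + b') (h.add h') :=
  Subtype.ext (AddMonoidAlgebra.single_add _ _ _).symm

theorem tz_mul {B : MuVar} (q r : ℚ) (b b' : B.A) (h : B.IsHom (QZ.mk q) b)
    (h' : B.IsHom (QZ.mk r) b') : B.tz q b h * B.tz r b' h' =
      B.tz (q + r) (b * b') (by rw [map_add]; exact h.mul h') :=
  Subtype.ext (AddMonoidAlgebra.single_mul_single ..)

theorem tz_pow {B : MuVar} (q : ℚ) (b : B.A) (h : B.IsHom (QZ.mk q) b) (n : ℕ) :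
    B.tz q b h ^ n = B.tz (n • q) (b ^ n) (by rw [map_nsmul]; exact h.pow n) :=
  Subtype.ext (AddMonoidAlgebra.single_pow ..)

theorem tz_congr {B : MuVar} {q q' : ℚ} {b b' : B.A} {h : B.IsHom (QZ.mk q) b}
    {h' : B.IsHom (QZ.mk q') b'} (e : q = q') (e' : b = b') : B.tz q b h = B.tz q' b' h' := by
  subst e; subst e'; rfl

theorem tz_one (B : MuVar) : B.tz 0 1 (by rw [map_zero]; exact isHom_one) = 1 := rfl

theorem tz_zero (B : MuVar) (q : ℚ) : B.tz q 0 (isHom_zero _) = 0 :=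
  Subtype.ext (AddMonoidAlgebra.single_zero q)

variable {B C D : MuVar}

/-- Functoriality of the total space. -/
def totMap (φ : B.A →ₐ[ℂ] C.A) (hφ : IsGr φ) : B.total →ₐ[ℂ] C.total :=
  ((mapAlgHom ℚ φ).comp B.total.val).codRestrict C.total (fun p q => by
    change C.IsHom (QZ.mk q) ((mapAlgHom ℚ φ p.1).coeff q)
    rw [AddMonoidAlgebra.coeff_mapAlgHom]
    exact hφ _ _ (p.2 q))

theorem totMap_tz {φ : B.A →ₐ[ℂ] C.A} {hφ : IsGr φ} (q : ℚ) (b : B.A)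
    (h : B.IsHom (QZ.mk q) b) : totMap φ hφ (B.tz q b h) = C.tz q (φ b) (hφ _ _ h) :=
  Subtype.ext (AddMonoidAlgebra.mapAlgHom_single ..)

theorem totMap_coeff {φ : B.A →ₐ[ℂ] C.A} {hφ : IsGr φ} (p : B.total) (q : ℚ) :
    (totMap φ hφ p).1.coeff q = φ (p.1.coeff q) :=
  AddMonoidAlgebra.coeff_mapAlgHom ..

theorem isGr_totMap (φ : B.A →ₐ[ℂ] C.A) (hφ : IsGr φ) :
    IsGr (X := B.tot.toGrAlg) (Y := C.tot.toGrAlg) (totMap φ hφ) := by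
  intro q p hp
  rw [tot_isHom_iff] at *
  rw [totMap_coeff]
  have : p = B.tz q (p.1.coeff q) (p.2 q) := Subtype.ext hp
  conv_lhs => rw [this, totMap_tz]
  rfl

theorem totMap_f (φ : B.A →ₐ[ℂ] C.A) (hφ : IsGr φ) : totMap φ hφ B.tot.f = C.tot.f := by
  refine (totMap_tz 1 1 (by rw [QZ.mk_one]; exact isHom_one)).trans ?_
  exact tz_congr (h' := by rw [QZ.mk_one]; exact isHom_one) rfl (map_one φ)

theorem tot_iso (h : Iso B C) : PotVar.Iso B.tot C.tot := by
  obtain ⟨e, he⟩ := h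
  refine ⟨AlgEquiv.ofAlgHom (totMap (e : B.A →ₐ[ℂ] C.A) he)
    (totMap (e.symm : C.A →ₐ[ℂ] B.A) he.symm) ?_ ?_, isGr_totMap (e : B.A →ₐ[ℂ] C.A) he, totMap_f (e : B.A →ₐ[ℂ] C.A) he⟩
  · refine AlgHom.ext fun p => Subtype.ext ?_
    ext q
    refine (totMap_coeff (hφ := he) _ q).trans ?_
    refine (congr_arg e (totMap_coeff (hφ := he.symm) p q)).trans ?_
    exact e.apply_symm_apply _
  · refine AlgHom.ext fun p => Subtype.ext ?_
    ext q
    refine (totMap_coeff (hφ := he.symm) _ q).trans ?_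
    refine (congr_arg e.symm (totMap_coeff (hφ := he) p q)).trans ?_
    exact e.symm_apply_apply _

theorem tot_scissors {g : B.A} {φ : B.A →ₐ[ℂ] C.A} {ψ : B.A →ₐ[ℂ] D.A}
    (h : IsScissors B C D g φ ψ) :
    ∃ g', IsScissors B.tot.toGrAlg C.tot.toGrAlg D.tot.toGrAlg g' (totMap φ h.grφ)
      (totMap ψ h.grψ) := by
  classical
  obtain ⟨q₁, hg⟩ := h.hom
  obtain ⟨q₀, rfl⟩ := QuotientAddGroup.mk'_surjective _ q₁
  change B.IsHom (QZ.mk q₀) g at hg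
  refine ⟨B.tz q₀ g hg, IsScissors.mk' (tz_isHom _ _ _) (isGr_totMap _ _) (isGr_totMap _ _)
    ?_ ?_ ?_ ?_ ?_ ?_⟩
  · intro z
    induction z using total_induction with
    | h1 q b hb =>
      obtain ⟨a, ha⟩ := h.surj b
      refine ⟨B.tz q (B.comp (QZ.mk q) a) (isHom_comp _ _), ?_⟩
      rw [totMap_tz]
      exact tz_congr rfl (by rw [← h.grφ.comp_apply, ha, hb.comp_self])
    | h2 p r hp hr =>
      obtain ⟨p, rfl⟩ := hp
      obtain ⟨r, rfl⟩ := hr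
      exact ⟨p + r, map_add _ _ _⟩
  · rw [totMap_tz]
    exact (tz_congr rfl h.map_g).trans (tz_zero C q₀)
  · intro p hp
    have h0 : ∀ q, ∃ b, p.1.coeff q = g * b := fun q => by
      refine h.ker' _ ?_
      rw [← totMap_coeff (hφ := h.grφ), hp]; simp
    choose b hb using h0
    refine ⟨∑ q ∈ p.1.coeff.support, B.tz (q - q₀) (B.comp (QZ.mk (q - q₀)) (b q))
      (isHom_comp _ _), Subtype.ext ?_⟩
    rw [Finset.mul_sum, AddSubmonoidClass.coe_finsetSum]
    refine (eq_sum_single p.1).trans (Finset.sum_congr rfl fun q _ => ?_)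
    refine congr_arg Subtype.val (a₁ := B.tz q _ (p.2 q)) ?_
    rw [tz_mul]
    refine tz_congr (by ring) ?_
    have := hg.comp_mul (QZ.mk (q - q₀)) (b q)
    rw [← map_add, sub_add_cancel, mul_comm, ← hb, (p.2 q).comp_self, mul_comm] at this
    exact this
  · obtain ⟨u, hu⟩ := h.unit
    have hg' : D.IsHom (QZ.mk q₀) (ψ g) := h.grψ _ _ hg
    have h1 := hg'.comp_mul (QZ.mk (-q₀)) (↑u⁻¹ : D.A)
    rw [← map_add, neg_add_cancel, map_zero, ← hu, Units.inv_mul, isHom_one.comp_self, hu] at h1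
    rw [totMap_tz]
    refine IsUnit.of_mul_eq_one (D.tz (-q₀) (D.comp (QZ.mk (-q₀)) (↑u⁻¹ : D.A))
      (isHom_comp _ _)) ?_
    rw [tz_mul]
    refine (tz_congr (by ring) ?_).trans (tz_one D)
    rw [mul_comm]; exact h1.symm
  · intro u
    induction u using total_induction with
    | h1 q b hb =>
      obtain ⟨n, a, ha⟩ := h.lsurj b
      have hd : D.IsHom (QZ.mk (q + n • q₀)) (b * ψ g ^ n) := by
        rw [map_add, map_nsmul]; exact hb.mul ((h.grψ _ _ hg).pow n)
      refine ⟨n, B.tz (q + n • q₀) (B.comp _ a) (isHom_comp _ _), ?_⟩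
      rw [totMap_tz, totMap_tz, tz_pow, tz_mul]
      refine tz_congr rfl ?_
      rw [← h.grψ.comp_apply, ← ha, hd.comp_self]
    | h2 p r hp hr =>
      obtain ⟨n, a, ha⟩ := hp
      obtain ⟨m, b, hb⟩ := hr
      refine ⟨n + m, a * B.tz q₀ g hg ^ m + b * B.tz q₀ g hg ^ n, ?_⟩
      rw [map_add, map_mul, map_mul, map_pow, map_pow, ← ha, ← hb]
      ring
  · intro p hp
    have h0 : ∀ q, ∃ n, g ^ n * p.1.coeff q = 0 := fun q => by
      refine h.lker _ ?_
      rw [← totMap_coeff (hφ := h.grψ), hp]; simp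
    choose n hn using h0
    refine ⟨∑ q ∈ p.1.coeff.support, n q, Subtype.ext ?_⟩
    have e : p = ∑ q ∈ p.1.coeff.support, B.tz q (p.1.coeff q) (p.2 q) := by
      refine Subtype.ext ?_
      refine (eq_sum_single p.1).trans ?_
      rw [AddSubmonoidClass.coe_finsetSum]
      rfl
    have h1 : ∀ q ∈ p.1.coeff.support, g ^ (∑ q ∈ p.1.coeff.support, n q) * p.1.coeff q = 0 := by
      intro q hq
      rw [← Finset.sum_erase_add _ _ hq, pow_add, mul_assoc, hn, mul_zero]
    refine congr_arg Subtype.val (a₂ := (0 : B.total)) ?_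
    generalize (∑ q ∈ p.1.coeff.support, n q) = N at h1
    generalize p.1.coeff.support = S at e h1
    refine (congr_arg (B.tz q₀ g hg ^ N * ·) e).trans ?_
    rw [Finset.mul_sum]
    refine Finset.sum_eq_zero fun q hq => ?_
    rw [tz_pow, tz_mul]
    exact (tz_congr rfl (h1 q hq)).trans (tz_zero B _)

theorem comp_poly {Γ : Type} [AddCommGroup Γ] (X : GrAlg Γ) (q s : Γ) (p : Polynomial X.A) (n : ℕ) :
    Polynomial.coeff ((X.poly q).comp s p) n = X.comp (s - n • q) (p.coeff n) := by
  induction p using Polynomial.induction_on' with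
  | add p r hp hr =>
    rw [comp_add, Polynomial.coeff_add, Polynomial.coeff_add, comp_add, hp, hr]
  | monomial m a =>
    induction a using hom_induction (X := X) with
    | hom r a ha =>
      have h1 : (X.poly q).IsHom (r + m • q) (Polynomial.monomial m a) := by
        rw [← Polynomial.C_mul_X_pow_eq_monomial]
        exact (isGr_polyC X q _ _ ha).mul ((isHom_polyX X q).pow m)
      by_cases hm : m = n
      · subst hm
        rw [Polynomial.coeff_monomial_same]
        by_cases hs : r + m • q = s
        · rw [← hs, h1.comp_self, add_sub_cancel_right, ha.comp_self,
            Polynomial.coeff_monomial_same]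
        · rw [h1.comp_ne hs, ha.comp_ne (fun h => hs (by rw [h, sub_add_cancel]))]
          rfl
      · rw [Polynomial.coeff_monomial_of_ne _ (Ne.symm hm), comp_zero]
        by_cases hs : r + m • q = s
        · rw [← hs, h1.comp_self, Polynomial.coeff_monomial_of_ne _ (Ne.symm hm)]
        · rw [h1.comp_ne hs]; rfl
    | add a b ha hb =>
      rw [map_add, comp_add, Polynomial.coeff_add, Polynomial.coeff_add, comp_add, ha, hb]

theorem tot_line (B : MuVar) (q : ℚ) :
    PotVar.Iso (B.tot.poly q) (tot (B.poly (QZ.mk q))) := by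
  classical
  let i := totMap (B := B) (C := B.poly (QZ.mk q)) Polynomial.CAlgHom (isGr_polyC B _)
  let y := tz (B.poly (QZ.mk q)) q Polynomial.X (isHom_polyX B _)
  have hy : (tot (B.poly (QZ.mk q))).IsHom q y := tz_isHom _ _ _
  have hmon : ∀ m r (b : B.A) (hb : B.IsHom (QZ.mk r) b),
      ((Polynomial.eval₂ (i : B.total →+* _) y (Polynomial.monomial m (B.tz r b hb))).1 :
        AddMonoidAlgebra (Polynomial B.A) ℚ) = single (r + m • q) (Polynomial.monomial m b) := by
    intro m r b hb
    rw [Polynomial.eval₂_monomial]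
    change (totMap (B := B) (C := B.poly (QZ.mk q)) Polynomial.CAlgHom (isGr_polyC B _) _ * y ^ m).1 = _
    rw [totMap_tz, tz_pow, tz_mul]
    change single _ _ = _
    rw [← Polynomial.C_mul_X_pow_eq_monomial]
    rfl
  have key : ∀ (p : Polynomial B.total) (s : ℚ) (n : ℕ),
      Polynomial.coeff ((Polynomial.eval₂ (i : B.total →+* _) y p).1.coeff s) n =
        (p.coeff n).1.coeff (s - n • q) := by
    intro p s n
    induction p using Polynomial.induction_on' with
    | add p r hp hr =>
      rw [Polynomial.eval₂_add, Polynomial.coeff_add]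
      change Polynomial.coeff ((_ + _ : AddMonoidAlgebra (Polynomial B.A) ℚ).coeff s) n =
        (_ + _ : AddMonoidAlgebra B.A ℚ).coeff _
      rw [AddMonoidAlgebra.coeff_add, AddMonoidAlgebra.coeff_add, Finsupp.add_apply,
        Finsupp.add_apply, Polynomial.coeff_add, hp, hr]
    | monomial m a =>
      induction a using total_induction with
      | h1 r b hb =>
        rw [hmon]
        by_cases hm : m = n
        · subst hm
          rw [Polynomial.coeff_monomial_same]
          change _ = (single r b : AddMonoidAlgebra B.A ℚ).coeff _
          rw [AddMonoidAlgebra.coeff_single, AddMonoidAlgebra.coeff_single, Finsupp.single_apply,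
            Finsupp.single_apply]
          by_cases hs : r + m • q = s
          · rw [if_pos hs, if_pos (eq_sub_of_add_eq hs), Polynomial.coeff_monomial_same]
          · rw [if_neg hs, if_neg (fun h => hs (add_eq_of_eq_sub h))]; rfl
        · rw [Polynomial.coeff_monomial_of_ne _ (Ne.symm hm), AddMonoidAlgebra.coeff_single,
            Finsupp.single_apply]
          split_ifs
          · rw [Polynomial.coeff_monomial_of_ne _ (Ne.symm hm)]; rfl
          · rfl
      | h2 a b ha hb =>
        rw [map_add, Polynomial.eval₂_add, Polynomial.coeff_add]
        change Polynomial.coeff ((_ + _ : AddMonoidAlgebra (Polynomial B.A) ℚ).coeff s) n =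
          (_ + _ : AddMonoidAlgebra B.A ℚ).coeff _
        rw [AddMonoidAlgebra.coeff_add, AddMonoidAlgebra.coeff_add, Finsupp.add_apply,
          Finsupp.add_apply, Polynomial.coeff_add, ha, hb]
  have hl : IsLine B.tot.toGrAlg (tot (B.poly (QZ.mk q))).toGrAlg i y := by
    refine ⟨⟨q, hy⟩, isGr_totMap _ _, ?_, ?_⟩
    · intro p p' hp
      refine Polynomial.ext fun n => Subtype.ext ?_
      ext r
      have h1 := key p (r + n • q) n
      have h2 := key p' (r + n • q) n
      rw [add_sub_cancel_right] at h1 h2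
      rw [← h1, ← h2]
      exact congr_arg (fun t : total (B.poly (QZ.mk q)) => Polynomial.coeff (t.1.coeff (r + n • q)) n) hp
    · intro u
      change ∃ a, Polynomial.eval₂ (i : B.total →+* _) y a = u
      induction u using total_induction with
      | h1 s P hP =>
        have hc : ∀ n, B.IsHom (QZ.mk (s - n • q)) (Polynomial.coeff P n) := fun n => by
          rw [map_sub, map_nsmul, ← hP.comp_self, comp_poly]
          exact isHom_comp _ _
        refine ⟨∑ n ∈ Polynomial.support P, Polynomial.monomial n (B.tz _ _ (hc n)), ?_⟩
        rw [Polynomial.eval₂_finsetSum]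
        refine Subtype.ext ?_
        rw [AddSubmonoidClass.coe_finsetSum]
        simp only [hmon, sub_add_cancel]
        change _ = AddMonoidAlgebra.singleAddHom s P
        conv_rhs => rw [Polynomial.as_sum_support P]
        rw [map_sum]
        rfl
      | h2 p r hp hr =>
        obtain ⟨p, rfl⟩ := hp
        obtain ⟨r, rfl⟩ := hr
        exact ⟨p + r, Polynomial.eval₂_add _ _⟩
  obtain ⟨e, he, h1, -⟩ := hl.iso hy
  exact ⟨e, he, (h1 _).trans (totMap_f _ _)⟩

end MuVar

namespace MuVar

open GrAlg

/-- `[Y] ↦ -[G_m ×^μ̂ Y, z]`. -/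
def psi : K0 →+ PotVar.K :=
  lift (fun B => - PotVar.cl B.tot) (by
    intro r hr
    cases hr with
    | iso X Y h =>
      rw [map_sub, FreeAbelianGroup.lift_apply_of, FreeAbelianGroup.lift_apply_of,
        PotVar.cl_eq (tot_iso h), sub_self]
    | scissors X Z U g φ ψ h =>
      obtain ⟨g', hg'⟩ := tot_scissors h
      rw [map_sub, map_sub, FreeAbelianGroup.lift_apply_of, FreeAbelianGroup.lift_apply_of,
        FreeAbelianGroup.lift_apply_of, PotVar.cl_scissors hg' (totMap_f _ _) (totMap_f _ _)]
      abel
    | line X q r =>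
      obtain ⟨q, rfl⟩ := QuotientAddGroup.mk'_surjective _ q
      obtain ⟨r, rfl⟩ := QuotientAddGroup.mk'_surjective _ r
      rw [map_sub, FreeAbelianGroup.lift_apply_of, FreeAbelianGroup.lift_apply_of,
        ← PotVar.cl_eq (tot_line X q), ← PotVar.cl_eq (tot_line X r), PotVar.cl_line _ q r,
        sub_self])

theorem psi_cl (B : MuVar) : psi (cl B) = - PotVar.cl B.tot := lift_cl _ _ B

theorem tot_f (B : MuVar) :
    B.tot.f = B.tz 1 1 (by rw [QZ.mk_one]; exact isHom_one) := rfl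

theorem mk_nat (n : ℕ) : QZ.mk (n : ℚ) = 0 := by
  rw [← nsmul_one, map_nsmul, QZ.mk_one, smul_zero]

theorem z_pow (B : MuVar) (n : ℕ) :
    B.tot.f ^ n = B.tz n 1 (by rw [mk_nat]; exact isHom_one) := by
  rw [tot_f, tz_pow]
  exact tz_congr (by simp) (one_pow n)

theorem z_unit (B : MuVar) : IsUnit B.tot.f := by
  refine IsUnit.of_mul_eq_one (B.tz (-1) 1 (by
    rw [map_neg, QZ.mk_one, neg_zero]; exact isHom_one)) ?_
  rw [tot_f, tz_mul]
  exact (tz_congr (by ring) (one_mul 1)).trans (tz_one B)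

end MuVar

namespace PotVar

open GrAlg MuVar

/-- The map from the functions on `X` to the functions on the total space of `f = 1`. -/
def toTot (P : PotVar) : P.A →ₐ[ℂ] (P.fib 1).total :=
  ((mapAlgHom ℚ (Ideal.Quotient.mkₐ ℂ (Ideal.span {P.f - algebraMap ℂ P.A 1}))).comp
    P.co).codRestrict (P.fib 1).total (fun a q => by
      rw [AlgHom.comp_apply, AddMonoidAlgebra.coeff_mapAlgHom]
      exact isGr_toQuot _ _ (P.hom_sub 1) _ _ (IsHom.push QZ.mk (isHom_comp q a)))

/-- Reduction to the fibre. -/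
abbrev toFib (P : PotVar) : P.A →ₐ[ℂ] (P.fib 1).A :=
  Ideal.Quotient.mkₐ ℂ (Ideal.span {P.f - algebraMap ℂ P.A 1})

theorem isGr_toFib (P : PotVar) : IsGr (X := P.toGrAlg.push QZ.mk) (Y := P.fib 1) P.toFib :=
  isGr_toQuot _ _ (P.hom_sub 1)

theorem toFib_hom (P : PotVar) {q : ℚ} {a : P.A} (h : P.IsHom q a) :
    (P.fib 1).IsHom (QZ.mk q) (P.toFib a) := P.isGr_toFib _ _ (h.push QZ.mk)

theorem toFib_eq_zero {P : PotVar} {a : P.A} : P.toFib a = 0 ↔ ∃ b, a = (P.f - 1) * b := by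
  refine (toQuot_eq_zero (X := P.toGrAlg.push QZ.mk) (hg := P.hom_sub 1)).trans ?_
  rw [map_one]

theorem toFib_f (P : PotVar) : P.toFib P.f = 1 := by
  rw [← sub_eq_zero, ← map_one P.toFib, ← map_sub, toFib_eq_zero]
  exact ⟨1, (mul_one _).symm⟩

theorem toTot_coeff (P : PotVar) (a : P.A) (q : ℚ) :
    (P.toTot a).1.coeff q = P.toFib (P.comp q a) :=
  AddMonoidAlgebra.coeff_mapAlgHom ..

theorem toTot_hom {P : PotVar} {q : ℚ} {a : P.A} (h : P.IsHom q a) :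
    P.toTot a = (P.fib 1).tz q (P.toFib a) (P.toFib_hom h) := by
  refine Subtype.ext ?_
  change mapAlgHom ℚ P.toFib (P.co a) = _
  rw [h, AddMonoidAlgebra.mapAlgHom_single]
  rfl

theorem isGr_toTot (P : PotVar) :
    IsGr (X := P.toGrAlg) (Y := (P.fib 1).tot.toGrAlg) P.toTot := by
  intro q a h
  rw [toTot_hom h]
  exact tz_isHom _ _ _

theorem toTot_f (P : PotVar) : P.toTot P.f = (P.fib 1).tot.f := by
  rw [toTot_hom P.hf, tot_f]
  exact tz_congr rfl P.toFib_f

theorem exists_lift (P : PotVar) (a : P.A) (q : ℚ) :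
    ∃ (n : ℕ) (a' : P.A), P.IsHom (q + n) a' ∧ P.toFib a' = (P.fib 1).comp (QZ.mk q) (P.toFib a) := by
  induction a using hom_induction with
  | hom r a ha =>
    by_cases h : QZ.mk r = QZ.mk q
    · rw [← h, (P.toFib_hom ha).comp_self]
      obtain ⟨k, hk⟩ := QZ.exists_int (q := r - q) (by rw [map_sub, h, sub_self])
      obtain ⟨k, rfl | rfl⟩ := k.eq_nat_or_neg
      · refine ⟨k, a, ?_, rfl⟩
        rwa [show q + k = r by push_cast at hk; linarith]
      · refine ⟨0, P.f ^ k * a, ?_, by rw [map_mul, map_pow, toFib_f, one_pow, one_mul]⟩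
        have := (P.hf.pow k).mul ha
        rwa [show k • (1 : ℚ) + r = q + (0 : ℕ) by push_cast at hk; simp; linarith] at this
    · exact ⟨0, 0, isHom_zero _, by rw [(P.toFib_hom ha).comp_ne h, map_zero]⟩
  | add a b ha hb =>
    obtain ⟨n, a', h1, h2⟩ := ha
    obtain ⟨m, b', h3, h4⟩ := hb
    refine ⟨n + m, a' * P.f ^ m + b' * P.f ^ n, ?_, ?_⟩
    · have e1 := h1.mul (P.hf.pow m)
      have e2 := h3.mul (P.hf.pow n)
      have t1 : q + n + m • (1 : ℚ) = q + ((n + m : ℕ) : ℚ) := by push_cast; simp; ring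
      have t2 : q + m + n • (1 : ℚ) = q + ((n + m : ℕ) : ℚ) := by push_cast; simp; ring
      rw [t1] at e1
      rw [t2] at e2
      exact e1.add e2
    · rw [map_add, map_mul, map_mul, map_pow, map_pow, toFib_f, one_pow, one_pow, mul_one, mul_one,
        h2, h4, map_add, comp_add]

theorem hom_killed (P : PotVar) {q : ℚ} {x : P.A} (hx : P.IsHom q x) (h : P.toFib x = 0) :
    ∃ n, P.f ^ n * x = 0 := by
  obtain ⟨b, hb⟩ := toFib_eq_zero.1 h
  have hc : ∀ r, P.comp r x = P.f * P.comp (r - 1) b - P.comp r b := by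
    intro r
    have := P.hf.comp_mul (r - 1) b
    rw [sub_add_cancel] at this
    rw [hb, sub_mul, one_mul, comp_sub, mul_comm P.f b, this, mul_comm]
  have hne : ∀ r, q ≠ r → P.comp r b = P.f * P.comp (r - 1) b := by
    intro r hr
    have := hc r
    rw [hx.comp_ne hr] at this
    exact (sub_eq_zero.1 this.symm).symm
  have fin : ∀ (F : ℕ → ℚ), Function.Injective F → ∃ n, P.comp (F n) b = 0 := by
    intro F hF
    by_contra! hcon
    refine Set.infinite_of_injective_forall_mem hF (s := (P.degs b : Set ℚ)) ?_
      (P.degs b).finite_toSet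
    intro n
    by_contra hn
    exact hcon n (comp_of_notMem hn)
  have up : ∀ n : ℕ, P.comp (q + n) b = P.f ^ n * P.comp q b := by
    intro n
    induction n with
    | zero => simp
    | succ n ih =>
      rw [hne _ (by
        intro h; push_cast at h; have : (0 : ℚ) ≤ n := n.cast_nonneg; linarith), pow_succ', mul_assoc, ← ih]
      congr 2
      push_cast; ring
  have down : ∀ n : ℕ, P.comp (q - 1) b = P.f ^ n * P.comp (q - 1 - n) b := by
    intro n
    induction n with
    | zero => simp
    | succ n ih =>
      rw [ih, hne (q - 1 - n) (by
        intro h; have : (0 : ℚ) ≤ n := n.cast_nonneg; linarith), pow_succ, mul_assoc]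
      congr 3
      push_cast; ring
  obtain ⟨n, hn⟩ := fin (fun n => q + n) (fun a b h => by simpa using h)
  obtain ⟨m, hm⟩ := fin (fun n => q - 1 - n) (fun a b h => by simpa using h)
  refine ⟨n, ?_⟩
  have := hc q
  rw [hx.comp_self, down m, hm, mul_zero, mul_zero, zero_sub] at this
  rw [this, mul_neg, ← up, hn, neg_zero]

theorem toTot_scissors (P : PotVar) :
    IsScissors P.toGrAlg (P.toGrAlg.quot P.f P.hf) (P.fib 1).tot.toGrAlg P.f
      (P.toGrAlg.toQuot P.f P.hf) P.toTot := by
  classical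
  refine IsScissors.mk' P.hf (isGr_toQuot _ _ _) P.isGr_toTot (toQuot_surjective _ _ _)
    (toQuot_eq_zero.2 ⟨1, (mul_one _).symm⟩) (fun a h => toQuot_eq_zero.1 h) ?_ ?_ ?_
  · rw [toTot_f]; exact z_unit _
  · intro u
    rw [toTot_f]
    induction u using total_induction with
    | h1 q b hb =>
      obtain ⟨a, rfl⟩ := Ideal.Quotient.mkₐ_surjective ℂ _ b
      obtain ⟨n, a', h1, h2⟩ := P.exists_lift a q
      refine ⟨n, a', ?_⟩
      rw [z_pow, tz_mul, toTot_hom h1]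
      exact tz_congr rfl (by rw [h2, mul_one]; exact hb.comp_self.symm)
    | h2 p r hp hr =>
      obtain ⟨n, a, ha⟩ := hp
      obtain ⟨m, b, hb⟩ := hr
      refine ⟨n + m, a * P.f ^ m + b * P.f ^ n, ?_⟩
      rw [map_add, map_mul, map_mul, map_pow, map_pow, toTot_f, ← ha, ← hb]
      ring
  · intro a ha
    have h0 : ∀ q, ∃ n, P.f ^ n * P.comp q a = 0 := fun q => by
      refine P.hom_killed (isHom_comp q a) ?_
      rw [← toTot_coeff, ha]; rfl
    choose n hn using h0
    refine ⟨∑ q ∈ P.degs a, n q, ?_⟩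
    conv_lhs => rw [← sum_comp a, Finset.mul_sum]
    refine Finset.sum_eq_zero fun q hq => ?_
    rw [sum_comp a, ← Finset.sum_erase_add _ _ hq, pow_add, mul_assoc, hn, mul_zero]

/-- A variety with potential zero. -/
abbrev zero (X : GrAlg ℚ) : PotVar where
  toGrAlg := X
  f := 0
  hf := isHom_zero 1

theorem cl_eq_add (P : PotVar) :
    cl P = cl (zero (P.toGrAlg.quot P.f P.hf)) + cl (P.fib 1).tot :=
  cl_scissors (Z := zero (P.toGrAlg.quot P.f P.hf)) P.toTot_scissors
    (toQuot_eq_zero.2 ⟨1, (mul_one _).symm⟩) P.toTot_f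

theorem zero_iso {X Y : GrAlg ℚ} (h : GrAlg.Iso X Y) : Iso (zero X) (zero Y) := by
  obtain ⟨e, he⟩ := h
  exact ⟨e, he, map_zero e⟩

theorem cl_zero (X : GrAlg ℚ) : cl (zero X) = - cl (MuVar.tot (X.push QZ.mk)) := by
  have h := cl_eq_add (pull X)
  have e : GrAlg.Iso ((X.poly 1).quot Polynomial.X (isHom_polyX X 1)) X := by
    refine iso_quot (φ := Polynomial.eval₂AlgHom (AlgHom.id ℂ X.A) 0
      (fun _ => Commute.all _ _)) ?_ ?_ _ ?_
    · apply isGr_poly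
      · intro r a ha
        simpa using ha
      · simpa using isHom_zero 1
    · exact fun a => ⟨Polynomial.C a, by simp⟩
    · intro p
      change Polynomial.eval₂ (RingHom.id X.A) 0 p = 0 ↔ Polynomial.X ∣ p
      rw [Polynomial.X_dvd_iff, Polynomial.eval₂_id, Polynomial.coeff_zero_eq_eval_zero]
  rw [cl_pull, cl_eq (zero_iso e), cl_eq (tot_iso (fib_pull X 1))] at h
  exact eq_neg_of_add_eq_zero_left h.symm

theorem fib_zero (P : PotVar) :
    GrAlg.Iso (P.fib 0) ((P.toGrAlg.quot P.f P.hf).push QZ.mk) := by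
  refine iso_quot (X := P.toGrAlg.push QZ.mk) (Z := (P.toGrAlg.quot P.f P.hf).push QZ.mk)
    (φ := P.toGrAlg.toQuot P.f P.hf) ((isGr_toQuot _ _ _).push QZ.mk)
    (toQuot_surjective _ _ _) _ fun a => ?_
  rw [toQuot_eq_zero, map_zero, sub_zero]
  rfl

theorem psi_phi (a : K) : psi (phi a) = a := by
  have : psi.comp phi = AddMonoidHom.id K := by
    refine hom_ext fun P => ?_
    change psi (phi (cl P)) = cl P
    rw [phi_cl, map_sub, psi_cl, psi_cl, cl_eq_add P, cl_zero, cl_eq (tot_iso P.fib_zero)]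
    abel
  exact DFunLike.congr_fun this a

end PotVar

namespace MuVar

open GrAlg

theorem cl_subsingleton {X : MuVar} (h : Subsingleton X.A) : cl X = 0 := by
  have : IsScissors X X X 0 (AlgHom.id ℂ X.A) (AlgHom.id ℂ X.A) := by
    refine IsScissors.mk' (isHom_zero 0) IsGr.id IsGr.id Function.surjective_id
      (Subsingleton.elim _ _) (fun a _ => ⟨0, Subsingleton.elim _ _⟩) (isUnit_of_subsingleton _)
      (fun u => ⟨0, u, Subsingleton.elim _ _⟩) (fun u _ => ⟨0, Subsingleton.elim _ _⟩)
  simpa using cl_scissors this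

/-- Setting `z = 1`. -/
def aug (B : MuVar) : B.total →ₐ[ℂ] B.A :=
  (AddMonoidAlgebra.liftNCAlgHom (AlgHom.id ℂ B.A) (1 : Multiplicative ℚ →* B.A)
    (fun _ _ => Commute.all _ _)).comp B.total.val

theorem aug_tz {B : MuVar} (q : ℚ) (b : B.A) (h : B.IsHom (QZ.mk q) b) :
    B.aug (B.tz q b h) = b := by
  simp [aug, tz]

theorem dvd_aux {B : MuVar} (q : ℚ) (k : ℕ) (b : B.A) (h h') :
    B.tot.f - 1 ∣ B.tz (q + k) b h - B.tz q b h' := by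
  have : B.tz (q + k) b h = B.tz q b h' * B.tot.f ^ k := by
    rw [z_pow, tz_mul]; exact tz_congr rfl (mul_one b).symm
  rw [this, ← mul_sub_one]
  exact Dvd.dvd.mul_left (sub_one_dvd_pow_sub_one _ _) _

theorem dvd_aux' {B : MuVar} (q r : ℚ) (b : B.A) (h h') (hqr : QZ.mk q = QZ.mk r) :
    B.tot.f - 1 ∣ B.tz q b h - B.tz r b h' := by
  obtain ⟨k, hk⟩ := QZ.exists_int (q := q - r) (by rw [map_sub, hqr, sub_self])
  obtain ⟨k, rfl | rfl⟩ := k.eq_nat_or_neg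
  · obtain rfl : q = r + k := by push_cast at hk; linarith
    exact dvd_aux r k b h h'
  · obtain rfl : r = q + k := by push_cast at hk; linarith
    rw [dvd_sub_comm]
    exact dvd_aux q k b h' h

theorem total_eq_sum {B : MuVar} (p : B.total) :
    p = ∑ q ∈ p.1.coeff.support, B.tz q (p.1.coeff q) (p.2 q) := by
  refine Subtype.ext ?_
  refine (eq_sum_single p.1).trans ?_
  rw [AddSubmonoidClass.coe_finsetSum]
  rfl

theorem fib_one_tot (B : MuVar) : GrAlg.Iso (B.tot.fib 1) B := by
  classical
  refine iso_quot (X := B.tot.toGrAlg.push QZ.mk) (φ := B.aug) ?_ ?_ _ ?_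
  · intro q p hp
    rw [← hp.comp_self]
    generalize p = p at *
    clear hp
    induction p using total_induction with
    | h1 r b hb =>
      have h1 := (tz_isHom r b hb).push QZ.mk
      by_cases h : QZ.mk r = q
      · subst h
        rw [h1.comp_self, aug_tz]; exact hb
      · rw [h1.comp_ne h, map_zero]; exact isHom_zero _
    | h2 p r hp hr => rw [comp_add, map_add]; exact hp.add hr
  · intro b
    induction b using hom_induction with
    | hom q b hb =>
      exact ⟨B.tz (QZ.sec q) b (by rwa [QZ.mk_sec]), aug_tz _ _ _⟩
    | add a b ha hb =>
      obtain ⟨a, rfl⟩ := ha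
      obtain ⟨b, rfl⟩ := hb
      exact ⟨a + b, map_add _ _ _⟩
  · intro p
    rw [map_one]
    constructor
    · intro hp
      set S : Finset QZ := p.1.coeff.support.image QZ.mk with hS
      let s : B.A → B.total := fun b => ∑ q ∈ S, B.tz (QZ.sec q) (B.comp q b)
        (by rw [QZ.mk_sec]; exact isHom_comp q b)
      have s0 : s 0 = 0 := Finset.sum_eq_zero fun q _ =>
        (tz_congr (h' := isHom_zero _) rfl (comp_zero q)).trans (tz_zero B _)
      have sadd : ∀ a b, s (a + b) = s a + s b := fun a b => by
        rw [← Finset.sum_add_distrib]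
        refine Finset.sum_congr rfl fun q _ => ?_
        rw [tz_add]
        exact tz_congr rfl (comp_add q a b)
      have ssum : ∀ T : Finset ℚ, s (∑ q ∈ T, p.1.coeff q) = ∑ q ∈ T, s (p.1.coeff q) := by
        intro T
        induction T using Finset.induction_on with
        | empty => simpa using s0
        | insert i T hi ih => rw [Finset.sum_insert hi, Finset.sum_insert hi, sadd, ih]
      have h0 : ∑ q ∈ p.1.coeff.support, p.1.coeff q = 0 := by
        rw [total_eq_sum p, map_sum] at hp
        simpa only [aug_tz] using hp
      have h1 : p = ∑ q ∈ p.1.coeff.support,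
          (B.tz q (p.1.coeff q) (p.2 q) - s (p.1.coeff q)) := by
        rw [Finset.sum_sub_distrib, ← ssum, h0, s0, sub_zero]
        exact total_eq_sum p
      rw [h1]
      refine Finset.dvd_sum fun q hq => ?_
      have h2 : s (p.1.coeff q) = B.tz (QZ.sec (QZ.mk q)) (p.1.coeff q)
          (by rw [QZ.mk_sec]; exact p.2 q) := by
        refine (Finset.sum_eq_single (QZ.mk q) (fun r _ hr => ?_) (fun h => ?_)).trans ?_
        · exact (tz_congr (h' := isHom_zero _) rfl ((p.2 q).comp_ne hr.symm)).trans (tz_zero B _)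
        · exact absurd (Finset.mem_image_of_mem _ hq) h
        · exact tz_congr rfl (p.2 q).comp_self
      rw [h2]
      exact dvd_aux' _ _ _ _ _ (QZ.mk_sec _).symm
    · rintro ⟨r, rfl⟩
      rw [map_mul, map_sub, tot_f, aug_tz, map_one, sub_self, zero_mul]

theorem phi_psi (a : K0) : PotVar.phi (psi a) = a := by
  have : PotVar.phi.comp psi = AddMonoidHom.id K0 := by
    refine hom_ext fun B => ?_
    change PotVar.phi (psi (cl B)) = cl B
    rw [psi_cl, map_neg, PotVar.phi_cl, cl_eq (fib_one_tot B), cl_subsingleton]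
    · abel
    · rw [← not_nontrivial_iff_subsingleton]
      intro hn
      have h1 : IsUnit (((B.tot.toGrAlg.push QZ.mk).toQuot _ (B.tot.hom_sub 0)) B.tot.f) :=
        (z_unit B).map _
      have h2 : ((B.tot.toGrAlg.push QZ.mk).toQuot _ (B.tot.hom_sub 0)) B.tot.f = 0 :=
        toQuot_eq_zero.2 ⟨1, by simp⟩
      rw [h2] at h1
      exact not_isUnit_zero h1
  exact DFunLike.congr_fun this a

end MuVar

namespace MuVar

open GrAlg

/-- The point. -/
abbrev pt : MuVar := GrAlg.triv ℂ inferInstance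

theorem isHom_triv {Γ : Type} [AddCommGroup Γ] {A : Type} [CommRing A] [Algebra ℂ A]
    (h : Algebra.FiniteType ℂ A) (a : A) : (GrAlg.triv (Γ := Γ) A h).IsHom 0 a := rfl

theorem isHom_triv_iff {Γ : Type} [AddCommGroup Γ] {A : Type} [CommRing A] [Algebra ℂ A]
    {h : Algebra.FiniteType ℂ A} {a : A} {q : Γ} (ha : (GrAlg.triv (Γ := Γ) A h).IsHom q a) :
    q = 0 ∨ a = 0 := by
  by_cases h0 : 0 = q
  · exact Or.inl h0.symm
  · exact Or.inr (((isHom_triv h a).eq_zero ha h0))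

theorem isGr_triv {Γ : Type} [AddCommGroup Γ] {A : Type} [CommRing A] [Algebra ℂ A]
    {h : Algebra.FiniteType ℂ A} {X : GrAlg Γ} {φ : A →ₐ[ℂ] X.A}
    (hφ : ∀ a, X.IsHom 0 (φ a)) : IsGr (X := GrAlg.triv A h) φ := by
  intro q a ha
  obtain rfl | rfl := isHom_triv_iff ha
  · exact hφ a
  · rw [map_zero]; exact isHom_zero _

/-- The Grothendieck group of varieties with homogeneous functions is isomorphic to the Grothendieck group of
`μ̂`-varieties. -/
def equiv : PotVar.K ≃+ K0 where
  toFun := PotVar.phi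
  invFun := psi
  left_inv := PotVar.psi_phi
  right_inv := phi_psi
  map_add' := map_add _

theorem fib_pt (c : ℂ) (hc : c ≠ 0) : Subsingleton (PotVar.pt.fib c).A := by
  refine Ideal.Quotient.subsingleton_iff.2 (Ideal.span_singleton_eq_top.2 ?_)
  exact (isUnit_iff_ne_zero (G₀ := ℂ)).2 (by simpa using hc)

theorem fib_pt_zero : Iso (PotVar.pt.fib 0) pt := by
  refine iso_quot (X := PotVar.pt.toGrAlg.push QZ.mk) (φ := AlgHom.id ℂ ℂ) ?_
    Function.surjective_id _ fun a => ?_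
  · intro q a ha
    have h0 : (PotVar.pt.toGrAlg.push QZ.mk).IsHom (QZ.mk 0) a :=
      IsHom.push QZ.mk (isHom_triv (Γ := ℚ) (A := ℂ) inferInstance a)
    by_cases h : QZ.mk 0 = q
    · subst h; rw [map_zero]; exact isHom_triv _ _
    · rw [h0.eq_zero ha h, map_zero]; exact isHom_zero _
  · simp

theorem phi_one : PotVar.phi 1 = cl pt := by
  change PotVar.phi (PotVar.cl PotVar.pt) = _
  rw [PotVar.phi_cl, cl_eq fib_pt_zero, cl_subsingleton (fib_pt 1 one_ne_zero), sub_zero]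

/-- The convolution product on `K₀^μ̂(Var_ℂ)`: the product that corresponds to
`[X, f] [Y, g] = [X × Y, f + g]` under the isomorphism `[X, f] ↦ [f = 0] - [f = 1]`. -/
instance : Mul K0 := ⟨fun a b => PotVar.phi (psi a * psi b)⟩

instance : One K0 := ⟨cl pt⟩

theorem mul_def (a b : K0) : a * b = PotVar.phi (psi a * psi b) := rfl

theorem psi_mul (a b : K0) : psi (a * b) = psi a * psi b := PotVar.psi_phi _

theorem one_def : (1 : K0) = cl pt := rfl

theorem psi_one : psi 1 = 1 := by rw [one_def, ← phi_one, PotVar.psi_phi]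

theorem psi_injective : Function.Injective psi := equiv.symm.injective

instance : CommRing K0 :=
  { (inferInstance : AddCommGroup K0) with
    mul := fun a b => a * b
    one := 1
    mul_assoc := fun a b c => psi_injective (by simp only [psi_mul, mul_assoc])
    mul_comm := fun a b => psi_injective (by simp only [psi_mul, mul_comm])
    one_mul := fun a => psi_injective (by simp only [psi_mul, psi_one, one_mul])
    mul_one := fun a => psi_injective (by simp only [psi_mul, psi_one, mul_one])
    left_distrib := fun a b c => psi_injective (by simp only [psi_mul, map_add, mul_add])
    right_distrib := fun a b c => psi_injective (by simp only [psi_mul, map_add, add_mul])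
    zero_mul := fun a => psi_injective (by simp only [psi_mul, map_zero, zero_mul])
    mul_zero := fun a => psi_injective (by simp only [psi_mul, map_zero, mul_zero]) }

/-- The convolution product in terms of the varieties: with `z` and `w` the functions on
`G_m ×^μ̂ B` and `G_m ×^μ̂ C`, one has `[B] [C] = [z + w = 0] - [z + w = 1]`. -/
theorem cl_mul_cl (B C : MuVar) :
    cl B * cl C = cl ((B.tot.tensor C.tot).fib 0) - cl ((B.tot.tensor C.tot).fib 1) := by
  rw [mul_def, psi_cl, psi_cl, neg_mul_neg, PotVar.cl_mul, PotVar.phi_cl]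

/-- The isomorphism as an isomorphism of rings. -/
def ringEquiv : PotVar.K ≃+* K0 :=
  { equiv with
    map_mul' := fun a b => by
      change PotVar.phi (a * b) = PotVar.phi (psi (PotVar.phi a) * psi (PotVar.phi b))
      rw [PotVar.psi_phi, PotVar.psi_phi] }

theorem ringEquiv_apply (a : PotVar.K) : ringEquiv a = PotVar.phi a := rfl
theorem ringEquiv_symm_apply (a : K0) : ringEquiv.symm a = psi a := rfl

end MuVar

namespace GrAlg

variable {Γ : Type} [AddCommGroup Γ]

/-- The invariant functions of an involution. -/
abbrev inv {A : Type} [CommRing A] [Algebra ℂ A] (τ : A →ₐ[ℂ] A) : Subalgebra ℂ A :=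
  AlgHom.equalizer τ (AlgHom.id ℂ A)

theorem mem_inv {A : Type} [CommRing A] [Algebra ℂ A] {τ : A →ₐ[ℂ] A} {a : A} :
    a ∈ inv τ ↔ τ a = a := Iff.rfl

/-- The average of `a`. -/
def avg {A : Type} [CommRing A] [Algebra ℂ A] (τ : A →ₐ[ℂ] A) (h2 : ∀ a, τ (τ a) = a) (a : A) :
    inv τ := ⟨(1 / 2 : ℂ) • (a + τ a), by
      rw [mem_inv, map_smul, map_add, h2, add_comm]⟩

theorem avg_of_mem {A : Type} [CommRing A] [Algebra ℂ A] {τ : A →ₐ[ℂ] A}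
    {h2 : ∀ a, τ (τ a) = a} {a : A} (h : τ a = a) : (avg τ h2 a : A) = a := by
  simp only [avg, h]
  rw [← two_smul ℂ, smul_smul]; norm_num

theorem inv_gen (X : GrAlg Γ) (τ : X.A →ₐ[ℂ] X.A) (hτ : IsGr τ) (h2 : ∀ a, τ (τ a) = a) :
    ∃ G : Set X.A, G.Finite ∧ G ⊆ inv τ ∧ inv τ ≤ Algebra.adjoin ℂ G ∧
      ∀ g ∈ G, ∃ q, X.co g = single q g := by
  obtain ⟨S, hf, hS, hq⟩ := X.gen
  let D : Set X.A := (fun s => s - τ s) '' S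
  let G : Set X.A := (fun s => s + τ s) '' S ∪ Set.image2 (fun a b => a * b) D D
  have hD : D.Finite := hf.image _
  set B := Algebra.adjoin ℂ G with hB
  let M : Submodule B X.A := Submodule.span B D
  have hMM : ∀ a ∈ M, ∀ b ∈ M, a * b ∈ B := by
    intro a ha b hb
    induction ha using Submodule.span_induction with
    | mem x hx =>
      induction hb using Submodule.span_induction with
      | mem y hy => exact Algebra.subset_adjoin (Or.inr ⟨x, hx, y, hy, rfl⟩)
      | zero => rw [mul_zero]; exact zero_mem _
      | add y z _ _ h1 h2 => rw [mul_add]; exact add_mem h1 h2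
      | smul c y _ h =>
        rw [mul_smul_comm]
        exact mul_mem c.2 h
    | zero => rw [zero_mul]; exact zero_mem _
    | add y z _ _ h1 h2 => rw [add_mul]; exact add_mem h1 h2
    | smul c y _ h =>
      rw [smul_mul_assoc]
      exact mul_mem c.2 h
  have half : ∀ a : X.A, a = (1 / 2 : ℂ) • (a + a) := fun a => by
    rw [← two_smul ℂ, smul_smul]; norm_num
  have hBM : ∀ b ∈ B, ∀ m ∈ M, b * m ∈ M := fun b hb m hm =>
    M.smul_mem (⟨b, hb⟩ : B) hm
  have hcM : ∀ c : ℂ, ∀ m ∈ M, c • m ∈ M := fun c m hm => by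
    rw [Algebra.smul_def]; exact hBM _ (B.algebraMap_mem c) _ hm
  have key : ∀ a : X.A, a + τ a ∈ B ∧ a - τ a ∈ M := by
    intro a
    have ha : a ∈ Algebra.adjoin ℂ S := by rw [hS]; trivial
    induction ha using Algebra.adjoin_induction with
    | mem s hs =>
      exact ⟨Algebra.subset_adjoin (Or.inl ⟨s, hs, rfl⟩), Submodule.subset_span ⟨s, hs, rfl⟩⟩
    | algebraMap c =>
      rw [AlgHom.commutes, sub_self]
      exact ⟨add_mem (B.algebraMap_mem c) (B.algebraMap_mem c), zero_mem _⟩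
    | add x y _ _ hx hy =>
      rw [map_add, add_add_add_comm, add_sub_add_comm]
      exact ⟨add_mem hx.1 hy.1, add_mem hx.2 hy.2⟩
    | mul x y _ _ hx hy =>
      rw [map_mul]
      constructor
      · have : x * y + τ x * τ y = (1 / 2 : ℂ) • ((x + τ x) * (y + τ y) +
            (x - τ x) * (y - τ y)) := by
          rw [half (x * y + τ x * τ y)]
          congr 1
          ring
        rw [this]
        exact B.smul_mem (add_mem (mul_mem hx.1 hy.1) (hMM _ hx.2 _ hy.2)) _
      · have : x * y - τ x * τ y = (1 / 2 : ℂ) • ((x + τ x) * (y - τ y) +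
            (y + τ y) * (x - τ x)) := by
          rw [half (x * y - τ x * τ y)]
          congr 1
          ring
        rw [this]
        exact hcM _ _ (add_mem (hBM _ hx.1 _ hy.2) (hBM _ hy.1 _ hx.2))
  refine ⟨G, (hf.image _).union (hD.image2 _ hD), ?_, ?_, ?_⟩
  · rintro _ (⟨s, _, rfl⟩ | ⟨_, ⟨s, _, rfl⟩, _, ⟨t, _, rfl⟩, rfl⟩)
    · change τ _ = _
      simp only [map_add, h2, AlgHom.id_apply, add_comm]
    · change τ _ = _
      simp only [map_sub, map_mul, h2, AlgHom.id_apply]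
      ring
  · intro a ha
    have := (key a).1
    rw [mem_inv.1 ha] at this
    rw [half a]
    exact B.smul_mem this _
  · have hd : ∀ d ∈ D, ∃ q, X.IsHom q d := by
      rintro _ ⟨s, hs, rfl⟩
      obtain ⟨q, h⟩ := hq s hs
      exact ⟨q, IsHom.sub h (hτ _ _ h)⟩
    rintro _ (⟨s, hs, rfl⟩ | ⟨d, h, e, h', rfl⟩)
    · obtain ⟨q, h⟩ := hq s hs
      exact ⟨q, IsHom.add h (hτ _ _ h)⟩
    · obtain ⟨q, h⟩ := hd d h
      obtain ⟨r, h'⟩ := hd e h'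
      exact ⟨q + r, h.mul h'⟩

theorem inv_comp (X : GrAlg Γ) (τ : X.A →ₐ[ℂ] X.A) (hτ : IsGr τ) :
    ∀ a ∈ inv τ, ∀ q, (X.co a).coeff q ∈ inv τ := fun a ha q => by
  change τ (X.comp q a) = X.comp q a
  rw [← hτ.comp_apply, mem_inv.1 ha]

/-- The quotient variety by an involution. -/
abbrev fixed (X : GrAlg Γ) (τ : X.A →ₐ[ℂ] X.A) (hτ : IsGr τ) (h2 : ∀ a, τ (τ a) = a) :
    GrAlg Γ where
  A := inv τ
  co := restrictCo X.co (inv τ) (X.inv_comp τ hτ)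
  gen := by
    obtain ⟨G, hf, h1, h2, h3⟩ := X.inv_gen τ hτ h2
    refine ⟨(inv τ).val ⁻¹' G, hf.preimage Subtype.val_injective.injOn,
      MuVar.adjoin_aux _ _ h1 h2, ?_⟩
    intro g hg
    obtain ⟨q, hq⟩ := h3 _ hg
    exact ⟨q, (restrictCo_eq_single X.co (inv τ) (X.inv_comp τ hτ)).2 hq⟩

theorem isHom_fixed {X : GrAlg Γ} {τ : X.A →ₐ[ℂ] X.A} {hτ : IsGr τ} {h2 : ∀ a, τ (τ a) = a}
    {q : Γ} {a : inv τ} : (X.fixed τ hτ h2).IsHom q a ↔ X.IsHom q (a : X.A) :=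
  restrictCo_eq_single X.co (inv τ) (X.inv_comp τ hτ)

end GrAlg

open GrAlg

/-- A variety with potential and an involution. -/
structure InvPot extends PotVar where
  τ : A →ₐ[ℂ] A
  gr : IsGr (X := toGrAlg) (Y := toGrAlg) τ
  inv : ∀ a, τ (τ a) = a
  fix : τ f = f

namespace InvPot

/-- The quotient by the involution. -/
abbrev quo (P : InvPot) : PotVar where
  toGrAlg := P.toGrAlg.fixed P.τ P.gr P.inv
  f := ⟨P.f, P.fix⟩
  hf := isHom_fixed.2 P.hf

variable {P Q : InvPot}

theorem isHom_quo {P : InvPot} {q : ℚ} {a : P.quo.A} :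
    P.quo.IsHom q a ↔ P.IsHom q (a.1 : P.A) :=
  isHom_fixed (hτ := P.gr) (h2 := P.inv)

/-- The map between the quotients. -/
def map (φ : P.A →ₐ[ℂ] Q.A) (e : ∀ a, φ (P.τ a) = Q.τ (φ a)) : P.quo.A →ₐ[ℂ] Q.quo.A :=
  (φ.comp (GrAlg.inv P.τ).val).codRestrict (GrAlg.inv Q.τ) (fun a => by
    change Q.τ (φ a.1) = φ a.1
    rw [← e, mem_inv.1 a.2])

theorem map_val {φ : P.A →ₐ[ℂ] Q.A} {e : ∀ a, φ (P.τ a) = Q.τ (φ a)} (a : P.quo.A) :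
    (map φ e a).1 = φ a.1 := rfl

theorem isGr_map (φ : P.A →ₐ[ℂ] Q.A) (e : ∀ a, φ (P.τ a) = Q.τ (φ a))
    (h : IsGr (X := P.toGrAlg) (Y := Q.toGrAlg) φ) :
    IsGr (X := P.quo.toGrAlg) (Y := Q.quo.toGrAlg) (map φ e) := fun q a ha =>
  isHom_quo.2 (h q _ (isHom_quo.1 ha))

theorem map_surjective {φ : P.A →ₐ[ℂ] Q.A} {e : ∀ a, φ (P.τ a) = Q.τ (φ a)}
    (h : Function.Surjective φ) : Function.Surjective (map φ e) := by
  intro b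
  obtain ⟨a, ha⟩ := h b.1
  refine ⟨avg P.τ P.inv a, Subtype.ext ?_⟩
  rw [map_val]
  have hb : Q.τ b.1 = b.1 := b.2
  simp only [avg, map_smul, map_add, e, ha, hb]
  rw [← two_smul ℂ, smul_smul]; norm_num

theorem quo_iso (e : P.A ≃ₐ[ℂ] Q.A)
    (h : IsGr (X := P.toGrAlg) (Y := Q.toGrAlg) (e : P.A →ₐ[ℂ] Q.A)) (hf : e P.f = Q.f)
    (hτ : ∀ a, e (P.τ a) = Q.τ (e a)) : PotVar.Iso P.quo Q.quo := by
  refine ⟨AlgEquiv.ofBijective (map (e : P.A →ₐ[ℂ] Q.A) hτ) ⟨?_, map_surjective e.surjective⟩,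
    isGr_map (e : P.A →ₐ[ℂ] Q.A) hτ h, Subtype.ext hf⟩
  intro a b hab
  exact Subtype.ext (e.injective (congr_arg Subtype.val hab))

end InvPot

namespace PotVar

/-- `P × P` with the exchange of the factors. -/
abbrev swap (P : PotVar) : InvPot where
  toPotVar := P.tensor P
  τ := (Algebra.TensorProduct.comm ℂ P.A P.A : P.A ⊗[ℂ] P.A →ₐ[ℂ] P.A ⊗[ℂ] P.A)
  gr := by
    apply isGr_tensor
    · exact fun q a ha => isGr_inclRight P.toGrAlg P.toGrAlg q a ha
    · exact fun q a ha => isGr_inclLeft P.toGrAlg P.toGrAlg q a ha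
  inv a := (Algebra.TensorProduct.comm ℂ P.A P.A).symm_apply_apply a
  fix := by simp [add_comm]

/-- The symmetric square. -/
abbrev sym2 (P : PotVar) : PotVar := P.swap.quo

theorem sym2_iso {P Q : PotVar} (h : Iso P Q) : Iso P.sym2 Q.sym2 := by
  obtain ⟨e, he, hf⟩ := h
  refine InvPot.quo_iso (P := P.swap) (Q := Q.swap) (Algebra.TensorProduct.congr e e)
    (he.tmap he) (by simp [hf]) ?_
  intro a
  have : ((Algebra.TensorProduct.congr e e : P.A ⊗[ℂ] P.A →ₐ[ℂ] Q.A ⊗[ℂ] Q.A).comp P.swap.τ) =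
      Q.swap.τ.comp (Algebra.TensorProduct.congr e e : P.A ⊗[ℂ] P.A →ₐ[ℂ] Q.A ⊗[ℂ] Q.A) := by
    apply Algebra.TensorProduct.ext' 
    intro a b
    simp
  exact DFunLike.congr_fun this a

/-- The closed subvariety `g = 0`. -/
abbrev quot (P : PotVar) (g : P.A) {q : ℚ} (hg : P.IsHom q g) : PotVar where
  toGrAlg := P.toGrAlg.quot g hg
  f := P.toGrAlg.toQuot g hg P.f
  hf := isGr_toQuot _ _ hg _ _ P.hf

theorem cl_subsingleton {X : PotVar} (h : Subsingleton X.A) : cl X = 0 := by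
  have : IsScissors X.toGrAlg X.toGrAlg X.toGrAlg 0 (AlgHom.id ℂ X.A) (AlgHom.id ℂ X.A) := by
    refine IsScissors.mk' (isHom_zero 0) IsGr.id IsGr.id Function.surjective_id
      (Subsingleton.elim _ _) (fun a _ => ⟨0, Subsingleton.elim _ _⟩) (isUnit_of_subsingleton _)
      (fun u => ⟨0, u, Subsingleton.elim _ _⟩) (fun u _ => ⟨0, Subsingleton.elim _ _⟩)
  simpa using cl_scissors (P := X) (Z := X) (U := X) this rfl rfl

/-- The zero ring. -/
abbrev empty : PotVar where
  toGrAlg := GrAlg.triv PUnit inferInstance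
  f := 0
  hf := isHom_zero 1

theorem cl_quot_nil (P : PotVar) (g : P.A) {q : ℚ} (hg : P.IsHom q g) (hn : IsNilpotent g) :
    cl (P.quot g hg) = cl P := by
  obtain ⟨n, hn⟩ := hn
  let ψ : P.A →ₐ[ℂ] PUnit.{1} :=
    { toFun := fun _ => 0, map_one' := rfl, map_mul' := fun _ _ => rfl, map_zero' := rfl,
      map_add' := fun _ _ => rfl, commutes' := fun _ => rfl }
  have h : IsScissors P.toGrAlg (P.quot g hg).toGrAlg empty.toGrAlg g (P.toGrAlg.toQuot g hg) ψ := by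
    refine IsScissors.mk' hg (isGr_toQuot _ _ _) (fun _ _ _ => isHom_zero _)
      (toQuot_surjective _ _ _) (toQuot_eq_zero.2 ⟨1, (mul_one _).symm⟩)
      (fun a h => toQuot_eq_zero.1 h) (isUnit_of_subsingleton _)
      (fun u => ⟨0, 0, Subsingleton.elim _ _⟩) (fun u _ => ⟨n, by rw [hn, zero_mul]⟩)
  rw [cl_scissors (Z := P.quot g hg) (U := empty) h rfl rfl,
    cl_subsingleton (X := empty) inferInstance, add_zero]

/-- Nilpotent functions do not change the class. -/
theorem cl_nil {P Q : PotVar} (φ : P.A →ₐ[ℂ] Q.A)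
    (hφ : IsGr (X := P.toGrAlg) (Y := Q.toGrAlg) φ) (hf : φ P.f = Q.f)
    (hs : Function.Surjective φ) (hn : ∀ a, φ a = 0 → IsNilpotent a) : cl P = cl Q := by
  have key : ∀ (n : ℕ) (P : PotVar) (φ : P.A →ₐ[ℂ] Q.A)
      (hφ : IsGr (X := P.toGrAlg) (Y := Q.toGrAlg) φ) (hf : φ P.f = Q.f)
      (hs : Function.Surjective φ) (l : List P.A), l.length = n →
      (∀ g ∈ l, IsNilpotent g ∧ φ g = 0 ∧ ∃ q, P.IsHom q g) →
      (∀ a, φ a = 0 → a ∈ Ideal.span {g | g ∈ l}) → cl P = cl Q := by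
    intro n
    induction n with
    | zero =>
      intro P φ hφ hf hs l hl _ h
      obtain rfl := List.length_eq_zero_iff.1 hl
      refine cl_eq ⟨AlgEquiv.ofBijective φ ⟨?_, hs⟩, hφ, hf⟩
      rw [injective_iff_map_eq_zero]
      intro a ha
      simpa using h a ha
    | succ n ih =>
      intro P φ hφ hf hs l hl h1 h2
      obtain ⟨g, l, rfl⟩ := List.exists_cons_of_length_eq_add_one hl
      obtain ⟨hgn, hg0, q, hg⟩ := h1 g (by simp)
      rw [← P.cl_quot_nil g hg hgn]
      let φ' : (P.quot g hg).A →ₐ[ℂ] Q.A := Ideal.Quotient.liftₐ _ φ (fun a ha => by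
        obtain ⟨b, rfl⟩ := Ideal.mem_span_singleton'.1 ha
        rw [map_mul, hg0, mul_zero])
      have e : ∀ a, φ' (P.toGrAlg.toQuot g hg a) = φ a := fun a => rfl
      refine ih (P.quot g hg) φ' ?_ hf ?_ (l.map (P.toGrAlg.toQuot g hg)) (by simpa using hl) ?_ ?_
      · exact IsGr.of_comp_surj (isGr_toQuot _ g hg) (toQuot_surjective _ g hg) hφ
      · intro z
        obtain ⟨a, rfl⟩ := hs z
        exact ⟨_, e a⟩
      · intro g' hg'
        obtain ⟨k, hk, rfl⟩ := List.mem_map.1 hg'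
        obtain ⟨h3, h4, r, h5⟩ := h1 k (by simp [hk])
        exact ⟨h3.map _, h4, r, isGr_toQuot _ g hg _ _ h5⟩
      · intro a ha
        obtain ⟨a, rfl⟩ := toQuot_surjective _ g hg a
        have h3 := Ideal.mem_map_of_mem (P.toGrAlg.toQuot g hg) (h2 a ha)
        rw [Ideal.map_span] at h3
        refine (Ideal.span_le.2 ?_) h3
        rintro _ ⟨k, hk, rfl⟩
        obtain rfl | hk := List.mem_cons.1 hk
        · have : P.toGrAlg.toQuot k hg k = 0 := toQuot_eq_zero.2 ⟨1, (mul_one _).symm⟩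
          rw [this]; exact zero_mem _
        · exact Ideal.subset_span (List.mem_map_of_mem hk)
  classical
  have hN : IsNoetherianRing P.A := by
    obtain ⟨S, hS, h, -⟩ := P.gen
    have : Algebra.FiniteType ℂ P.A := ⟨hS.toFinset, by simpa using h⟩
    exact Algebra.FiniteType.isNoetherianRing ℂ P.A
  obtain ⟨T, hT⟩ := hN.noetherian (RingHom.ker φ)
  let l : List P.A := (T.biUnion fun g => (P.toGrAlg.degs g).image fun q => P.comp q g).toList
  have hl : ∀ g ∈ l, φ g = 0 ∧ ∃ q, P.IsHom q g := by
    intro g hg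
    simp only [l, Finset.mem_toList, Finset.mem_biUnion, Finset.mem_image] at hg
    obtain ⟨t, ht, q, hq, rfl⟩ := hg
    refine ⟨?_, q, isHom_comp q t⟩
    have : φ t = 0 := by
      rw [← RingHom.mem_ker, ← hT]; exact Submodule.subset_span ht
    rw [← hφ.comp_apply, this, comp_zero]
  refine key l.length P φ hφ hf hs l rfl (fun g hg => ⟨hn g (hl g hg).1, hl g hg⟩) ?_
  intro a ha
  have ha : a ∈ Ideal.span (T : Set P.A) := by
    rw [Ideal.span, hT]; exact ha
  refine (Ideal.span_le.2 ?_) ha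
  intro t ht
  rw [← P.sum_comp t]
  refine sum_mem fun q hq => Ideal.subset_span ?_
  simp only [l, Set.mem_ofPred_eq, Finset.mem_toList, Finset.mem_biUnion, Finset.mem_image]
  exact ⟨t, ht, q, hq, rfl⟩

end PotVar

section

open GrAlg

namespace GrAlg

variable {Γ : Type} [AddCommGroup Γ] {X Z U : GrAlg Γ}

theorem IsScissors.lker_right {g : X.A} {φ : X.A →ₐ[ℂ] Z.A} {ψ : X.A →ₐ[ℂ] U.A}
    (h : IsScissors X Z U g φ ψ) (W : GrAlg Γ) (t : W.A ⊗[ℂ] X.A)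
    (ht : Algebra.TensorProduct.map (AlgHom.id ℂ W.A) ψ t = 0) :
    ∃ n, (1 ⊗ₜ[ℂ] g) ^ n * t = 0 := by
  have e : ∀ t : W.A ⊗[ℂ] X.A, Algebra.TensorProduct.map ψ (AlgHom.id ℂ W.A)
      (Algebra.TensorProduct.comm ℂ W.A X.A t) = Algebra.TensorProduct.comm ℂ W.A U.A
        (Algebra.TensorProduct.map (AlgHom.id ℂ W.A) ψ t) := by
    intro t
    induction t using TensorProduct.induction_on with
    | zero => simp
    | add a b ha hb => simp only [map_add, ha, hb]
    | tmul a b => simp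
  obtain ⟨n, hn⟩ := (h.tensor W).lker (Algebra.TensorProduct.comm ℂ W.A X.A t) (by
    rw [e, ht, map_zero])
  refine ⟨n, (Algebra.TensorProduct.comm ℂ W.A X.A).injective ?_⟩
  rw [map_mul, map_pow, map_zero, Algebra.TensorProduct.comm_tmul]
  exact hn

end GrAlg

namespace PotVar

variable {P Z U : PotVar} {g : P.A} {φ : P.A →ₐ[ℂ] Z.A} {ψ : P.A →ₐ[ℂ] U.A}

theorem map_swap {P Q : PotVar} (φ : P.A →ₐ[ℂ] Q.A) (t : P.A ⊗[ℂ] P.A) :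
    Algebra.TensorProduct.map φ φ (P.swap.τ t) =
      Q.swap.τ (Algebra.TensorProduct.map φ φ t) := by
  induction t using TensorProduct.induction_on with
  | zero => simp
  | add a b ha hb => simp only [map_add, ha, hb]
  | tmul a b => simp

/-- `g ⊗ g` -/
def gg (g : P.A) : P.sym2.A := ⟨g ⊗ₜ[ℂ] g, by rw [mem_inv]; simp⟩

/-- `g ⊗ 1 + 1 ⊗ g` -/
def ge (g : P.A) : P.sym2.A := ⟨g ⊗ₜ[ℂ] 1 + 1 ⊗ₜ[ℂ] g, by rw [mem_inv]; simp [add_comm]⟩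

theorem gg_hom {q : ℚ} (hg : P.IsHom q g) : P.sym2.IsHom (q + q) (gg g) :=
  InvPot.isHom_quo.2 (hg.tmul hg)

theorem ge_hom {q : ℚ} (hg : P.IsHom q g) : P.sym2.IsHom q (ge g) :=
  InvPot.isHom_quo.2 ((isGr_inclLeft _ _ _ _ hg).add (isGr_inclRight _ _ _ _ hg))

theorem sym2_open (h : IsScissors P.toGrAlg Z.toGrAlg U.toGrAlg g φ ψ) {q : ℚ}
    (hg : P.IsHom q g) (hψ : ψ P.f = U.f) :
    cl P.sym2 = cl (P.sym2.quot (gg g) (gg_hom hg)) + cl U.sym2 := by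
  let Ψ : P.sym2.A →ₐ[ℂ] U.sym2.A := InvPot.map (P := P.swap) (Q := U.swap)
    (Algebra.TensorProduct.map ψ ψ) (map_swap ψ)
  have hΨ : ∀ a, (Ψ a).1 = Algebra.TensorProduct.map ψ ψ a.1 := fun a => rfl
  have hΨf : Ψ P.sym2.f = U.sym2.f := Subtype.ext (by
    rw [hΨ]; simp [hψ])
  have hs : IsScissors P.sym2.toGrAlg (P.sym2.quot (gg g) (gg_hom hg)).toGrAlg U.sym2.toGrAlg (gg g)
      (P.sym2.toGrAlg.toQuot (gg g) (gg_hom hg)) Ψ := by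
    refine IsScissors.mk' (gg_hom hg) (isGr_toQuot _ _ _)
      (InvPot.isGr_map (P := P.swap) (Q := U.swap) _ _ (h.grψ.tmap h.grψ))
      (toQuot_surjective _ _ _) (toQuot_eq_zero.2 ⟨1, (mul_one _).symm⟩)
      (fun a h => toQuot_eq_zero.1 h) ?_ ?_ ?_
    · obtain ⟨u, hu⟩ := h.unit
      refine IsUnit.of_mul_eq_one (gg (↑u⁻¹ : U.A)) (Subtype.ext ?_)
      change (Ψ (gg g)).1 * (↑u⁻¹ : U.A) ⊗ₜ[ℂ] (↑u⁻¹ : U.A) = 1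
      rw [hΨ]
      simp only [gg, ← hu, Algebra.TensorProduct.map_tmul, Algebra.TensorProduct.tmul_mul_tmul,
        Units.mul_inv]
      rfl
    · intro u
      have key : ∀ u : U.A ⊗[ℂ] U.A, ∃ n a, u * (ψ g ⊗ₜ[ℂ] ψ g) ^ n =
          Algebra.TensorProduct.map ψ ψ a := by
        intro u
        induction u using TensorProduct.induction_on with
        | zero => exact ⟨0, 0, by simp⟩
        | add a b ha hb =>
          obtain ⟨n, a', ha⟩ := ha
          obtain ⟨m, b', hb⟩ := hb
          refine ⟨n + m, a' * (g ⊗ₜ g) ^ m + b' * (g ⊗ₜ g) ^ n, ?_⟩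
          rw [map_add, map_mul, map_mul, map_pow, map_pow, ← ha, ← hb,
            Algebra.TensorProduct.map_tmul]
          ring
        | tmul a b =>
          obtain ⟨n, a', ha⟩ := h.lsurj a
          obtain ⟨m, b', hb⟩ := h.lsurj b
          refine ⟨n + m, (a' * g ^ m) ⊗ₜ (b' * g ^ n), ?_⟩
          rw [Algebra.TensorProduct.map_tmul, map_mul, map_mul, map_pow, map_pow, ← ha, ← hb,
            Algebra.TensorProduct.tmul_pow, Algebra.TensorProduct.tmul_mul_tmul]
          congr 1 <;> ring
      obtain ⟨n, a, ha⟩ := key u.1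
      refine ⟨n, avg P.swap.τ P.swap.inv a, Subtype.ext ?_⟩
      have h1 : (u * Ψ (gg g) ^ n).1 = u.1 * (ψ g ⊗ₜ[ℂ] ψ g) ^ n := rfl
      have h2 : U.swap.τ (u * Ψ (gg g) ^ n).1 = (u * Ψ (gg g) ^ n).1 := (u * Ψ (gg g) ^ n).2
      rw [hΨ]
      simp only [avg, map_smul, map_add]
      rw [map_swap, ← ha, ← h1, h2, ← two_smul ℂ, smul_smul, one_div, inv_mul_cancel₀ two_ne_zero,
        one_smul]
    · intro a ha
      have h1 : Algebra.TensorProduct.map ψ ψ a.1 = 0 := congr_arg Subtype.val ha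
      have h2 : ∀ t : P.A ⊗[ℂ] P.A, Algebra.TensorProduct.map ψ ψ t =
          Algebra.TensorProduct.map ψ (AlgHom.id ℂ U.A)
            (Algebra.TensorProduct.map (AlgHom.id ℂ P.A) ψ t) := by
        intro t
        induction t using TensorProduct.induction_on with
        | zero => simp
        | add a b ha hb => simp only [map_add, ha, hb]
        | tmul a b => simp
      rw [h2] at h1
      obtain ⟨n, hn⟩ := (h.tensor U.toGrAlg).lker _ h1
      obtain ⟨m, hm⟩ := h.lker_right P.toGrAlg ((g ⊗ₜ 1) ^ n * a.1) (by
        rw [map_mul, map_pow, Algebra.TensorProduct.map_tmul, map_one]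
        exact hn)
      refine ⟨n + m, Subtype.ext ?_⟩
      change (g ⊗ₜ[ℂ] g) ^ (n + m) * a.1 = 0
      have e : (g ⊗ₜ[ℂ] g : P.A ⊗[ℂ] P.A) = (g ⊗ₜ 1) * (1 ⊗ₜ g) := by simp
      rw [e]
      linear_combination (g ⊗ₜ[ℂ] (1 : P.A)) ^ m * (1 ⊗ₜ[ℂ] g) ^ n * hm
  exact cl_scissors (P := P.sym2) (Z := P.sym2.quot (gg g) (gg_hom hg)) (U := U.sym2) hs rfl hΨf

theorem add_pow_aux {A : Type} [CommRing A] (x y : A) (n : ℕ) :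
    ∃ k, (x + y) ^ (n + 1) = x ^ (n + 1) + y ^ (n + 1) + x * y * k := by
  induction n with
  | zero => exact ⟨0, by ring⟩
  | succ n ih =>
    obtain ⟨k, hk⟩ := ih
    refine ⟨x ^ n + y ^ n + k * (x + y), ?_⟩
    rw [pow_succ, hk]; ring

theorem sym2_mid (h : IsScissors P.toGrAlg Z.toGrAlg U.toGrAlg g φ ψ) {q : ℚ}
    (hg : P.IsHom q g) (hφ : φ P.f = Z.f) (hψ : ψ P.f = U.f) :
    cl (P.sym2.quot (gg g) (gg_hom hg)) =
      cl ((P.sym2.quot (gg g) (gg_hom hg)).quot (P.sym2.toGrAlg.toQuot (gg g) (gg_hom hg) (ge g))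
        (isGr_toQuot _ _ (gg_hom hg) _ _ (ge_hom hg))) + cl (Z.tensor U) := by
  let θ : P.sym2.A →ₐ[ℂ] (Z.tensor U).A :=
    (Algebra.TensorProduct.map φ ψ).comp (GrAlg.inv P.swap.τ).val
  have hθ : ∀ a : P.sym2.A, θ a = Algebra.TensorProduct.map φ ψ a.1 := fun a => rfl
  have hθgr : IsGr (X := P.sym2.toGrAlg) (Y := (Z.tensor U).toGrAlg) θ := by
    intro r a ha
    exact (h.grφ.tmap h.grψ) _ _ (InvPot.isHom_quo.1 ha)
  have hθg : θ (gg g) = 0 := by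
    rw [hθ, gg, Algebra.TensorProduct.map_tmul, h.map_g, TensorProduct.zero_tmul]
  have hθe : θ (ge g) = 1 ⊗ₜ ψ g := by
    rw [hθ, ge]; simp [h.map_g]
  have hθf : θ P.sym2.f = (Z.tensor U).f := by
    rw [hθ]; simp [hφ, hψ]
  let q' := P.sym2.toGrAlg.toQuot (gg g) (gg_hom hg)
  let Θ : (P.sym2.quot (gg g) (gg_hom hg)).A →ₐ[ℂ] (Z.tensor U).A :=
    Ideal.Quotient.liftₐ _ θ (fun a ha => by
      obtain ⟨b, rfl⟩ := Ideal.mem_span_singleton'.1 ha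
      rw [map_mul, hθg, mul_zero])
  have hΘ : ∀ a, Θ (q' a) = θ a := fun a => rfl
  have hs : IsScissors (P.sym2.quot (gg g) (gg_hom hg)).toGrAlg
      ((P.sym2.quot (gg g) (gg_hom hg)).quot (q' (ge g))
        (isGr_toQuot _ _ (gg_hom hg) _ _ (ge_hom hg))).toGrAlg (Z.tensor U).toGrAlg (q' (ge g))
      (toQuot _ _ (isGr_toQuot _ _ (gg_hom hg) _ _ (ge_hom hg))) Θ := by
    refine IsScissors.mk' (isGr_toQuot _ _ (gg_hom hg) _ _ (ge_hom hg)) (isGr_toQuot _ _ _)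
      (IsGr.of_comp_surj (isGr_toQuot _ _ (gg_hom hg)) (toQuot_surjective _ _ (gg_hom hg)) hθgr)
      (toQuot_surjective _ _ _) (toQuot_eq_zero.2 ⟨1, (mul_one _).symm⟩)
      (fun a h => toQuot_eq_zero.1 h) ?_ ?_ ?_
    · rw [hΘ, hθe]
      exact h.unit.map (Algebra.TensorProduct.includeRight : U.A →ₐ[ℂ] Z.A ⊗[ℂ] U.A)
    · intro u
      rw [hΘ, hθe]
      have key : ∃ (n : ℕ) (a : P.sym2.A), u * (1 ⊗ₜ[ℂ] ψ g) ^ n = θ a := by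
        induction u using TensorProduct.induction_on with
        | zero => exact ⟨0, 0, by rw [zero_mul, map_zero]⟩
        | add a b ha hb =>
          obtain ⟨n, a', ha⟩ := ha
          obtain ⟨m, b', hb⟩ := hb
          refine ⟨n + m, a' * ge g ^ m + b' * ge g ^ n, ?_⟩
          rw [map_add, map_mul, map_mul, map_pow, map_pow, ← ha, ← hb, hθe]
          ring
        | tmul z u =>
          obtain ⟨a, rfl⟩ := h.surj z
          obtain ⟨n, b, hb⟩ := h.lsurj u
          refine ⟨n + 1, ⟨a ⊗ₜ (g * b) + (g * b) ⊗ₜ a, by rw [mem_inv]; simp [add_comm]⟩, ?_⟩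
          rw [hθ, map_add, Algebra.TensorProduct.map_tmul, Algebra.TensorProduct.map_tmul, map_mul,
            map_mul, h.map_g, zero_mul, TensorProduct.zero_tmul, add_zero, ← hb,
            Algebra.TensorProduct.tmul_pow, Algebra.TensorProduct.tmul_mul_tmul]
          congr 1
          · simp
          · ring
      obtain ⟨n, a, ha⟩ := key
      exact ⟨n, q' a, ha⟩
    · intro a ha
      obtain ⟨t, rfl⟩ := toQuot_surjective _ _ (gg_hom hg) a
      have h1 : Algebra.TensorProduct.map φ ψ t.1 = 0 := ha
      have h2 : ∀ t : P.A ⊗[ℂ] P.A, Algebra.TensorProduct.map φ ψ t =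
          Algebra.TensorProduct.map (AlgHom.id ℂ Z.A) ψ
            (Algebra.TensorProduct.map φ (AlgHom.id ℂ P.A) t) := by
        intro t
        induction t using TensorProduct.induction_on with
        | zero => simp
        | add a b ha hb => simp only [map_add, ha, hb]
        | tmul a b => simp
      rw [h2] at h1
      obtain ⟨n, hn⟩ := h.lker_right Z.toGrAlg _ h1
      obtain ⟨s, hs⟩ := (h.tensor P.toGrAlg).ker' ((1 ⊗ₜ g) ^ n * t.1) (by
        rw [map_mul, map_pow, Algebra.TensorProduct.map_tmul, map_one]
        exact hn)
      have ht : P.swap.τ t.1 = t.1 := t.2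
      have hs' : (g ⊗ₜ[ℂ] (1 : P.A)) ^ n * t.1 = ((1 : P.A) ⊗ₜ[ℂ] g) * P.swap.τ s := by
        have := congr_arg P.swap.τ hs
        rw [map_mul, map_mul, map_pow, ht] at this
        simpa using this
      obtain ⟨k, hk⟩ := add_pow_aux (g ⊗ₜ[ℂ] (1 : P.A)) ((1 : P.A) ⊗ₜ[ℂ] g) n
      have e : (g ⊗ₜ[ℂ] g : P.A ⊗[ℂ] P.A) = (g ⊗ₜ 1) * (1 ⊗ₜ g) := by simp
      have h3 : (ge g ^ (n + 1) * t).1 = (g ⊗ₜ[ℂ] g) * (P.swap.τ s + s + k * t.1) := by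
        change (g ⊗ₜ[ℂ] (1 : P.A) + (1 : P.A) ⊗ₜ[ℂ] g) ^ (n + 1) * t.1 = _
        rw [hk, e]
        linear_combination (g ⊗ₜ[ℂ] (1 : P.A)) * hs' + ((1 : P.A) ⊗ₜ[ℂ] g) * hs
      refine ⟨n + 1, ?_⟩
      change q' (ge g) ^ (n + 1) * q' t = 0
      rw [← map_pow, ← map_mul, toQuot_eq_zero]
      refine ⟨avg P.swap.τ P.swap.inv (P.swap.τ s + s + k * t.1), Subtype.ext ?_⟩
      have h4 : P.swap.τ (ge g ^ (n + 1) * t).1 = (ge g ^ (n + 1) * t).1 := (ge g ^ (n + 1) * t).2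
      have h5 : P.swap.τ (g ⊗ₜ[ℂ] g) = g ⊗ₜ[ℂ] g := by simp
      change _ = (g ⊗ₜ[ℂ] g) * ((1 / 2 : ℂ) • (_ + P.swap.τ _))
      have h6 := congr_arg P.swap.τ h3
      rw [map_mul, h5] at h6
      rw [mul_smul_comm, mul_add, ← h3, ← h6, h4, ← two_smul ℂ, smul_smul, one_div,
        inv_mul_cancel₀ two_ne_zero, one_smul]
  exact cl_scissors (P := P.sym2.quot (gg g) (gg_hom hg)) (U := Z.tensor U)
    (Z := (P.sym2.quot (gg g) (gg_hom hg)).quot _ _) hs rfl hθf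

theorem sym2_closed (h : IsScissors P.toGrAlg Z.toGrAlg U.toGrAlg g φ ψ) {q : ℚ}
    (hg : P.IsHom q g) (hφ : φ P.f = Z.f) :
    cl ((P.sym2.quot (gg g) (gg_hom hg)).quot (P.sym2.toGrAlg.toQuot (gg g) (gg_hom hg) (ge g))
        (isGr_toQuot _ _ (gg_hom hg) _ _ (ge_hom hg))) = cl Z.sym2 := by
  let θ : P.sym2.A →ₐ[ℂ] Z.sym2.A := InvPot.map (P := P.swap) (Q := Z.swap)
    (Algebra.TensorProduct.map φ φ) (map_swap φ)
  have hθ : ∀ a : P.sym2.A, (θ a).1 = Algebra.TensorProduct.map φ φ a.1 := fun a => rfl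
  have hθgr : IsGr (X := P.sym2.toGrAlg) (Y := Z.sym2.toGrAlg) θ :=
    InvPot.isGr_map (P := P.swap) (Q := Z.swap) _ _ (h.grφ.tmap h.grφ)
  have hθg : θ (gg g) = 0 := Subtype.ext (by
    rw [hθ, gg, Algebra.TensorProduct.map_tmul, h.map_g, TensorProduct.zero_tmul]; rfl)
  have hθe : θ (ge g) = 0 := Subtype.ext (by
    rw [hθ, ge]; simp [h.map_g])
  have hθf : θ P.sym2.f = Z.sym2.f := Subtype.ext (by
    rw [hθ]; simp [hφ])
  have hθs : Function.Surjective θ := InvPot.map_surjective (P := P.swap) (Q := Z.swap)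
    (TensorProduct.map_surjective h.surj h.surj)
  let q' := P.sym2.toGrAlg.toQuot (gg g) (gg_hom hg)
  let Θ : (P.sym2.quot (gg g) (gg_hom hg)).A →ₐ[ℂ] Z.sym2.A :=
    Ideal.Quotient.liftₐ _ θ (fun a ha => by
      obtain ⟨b, rfl⟩ := Ideal.mem_span_singleton'.1 ha
      rw [map_mul, hθg, mul_zero])
  have hΘ : ∀ a, Θ (q' a) = θ a := fun a => rfl
  let q'' := (P.sym2.quot (gg g) (gg_hom hg)).toGrAlg.toQuot (q' (ge g))
    (isGr_toQuot _ _ (gg_hom hg) _ _ (ge_hom hg))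
  let Θ' : ((P.sym2.quot (gg g) (gg_hom hg)).quot (q' (ge g))
      (isGr_toQuot _ _ (gg_hom hg) _ _ (ge_hom hg))).A →ₐ[ℂ] Z.sym2.A :=
    Ideal.Quotient.liftₐ _ Θ (fun a ha => by
      obtain ⟨b, rfl⟩ := Ideal.mem_span_singleton'.1 ha
      rw [map_mul, hΘ, hθe, mul_zero])
  have hΘ' : ∀ a, Θ' (q'' (q' a)) = θ a := fun a => rfl
  have hsurj : ∀ b, ∃ a, q'' (q' a) = b := by
    intro b
    obtain ⟨b, rfl⟩ := toQuot_surjective _ _ (isGr_toQuot _ _ (gg_hom hg) _ _ (ge_hom hg)) b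
    obtain ⟨b, rfl⟩ := toQuot_surjective _ _ (gg_hom hg) b
    exact ⟨b, rfl⟩
  refine cl_nil (Q := Z.sym2) Θ' ?_ hθf ?_ ?_
  · have h2 : (P.sym2.quot (gg g) (gg_hom hg)).IsHom q (q' (ge g)) :=
      isGr_toQuot _ _ (gg_hom hg) _ _ (ge_hom hg)
    exact IsGr.of_comp_surj (isGr_toQuot _ _ h2) (toQuot_surjective _ _ h2)
      (IsGr.of_comp_surj (isGr_toQuot _ _ (gg_hom hg)) (toQuot_surjective _ _ (gg_hom hg)) hθgr)
  · intro z
    obtain ⟨a, rfl⟩ := hθs z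
    exact ⟨_, hΘ' a⟩
  · intro a ha
    obtain ⟨t, rfl⟩ := hsurj a
    rw [hΘ'] at ha
    have h1 : Algebra.TensorProduct.map φ φ t.1 = 0 := congr_arg Subtype.val ha
    rw [← RingHom.mem_ker, Algebra.TensorProduct.map_ker _ _ h.surj h.surj, h.ker, Ideal.map_span,
      Ideal.map_span, Set.image_singleton, Set.image_singleton, Submodule.mem_sup] at h1
    obtain ⟨_, hA, _, hB, hAB⟩ := h1
    obtain ⟨a, rfl⟩ := Ideal.mem_span_singleton'.1 hA
    obtain ⟨b, rfl⟩ := Ideal.mem_span_singleton'.1 hB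
    clear hA hB
    simp only [Algebra.TensorProduct.includeLeft_apply, Algebra.TensorProduct.includeRight_apply]
      at hAB
    set x : P.A ⊗[ℂ] P.A := g ⊗ₜ 1 with hx
    set y : P.A ⊗[ℂ] P.A := 1 ⊗ₜ g with hy
    have hxy : (g ⊗ₜ[ℂ] g : P.A ⊗[ℂ] P.A) = x * y := by simp [hx, hy]
    have τx : P.swap.τ x = y := by simp [hx, hy]
    have τy : P.swap.τ y = x := by simp [hx, hy]
    have ht : P.swap.τ t.1 = t.1 := t.2
    obtain ⟨c, hc⟩ : ∃ c, t.1 = x * c + y * P.swap.τ c := by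
      refine ⟨(1 / 2 : ℂ) • (a + P.swap.τ b), ?_⟩
      have h2 : t.1 = (1 / 2 : ℂ) • (t.1 + P.swap.τ t.1) := by
        rw [ht, ← two_smul ℂ, smul_smul]; norm_num
      rw [h2, ← hAB]
      simp only [map_add, map_mul, map_smul, P.swap.inv, τx, τy, mul_smul_comm, ← smul_add]
      congr 1
      ring
    have τc := P.swap.inv c
    set d := P.swap.τ c with hd
    refine ⟨2, ?_⟩
    let r1 : P.sym2.A := ⟨x * c ^ 2 + y * d ^ 2, by
      rw [mem_inv]
      rw [map_add, map_mul, map_mul, map_pow, map_pow, ← hd, τc, τx, τy, add_comm]⟩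
    let r2 : P.sym2.A := ⟨2 * (c * d) - c ^ 2 - d ^ 2, by
      rw [mem_inv]
      rw [map_sub, map_sub, map_mul, map_mul, map_pow, map_pow, ← hd, τc, map_ofNat]
      ring⟩
    have h3 : t ^ 2 = ge g * r1 + gg g * r2 := Subtype.ext (by
      change t.1 ^ 2 = (x + y) * (x * c ^ 2 + y * d ^ 2) +
        (g ⊗ₜ[ℂ] g) * (2 * (c * d) - c ^ 2 - d ^ 2)
      rw [hc, hxy]; ring)
    have e1 : q' (gg g) = 0 := toQuot_eq_zero.2 ⟨1, (mul_one _).symm⟩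
    have e2 : q'' (q' (ge g)) = 0 := toQuot_eq_zero.2 ⟨1, (mul_one _).symm⟩
    rw [← map_pow, ← map_pow, h3, map_add, map_mul, map_mul, e1, zero_mul, add_zero, map_mul, e2,
      zero_mul]

theorem sym2_scissors (h : IsScissors P.toGrAlg Z.toGrAlg U.toGrAlg g φ ψ)
    (hφ : φ P.f = Z.f) (hψ : ψ P.f = U.f) :
    cl P.sym2 = cl Z.sym2 + cl U.sym2 + cl Z * cl U := by
  obtain ⟨q, hg⟩ := h.hom
  rw [sym2_open h hg hψ, sym2_mid h hg hφ hψ, sym2_closed h hg hφ, cl_mul]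
  abel

end PotVar

end

section

open GrAlg

namespace GrAlg

variable {Γ : Type} [AddCommGroup Γ]

theorem loc_hom (X : GrAlg Γ) {g : X.A} {q : Γ} (hg : X.IsHom q g) :
    (X.poly (-q)).IsHom 0 (Polynomial.C g * Polynomial.X - 1 : Polynomial X.A) := by
  refine IsHom.sub ?_ isHom_one
  have := (isGr_polyC X (-q) _ _ hg).mul (isHom_polyX X (-q))
  rwa [add_neg_cancel] at this

/-- The open subvariety `g ≠ 0`. -/
abbrev loc (X : GrAlg Γ) (g : X.A) {q : Γ} (hg : X.IsHom q g) : GrAlg Γ :=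
  (X.poly (-q)).quot (Polynomial.C g * Polynomial.X - 1 : Polynomial X.A) (X.loc_hom hg)

/-- The restriction to an open subvariety. -/
def toLoc (X : GrAlg Γ) (g : X.A) {q : Γ} (hg : X.IsHom q g) : X.A →ₐ[ℂ] (X.loc g hg).A :=
  ((X.poly (-q)).toQuot _ (X.loc_hom hg)).comp Polynomial.CAlgHom

theorem isGr_toLoc (X : GrAlg Γ) (g : X.A) {q : Γ} (hg : X.IsHom q g) : IsGr (X.toLoc g hg) :=
  (isGr_toQuot _ _ _).comp (isGr_polyC X (-q))

theorem loc_scissors (X : GrAlg Γ) (g : X.A) {q : Γ} (hg : X.IsHom q g) :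
    IsScissors X (X.quot g hg) (X.loc g hg) g (X.toQuot g hg) (X.toLoc g hg) where
  hom := ⟨q, hg⟩
  grφ := isGr_toQuot _ _ _
  grψ := isGr_toLoc _ _ _
  surj := toQuot_surjective _ _ _
  ker := Ideal.Quotient.mkₐ_ker ℂ _
  loc := by
    have h := IsLocalization.adjoin_inv g
    let _ := (X.toLoc g hg).toRingHom.toAlgebra
    exact IsLocalization.isLocalization_of_algEquiv _
      (AlgEquiv.ofRingEquiv (R := X.A) (A₁ := AdjoinRoot (Polynomial.C g * Polynomial.X - 1))
        (A₂ := (X.loc g hg).A) (f := RingEquiv.refl _) (fun _ => rfl))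

end GrAlg

namespace PotVar

/-- The open subvariety `g ≠ 0`. -/
abbrev loc (P : PotVar) (g : P.A) {q : ℚ} (hg : P.IsHom q g) : PotVar where
  toGrAlg := P.toGrAlg.loc g hg
  f := P.toGrAlg.toLoc g hg P.f
  hf := isGr_toLoc _ _ hg _ _ P.hf

theorem cl_loc (P : PotVar) (g : P.A) {q : ℚ} (hg : P.IsHom q g) :
    cl P = cl (P.quot g hg) + cl (P.loc g hg) :=
  cl_scissors (P := P) (Z := P.quot g hg) (U := P.loc g hg) (P.toGrAlg.loc_scissors g hg) rfl rfl

/-- The class of the affine line. -/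
def L : K := cl (poly pt 0)

theorem poly_iso {P Q : PotVar} (h : Iso P Q) (q : ℚ) : Iso (P.poly q) (Q.poly q) := by
  obtain ⟨e, he, hf⟩ := h
  refine ⟨Polynomial.mapAlgEquiv e, ?_, by simp [hf]⟩
  apply isGr_poly
  · intro r a ha
    simpa using isGr_polyC Q.toGrAlg q _ _ (he _ _ ha)
  · simpa using isHom_polyX Q.toGrAlg q

theorem cl_poly (P : PotVar) (q : ℚ) : cl (P.poly q) = L * cl P := by
  rw [L, cl_mul, cl_eq (poly_tensor pt P 0), cl_eq (poly_iso (pt_tensor P) 0), cl_line P q 0]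

theorem cl_of_line {P Q : PotVar} {i : P.A →ₐ[ℂ] Q.A} {y : Q.A}
    (h : IsLine P.toGrAlg Q.toGrAlg i y) (hf : i P.f = Q.f) : cl Q = L * cl P := by
  obtain ⟨q, hq⟩ := h.hom
  obtain ⟨e, he, h1, -⟩ := h.iso hq
  rw [← cl_poly P q]
  exact (cl_eq (P := P.poly q) ⟨e, he, (h1 _).trans hf⟩).symm

end PotVar

namespace InvPot

theorem quo_line {Y T : InvPot} {i : Y.A →ₐ[ℂ] T.A} {s : T.A}
    (h : IsLine Y.toGrAlg T.toGrAlg i s) (e : ∀ a, i (Y.τ a) = T.τ (i a)) (hs : T.τ s = s) :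
    IsLine Y.quo.toGrAlg T.quo.toGrAlg (map i e) ⟨s, hs⟩ := by
  have key : ∀ p : Polynomial Y.quo.A,
      (Polynomial.eval₂ (map i e : Y.quo.A →+* T.quo.A) (⟨s, hs⟩ : T.quo.A) p).1 =
        Polynomial.eval₂ (i : Y.A →+* T.A) s (p.map (GrAlg.inv Y.τ).val.toRingHom) := by
    intro p
    induction p using Polynomial.induction_on' with
    | add p r hp hr =>
      rw [Polynomial.eval₂_add, Polynomial.map_add, Polynomial.eval₂_add, ← hp, ← hr]
      rfl
    | monomial m a =>
      rw [Polynomial.map_monomial, Polynomial.eval₂_monomial, Polynomial.eval₂_monomial]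
      rfl
  refine ⟨?_, isGr_map i e h.gr, ?_, ?_⟩
  · obtain ⟨q, hq⟩ := h.hom
    exact ⟨q, isHom_quo.2 hq⟩
  · intro p p' hp
    have h1 := congr_arg Subtype.val hp
    rw [key, key] at h1
    exact Polynomial.map_injective _ Subtype.val_injective (h.bij.1 h1)
  · intro t
    obtain ⟨p, hp⟩ := h.bij.2 t.1
    have h1 : Polynomial.eval₂ (i : Y.A →+* T.A) s (p.map Y.τ.toRingHom) = t.1 := by
      have ht : T.τ t.1 = t.1 := t.2
      rw [← ht, ← hp, Polynomial.eval₂_map]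
      refine Eq.trans ?_ (Polynomial.hom_eval₂ p (i : Y.A →+* T.A) T.τ.toRingHom s).symm
      change _ = Polynomial.eval₂ _ (T.τ s) p
      rw [hs]
      congr 1
      exact RingHom.ext e
    have h2 : p.map Y.τ.toRingHom = p := h.bij.1 (h1.trans hp.symm)
    have h3 : ∀ n, Y.τ (p.coeff n) = p.coeff n := fun n => by
      conv_rhs => rw [← h2, Polynomial.coeff_map]
      rfl
    obtain ⟨p', hp'⟩ := (Polynomial.mem_lifts p).1 ((Polynomial.lifts_iff_coeff_lifts
      (f := (GrAlg.inv Y.τ).val.toRingHom) p).2 (fun n => ⟨⟨p.coeff n, h3 n⟩, rfl⟩))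
    refine ⟨p', Subtype.ext ?_⟩
    rw [key, hp', hp]

/-- `B × A^1`, with the coordinate `d ↦ -d`. -/
abbrev anti (B : InvPot) (q : ℚ) : InvPot where
  toPotVar := B.toPotVar.poly q
  τ := Polynomial.eval₂AlgHom (Polynomial.CAlgHom.comp B.τ) (-Polynomial.X)
    (fun _ => Commute.all _ _)
  gr := by
    apply isGr_poly
    · intro r a ha
      simpa using isGr_polyC B.toGrAlg q _ _ (B.gr _ _ ha)
    · simpa using (isHom_polyX B.toGrAlg q).neg
  inv a := by
    have : ((Polynomial.eval₂AlgHom (Polynomial.CAlgHom.comp B.τ) (-Polynomial.X)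
        (fun _ => Commute.all _ _)).comp (Polynomial.eval₂AlgHom (Polynomial.CAlgHom.comp B.τ)
          (-Polynomial.X) (fun _ => Commute.all _ _)) : Polynomial B.A →ₐ[ℂ] Polynomial B.A) =
        AlgHom.id ℂ _ := by
      refine Polynomial.algHom_ext' ?_ (by simp)
      ext a : 1
      simp [B.inv]
    exact DFunLike.congr_fun this a
  fix := by simp [B.fix]

theorem anti_C {B : InvPot} {q : ℚ} (a : B.A) :
    (B.anti q).τ (Polynomial.C a) = Polynomial.C (B.τ a) := by simp

theorem anti_X {B : InvPot} {q : ℚ} :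
    (B.anti q).τ (Polynomial.X : Polynomial B.A) = -Polynomial.X := by simp

theorem anti_coeff {B : InvPot} {q : ℚ} (p : Polynomial B.A) (n : ℕ) :
    Polynomial.coeff ((B.anti q).τ p) n = (-1) ^ n * B.τ (p.coeff n) := by
  induction p using Polynomial.induction_on' with
  | add p r hp hr =>
    rw [map_add, Polynomial.coeff_add, hp, hr, Polynomial.coeff_add, map_add, mul_add]
  | monomial m a =>
    rw [← Polynomial.C_mul_X_pow_eq_monomial]
    have : (B.anti q).τ (Polynomial.C a * Polynomial.X ^ m) =
        Polynomial.C ((-1) ^ m * B.τ a) * Polynomial.X ^ m := by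
      rw [map_mul, map_pow, anti_C, anti_X, neg_pow]
      simp only [map_mul, map_pow, map_neg, map_one]
      ring
    rw [this, Polynomial.coeff_C_mul_X_pow, Polynomial.coeff_C_mul_X_pow]
    split_ifs with h
    · rw [h]
    · simp

theorem quo_nil {P Q : InvPot} (φ : P.A →ₐ[ℂ] Q.A)
    (hφ : IsGr (X := P.toGrAlg) (Y := Q.toGrAlg) φ) (hs : Function.Surjective φ)
    (e : ∀ a, φ (P.τ a) = Q.τ (φ a)) (hf : φ P.f = Q.f) (h : P.A) (hh : P.τ h = -h)
    (hk : ∀ a, φ a = 0 ↔ h ∣ a) (g : P.quo.A) (hg : g.1 = h ^ 2) {q : ℚ} (hq : P.quo.IsHom q g) :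
    PotVar.cl (P.quo.quot g hq) = PotVar.cl Q.quo := by
  have h0 : map φ e g = 0 := Subtype.ext (by
    rw [map_val, hg]
    exact (hk _).2 (dvd_pow_self h two_ne_zero))
  let Θ : (P.quo.quot g hq).A →ₐ[ℂ] Q.quo.A :=
    Ideal.Quotient.liftₐ _ (map φ e) (fun a ha => by
      obtain ⟨b, rfl⟩ := Ideal.mem_span_singleton'.1 ha
      rw [map_mul, h0, mul_zero])
  have hΘ : ∀ a, Θ (P.quo.toGrAlg.toQuot g hq a) = map φ e a := fun a => rfl
  refine PotVar.cl_nil Θ ?_ (Subtype.ext hf) ?_ ?_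
  · exact IsGr.of_comp_surj (isGr_toQuot _ _ hq) (toQuot_surjective _ _ hq) (isGr_map φ e hφ)
  · intro z
    obtain ⟨a, rfl⟩ := map_surjective (e := e) hs z
    exact ⟨_, hΘ a⟩
  · intro a ha
    obtain ⟨a, rfl⟩ := toQuot_surjective _ _ hq a
    rw [hΘ] at ha
    obtain ⟨b, hb⟩ := (hk _).1 (congr_arg Subtype.val ha)
    replace hb : a.1 = h * b := hb
    have ha' : P.τ a.1 = a.1 := a.2
    set c := (1 / 2 : ℂ) • (b - P.τ b) with hc
    have h1 : a.1 = h * c := by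
      have h2 : a.1 = (1 / 2 : ℂ) • (a.1 + P.τ a.1) := by
        rw [ha', ← two_smul ℂ, smul_smul, one_div, inv_mul_cancel₀ two_ne_zero, one_smul]
      rw [h2, hb, hc, map_mul, hh, mul_smul_comm]
      congr 1
      ring
    have τc : P.τ c = -c := by
      rw [hc, map_smul, map_sub, P.inv, ← smul_neg, neg_sub]
    refine ⟨2, ?_⟩
    rw [← map_pow, toQuot_eq_zero]
    refine ⟨⟨c ^ 2, by rw [mem_inv, map_pow, τc]; ring⟩, Subtype.ext ?_⟩
    change a.1 ^ 2 = g.1 * c ^ 2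
    rw [h1, hg]; ring

/-- The vanishing locus of an anti-invariant function. -/
abbrev quotAnti (B : InvPot) (h : B.A) {r : ℚ} (hr : B.IsHom r h) (hh : B.τ h = -h) : InvPot where
  toPotVar := B.toPotVar.quot h hr
  τ := Ideal.Quotient.liftₐ _ ((B.toGrAlg.toQuot h hr).comp B.τ) (by
    intro a ha
    obtain ⟨b, rfl⟩ := Ideal.mem_span_singleton'.1 ha
    rw [AlgHom.comp_apply, toQuot_eq_zero, map_mul, hh]
    exact ⟨-B.τ b, by ring⟩)
  gr := IsGr.of_comp_surj (isGr_toQuot _ _ hr) (toQuot_surjective _ _ hr)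
    ((isGr_toQuot _ _ hr).comp B.gr)
  inv a := by
    obtain ⟨a, rfl⟩ := toQuot_surjective _ _ hr a
    change B.toGrAlg.toQuot h hr (B.τ (B.τ a)) = _
    rw [B.inv]
  fix := by
    change B.toGrAlg.toQuot h hr (B.τ B.f) = _
    rw [B.fix]

theorem anti_base (B : InvPot) (q : ℚ) (hB : ∀ a, B.τ a = a) :
    PotVar.cl (B.anti q).quo = PotVar.L * PotVar.cl B.quo := by
  let ι : B.quo.A →ₐ[ℂ] (B.anti q).quo.A := map (P := B) (Q := B.anti q) Polynomial.CAlgHom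
    (fun a => by simp)
  let y : (B.anti q).quo.A := ⟨Polynomial.X ^ 2, by rw [mem_inv]; simp⟩
  have key : ∀ p : Polynomial B.quo.A, (Polynomial.eval₂ (ι : B.quo.A →+* (B.anti q).quo.A) y p).1 =
      Polynomial.expand B.A 2 (p.map (GrAlg.inv B.τ).val.toRingHom) := by
    intro p
    induction p using Polynomial.induction_on' with
    | add p r hp hr =>
      rw [Polynomial.eval₂_add, Polynomial.map_add, map_add, ← hp, ← hr]
      rfl
    | monomial m a =>
      rw [Polynomial.map_monomial, Polynomial.eval₂_monomial, Polynomial.expand_monomial]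
      change Polynomial.C a.1 * (Polynomial.X ^ 2) ^ m = _
      rw [← pow_mul, Polynomial.C_mul_X_pow_eq_monomial, mul_comm]
      rfl
  have hl : IsLine B.quo.toGrAlg (B.anti q).quo.toGrAlg ι y := by
    refine ⟨⟨2 • q, isHom_quo.2 ((isHom_polyX B.toGrAlg q).pow 2)⟩, isGr_map _ _
      (isGr_polyC B.toGrAlg q), ?_, ?_⟩
    · intro p p' hp
      have h1 := congr_arg Subtype.val hp
      rw [key, key] at h1
      exact Polynomial.map_injective _ Subtype.val_injective
        (Polynomial.expand_injective two_pos h1)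
    · intro t
      have ht : ∀ n, (-1) ^ n * Polynomial.coeff t.1 n = Polynomial.coeff t.1 n := fun n => by
        have h1 := anti_coeff (q := q) t.1 n
        rw [hB] at h1
        rw [← h1]
        exact congr_arg (fun p => Polynomial.coeff p n) t.2
      have hodd : ∀ n, ¬ 2 ∣ n → Polynomial.coeff t.1 n = 0 := fun n hn => by
        have h1 := ht n
        rw [(Nat.odd_iff.2 (by omega)).neg_one_pow, neg_one_mul, neg_eq_iff_add_eq_zero,
          ← two_smul ℂ] at h1
        exact (smul_eq_zero_iff_right (two_ne_zero (α := ℂ))).1 h1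
      let p := Polynomial.contract 2 (t.1 : Polynomial B.A)
      obtain ⟨p', hp'⟩ := (Polynomial.mem_lifts p).1 ((Polynomial.lifts_iff_coeff_lifts
        (f := (GrAlg.inv B.τ).val.toRingHom) p).2 (fun n => ⟨⟨p.coeff n, hB _⟩, rfl⟩))
      refine ⟨p', Subtype.ext ?_⟩
      rw [key, hp']
      refine Polynomial.ext fun n => ?_
      rw [Polynomial.coeff_expand two_pos]
      split_ifs with hn
      · rw [Polynomial.coeff_contract two_ne_zero, Nat.div_mul_cancel hn]
      · exact (hodd n hn).symm
  exact PotVar.cl_of_line hl rfl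

theorem anti_loc (B : InvPot) (q : ℚ) (h : B.A) {r : ℚ} (hr : B.IsHom r h) (hh : B.τ h = -h)
    (g : B.quo.A) (hg : g.1 = h ^ 2) (hgr : B.quo.IsHom (2 • r) g) (g' : (B.anti q).quo.A)
    (hg' : g'.1 = Polynomial.C (h ^ 2)) (hgr' : (B.anti q).quo.IsHom (2 • r) g') :
    PotVar.cl ((B.anti q).quo.loc g' hgr') = PotVar.L * PotVar.cl (B.quo.loc g hgr) := by
  let ι : B.quo.A →ₐ[ℂ] (B.anti q).quo.A := map (P := B) (Q := B.anti q) Polynomial.CAlgHom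
    (fun a => by simp)
  have hι : ∀ a, (ι a).1 = Polynomial.C a.1 := fun _ => rfl
  have hιg : ι g = g' := Subtype.ext (by rw [hg', ← hg]; rfl)
  have hιgr : IsGr (X := B.quo.toGrAlg) (Y := (B.anti q).quo.toGrAlg) ι :=
    isGr_map _ _ (isGr_polyC B.toGrAlg q)
  let i : (B.quo.loc g hgr).A →ₐ[ℂ] ((B.anti q).quo.loc g' hgr').A :=
    quotMap (X := B.quo.toGrAlg.poly (-(2 • r))) (Y := (B.anti q).quo.toGrAlg.poly (-(2 • r)))
      (Polynomial.mapAlgHom ι) (B.quo.toGrAlg.loc_hom hgr) ((B.anti q).quo.toGrAlg.loc_hom hgr')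
      (by simp [hιg])
  let ψ := B.quo.toGrAlg.toLoc g hgr
  let ψ' := (B.anti q).quo.toGrAlg.toLoc g' hgr'
  have hi : ∀ a, i (ψ a) = ψ' (ι a) := by
    intro a
    refine (quotMap_toQuot _).trans ?_
    simp only [ψ', toLoc, AlgHom.comp_apply]
    congr 1
    simp
  have higr : IsGr (X := (B.quo.loc g hgr).toGrAlg) (Y := ((B.anti q).quo.loc g' hgr').toGrAlg)
      i := by
    refine isGr_quotMap (X := B.quo.toGrAlg.poly (-(2 • r)))
      (Y := (B.anti q).quo.toGrAlg.poly (-(2 • r))) ?_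
    apply isGr_poly
    · intro s a ha
      have := isGr_polyC (B.anti q).quo.toGrAlg (-(2 • r)) _ _ (hιgr _ _ ha)
      simpa using this
    · rw [Polynomial.coe_mapAlgHom, Polynomial.map_X]
      exact isHom_polyX (B.anti q).quo.toGrAlg (-(2 • r))
  have hS := B.quo.toGrAlg.loc_scissors g hgr
  have hS' := (B.anti q).quo.toGrAlg.loc_scissors g' hgr'
  let v : (B.anti q).quo.A := ⟨Polynomial.C h * Polynomial.X, by rw [mem_inv]; simp [hh]⟩
  have hv : v.1 = Polynomial.C h * Polynomial.X := rfl
  have coeffE : ∀ (p : Polynomial B.quo.A) (m : ℕ),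
      Polynomial.coeff (Polynomial.eval₂ (ι : B.quo.A →+* (B.anti q).quo.A) v p).1 m =
        (p.coeff m).1 * h ^ m := by
    intro p m
    induction p using Polynomial.induction_on' with
    | add p r hp hr =>
      rw [Polynomial.eval₂_add, Polynomial.coeff_add]
      change Polynomial.coeff (_ + _ : Polynomial B.A) m = (_ + _ : B.A) * _
      rw [Polynomial.coeff_add, hp, hr, add_mul]
    | monomial n a =>
      rw [Polynomial.eval₂_monomial]
      change Polynomial.coeff (Polynomial.C a.1 * (Polynomial.C h * Polynomial.X) ^ n) m = _
      rw [mul_pow, ← Polynomial.C_pow, ← mul_assoc, ← Polynomial.C_mul, Polynomial.coeff_C_mul_X_pow,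
        Polynomial.coeff_monomial]
      by_cases hmn : m = n
      · subst hmn; simp
      · rw [if_neg hmn, if_neg (Ne.symm hmn)]; simp
  have hl : IsLine (B.quo.loc g hgr).toGrAlg ((B.anti q).quo.loc g' hgr').toGrAlg i (ψ' v) := by
    refine ⟨⟨r + q, isGr_toLoc _ _ hgr' _ _ (isHom_quo.2
      ((isGr_polyC B.toGrAlg q _ _ hr).mul (isHom_polyX B.toGrAlg q)))⟩, higr, ?_, ?_⟩
    · intro p₁ p₂ hp₁₂
      rw [← sub_eq_zero] at hp₁₂ ⊢
      rw [← Polynomial.eval₂_sub] at hp₁₂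
      generalize p₁ - p₂ = p at hp₁₂ ⊢
      obtain ⟨k, P, hP⟩ : ∃ (k : ℕ) (P : Polynomial B.quo.A), p * Polynomial.C (ψ g) ^ k =
          P.map (ψ : B.quo.A →+* (B.quo.loc g hgr).A) := by
        clear hp₁₂
        induction p using Polynomial.induction_on' with
        | add p r hp hr =>
          obtain ⟨k, P, hP⟩ := hp
          obtain ⟨l, R, hR⟩ := hr
          refine ⟨k + l, P * Polynomial.C g ^ l + R * Polynomial.C g ^ k, ?_⟩
          rw [Polynomial.map_add, Polynomial.map_mul, Polynomial.map_mul, ← hP, ← hR,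
            Polynomial.map_pow, Polynomial.map_pow, Polynomial.map_C]
          change _ = p * Polynomial.C (ψ g) ^ k * Polynomial.C (ψ g) ^ l +
            r * Polynomial.C (ψ g) ^ l * Polynomial.C (ψ g) ^ k
          ring
        | monomial n a =>
          obtain ⟨k, b, hb⟩ := hS.lsurj a
          refine ⟨k, Polynomial.monomial n b, ?_⟩
          rw [Polynomial.map_monomial, ← Polynomial.C_pow, Polynomial.monomial_mul_C, hb]
          rfl
      have h1 : ψ' (Polynomial.eval₂ (ι : B.quo.A →+* (B.anti q).quo.A) v P) = 0 := by
        have h2 : Polynomial.eval₂ (i : (B.quo.loc g hgr).A →+* ((B.anti q).quo.loc g' hgr').A)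
            (ψ' v) (p * Polynomial.C (ψ g) ^ k) = 0 := by
          rw [Polynomial.eval₂_mul, hp₁₂, zero_mul]
        rw [hP, Polynomial.eval₂_map] at h2
        refine ((Polynomial.hom_eval₂ P (ι : B.quo.A →+* (B.anti q).quo.A)
          (ψ' : (B.anti q).quo.A →+* ((B.anti q).quo.loc g' hgr').A) v).trans ?_).trans h2
        congr 1
        exact RingHom.ext fun a => (hi a).symm
      obtain ⟨N, hN⟩ := hS'.lker _ h1
      have h3 : ∀ m, ψ (P.coeff m) = 0 := by
        intro m
        have h4 : h ^ (2 * N) * ((P.coeff m).1 * h ^ m) = 0 := by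
          rw [← coeffE, pow_mul, ← Polynomial.coeff_C_mul, Polynomial.C_pow, ← hg']
          exact congr_arg (fun t : (B.anti q).quo.A => Polynomial.coeff (t.1 : Polynomial B.A) m) hN
        have h5 : g ^ (N + m) * P.coeff m = 0 := Subtype.ext (by
          change g.1 ^ (N + m) * (P.coeff m).1 = 0
          rw [hg]
          linear_combination h ^ m * h4)
        have h6 := congr_arg ψ h5
        rw [map_mul, map_pow, map_zero] at h6
        exact (hS.unit.pow (N + m)).mul_right_eq_zero.1 h6
      have h7 : p * Polynomial.C (ψ g) ^ k = 0 := by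
        rw [hP]
        refine Polynomial.ext fun m => ?_
        rw [Polynomial.coeff_map, Polynomial.coeff_zero]
        exact h3 m
      exact ((hS.unit.map Polynomial.C).pow k).mul_left_eq_zero.1 h7
    · intro t
      let E := Polynomial.eval₂RingHom
        (i : (B.quo.loc g hgr).A →+* ((B.anti q).quo.loc g' hgr').A) (ψ' v)
      suffices t ∈ E.range by exact this
      have hdiv : ∀ (u) (k : ℕ), u * ψ' g' ^ k ∈ E.range → u ∈ E.range := by
        intro u k hu
        obtain ⟨w, hw⟩ := hS.unit
        have h1 : ψ' g' * i (↑w⁻¹) = 1 := by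
          have h0 : ψ' g' = i (ψ g) := by rw [hi]; exact congr_arg ψ' hιg.symm
          rw [h0, ← map_mul]
          change i (B.quo.toGrAlg.toLoc g hgr g * _) = 1
          rw [← hw, Units.mul_inv, map_one]
        have h3 : i (↑w⁻¹) ∈ E.range := ⟨Polynomial.C (↑w⁻¹), by simp [E]⟩
        have h2 : i (↑w⁻¹) ^ k ∈ E.range := pow_mem h3 k
        have := mul_mem hu h2
        rwa [mul_assoc, ← mul_pow, h1, one_pow, mul_one] at this
      obtain ⟨n, a, ha⟩ := hS'.lsurj t
      refine hdiv t n ?_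
      change t * (B.anti q).quo.toGrAlg.toLoc g' hgr' g' ^ n ∈ _
      rw [ha]
      have hc : ∀ m, (-1) ^ m * B.τ (Polynomial.coeff a.1 m) = Polynomial.coeff a.1 m := fun m => by
        rw [← anti_coeff (q := q)]
        exact congr_arg (fun p => Polynomial.coeff p m) a.2
      have hc' : ∀ m, B.τ (Polynomial.coeff a.1 m) = (-1) ^ m * Polynomial.coeff a.1 m := fun m => by
        conv_rhs => rw [← hc m]
        rw [← mul_assoc, ← mul_pow]
        simp
      let am : ℕ → (B.anti q).quo.A := fun m => ⟨Polynomial.monomial m (Polynomial.coeff a.1 m), by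
        rw [mem_inv]
        refine Polynomial.ext fun k => ?_
        rw [anti_coeff, Polynomial.coeff_monomial]
        split_ifs with hk
        · rw [← hk]; exact hc m
        · simp⟩
      have hsum : a = ∑ m ∈ Polynomial.support a.1, am m := by
        refine Subtype.ext ?_
        rw [AddSubmonoidClass.coe_finsetSum]
        exact Polynomial.as_sum_support a.1
      rw [hsum, map_sum]
      refine sum_mem fun m _ => hdiv _ m ?_
      obtain ⟨x, hx⟩ : ∃ x : B.quo.A, x.1 = Polynomial.coeff a.1 m * h ^ m := by
        refine ⟨⟨Polynomial.coeff a.1 m * h ^ m, ?_⟩, rfl⟩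
        have h1 : ((-1 : B.A) ^ m) * (-1) ^ m = 1 := by rw [← mul_pow]; simp
        rw [mem_inv, map_mul, map_pow, hh, hc', neg_pow h]
        generalize (-1 : B.A) ^ m = e at h1
        linear_combination (Polynomial.coeff a.1 m * h ^ m) * h1
      have h3 : am m * g' ^ m = ι x * v ^ m := by
        refine Subtype.ext ?_
        change Polynomial.monomial m (Polynomial.coeff a.1 m) * g'.1 ^ m =
          Polynomial.C x.1 * (Polynomial.C h * Polynomial.X) ^ m
        rw [hg', hx, ← Polynomial.C_mul_X_pow_eq_monomial]
        simp only [map_mul, map_pow]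
        ring
      have h4 : ψ' (am m) * ψ' g' ^ m = i (ψ x) * ψ' v ^ m := by
        rw [hi, ← map_pow, ← map_mul, h3, map_mul, map_pow]
      rw [h4]
      have h5 : i (ψ x) ∈ E.range := ⟨Polynomial.C (ψ x), by simp [E]⟩
      have h6 : ψ' v ∈ E.range := ⟨Polynomial.X, by simp [E]⟩
      exact mul_mem h5 (pow_mem h6 m)
  refine PotVar.cl_of_line (P := B.quo.loc g hgr) (Q := (B.anti q).quo.loc g' hgr') hl ?_
  exact (hi _).trans rfl

theorem cl_anti (B : InvPot) (q : ℚ) :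
    PotVar.cl (B.anti q).quo = PotVar.L * PotVar.cl B.quo := by
  have key : ∀ (n : ℕ) (B : InvPot) (l : List B.A), l.length = n →
      (∀ h ∈ l, B.τ h = -h ∧ ∃ r, B.IsHom r h) →
      (∀ a, a - B.τ a ∈ Ideal.span {h | h ∈ l}) →
      PotVar.cl (B.anti q).quo = PotVar.L * PotVar.cl B.quo := by
    intro n
    induction n with
    | zero =>
      intro B l hl _ h
      obtain rfl := List.length_eq_zero_iff.1 hl
      refine anti_base B q fun a => ?_
      have := h a
      simp only [List.not_mem_nil] at this
      rw [show {h : B.A | False} = ∅ from rfl, Ideal.span_empty, Submodule.mem_bot, sub_eq_zero]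
        at this
      exact this.symm
    | succ n ih =>
      intro B l hl h1 h2
      obtain ⟨h, l, rfl⟩ := List.exists_cons_of_length_eq_add_one hl
      obtain ⟨hh, r, hr⟩ := h1 h (by simp)
      let g : B.quo.A := ⟨h ^ 2, by rw [mem_inv, map_pow, hh]; ring⟩
      have hgr : B.quo.IsHom (2 • r) g := isHom_quo.2 (hr.pow 2)
      let g' : (B.anti q).quo.A := ⟨Polynomial.C (h ^ 2), by
        rw [mem_inv, anti_C, map_pow, hh, neg_sq]⟩
      have hgr' : (B.anti q).quo.IsHom (2 • r) g' :=
        isHom_quo.2 (isGr_polyC B.toGrAlg q _ _ (hr.pow 2))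
      let B' := B.quotAnti h hr hh
      let π := B.toGrAlg.toQuot h hr
      have e1 : PotVar.cl (B.quo.quot g hgr) = PotVar.cl B'.quo :=
        quo_nil (P := B) (Q := B') π (isGr_toQuot _ _ _) (toQuot_surjective _ _ _) (fun _ => rfl)
          rfl h hh (fun a => toQuot_eq_zero) g rfl hgr
      have e2 : PotVar.cl ((B.anti q).quo.quot g' hgr') = PotVar.cl (B'.anti q).quo := by
        refine quo_nil (P := B.anti q) (Q := B'.anti q) (Polynomial.mapAlgHom π) ?_ ?_ ?_ ?_
          (Polynomial.C h) ?_ ?_ g' ?_ hgr'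
        · apply isGr_poly
          · intro s a ha
            simpa using isGr_polyC B'.toGrAlg q _ _ (isGr_toQuot _ _ hr _ _ ha)
          · simpa using isHom_polyX B'.toGrAlg q
        · exact Polynomial.map_surjective _ (toQuot_surjective _ _ hr)
        · intro p
          refine Polynomial.ext fun m => ?_
          rw [anti_coeff]
          simp only [Polynomial.coe_mapAlgHom, Polynomial.coeff_map]
          refine (congr_arg π (anti_coeff (q := q) p m)).trans ?_
          rw [map_mul, map_pow, map_neg, map_one]
          rfl
        · simp; rfl
        · simp [hh]
        · intro p
          rw [Polynomial.C_dvd_iff_dvd_coeff, Polynomial.ext_iff]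
          simp only [Polynomial.coe_mapAlgHom, Polynomial.coeff_map, Polynomial.coeff_zero]
          exact forall_congr' fun m => toQuot_eq_zero (hg := hr)
        · exact map_pow _ _ _
      have e3 : PotVar.cl (B'.anti q).quo = PotVar.L * PotVar.cl B'.quo := by
        refine ih B' (l.map π) (by simpa using hl) ?_ ?_
        · intro k hk
          obtain ⟨k, hk', rfl⟩ := List.mem_map.1 hk
          obtain ⟨h3, s, h4⟩ := h1 k (by simp [hk'])
          refine ⟨?_, s, isGr_toQuot _ _ hr _ _ h4⟩
          rw [← map_neg, ← h3]; rfl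
        · intro a
          obtain ⟨a, rfl⟩ := toQuot_surjective _ h hr a
          have h3 := Ideal.mem_map_of_mem π (h2 a)
          rw [Ideal.map_span] at h3
          refine (Ideal.span_le.2 ?_) h3
          rintro _ ⟨k, hk', rfl⟩
          obtain rfl | hk := List.mem_cons.1 hk'
          · have : π k = 0 := toQuot_eq_zero.2 ⟨1, (mul_one _).symm⟩
            rw [this]; exact zero_mem _
          · exact Ideal.subset_span (List.mem_map_of_mem hk)
      rw [PotVar.cl_loc _ g' hgr', PotVar.cl_loc _ g hgr, e2, e3, e1,
        anti_loc B q h hr hh g rfl hgr g' rfl hgr', mul_add]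
  classical
  obtain ⟨S, hf, hS, hq⟩ := B.gen
  let l : List B.A := (hf.toFinset.image fun s => s - B.τ s).toList
  have hl : ∀ s ∈ S, s - B.τ s ∈ l := fun s hs => by
    simp only [l, Finset.mem_toList, Finset.mem_image, Set.Finite.mem_toFinset]
    exact ⟨s, hs, rfl⟩
  refine key l.length B l rfl ?_ ?_
  · intro h hh
    simp only [l, Finset.mem_toList, Finset.mem_image, Set.Finite.mem_toFinset] at hh
    obtain ⟨s, hs, rfl⟩ := hh
    obtain ⟨q, hq⟩ := hq s hs
    exact ⟨by rw [map_sub, B.inv, neg_sub], q, IsHom.sub hq (B.gr _ _ hq)⟩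
  · intro a
    have ha : a ∈ Algebra.adjoin ℂ S := by rw [hS]; trivial
    induction ha using Algebra.adjoin_induction with
    | mem s hs => exact Ideal.subset_span (hl s hs)
    | algebraMap c => rw [AlgHom.commutes, sub_self]; exact zero_mem _
    | add x y _ _ hx hy => rw [map_add, add_sub_add_comm]; exact add_mem hx hy
    | mul x y _ _ hx hy =>
      rw [map_mul, show x * y - B.τ x * B.τ y = x * (y - B.τ y) + B.τ y * (x - B.τ x) by ring]
      exact add_mem (Ideal.mul_mem_left _ _ hy) (Ideal.mul_mem_left _ _ hx)

end InvPot

end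

section

open GrAlg

namespace GrAlg

/-- The map `(X × X) × A^1 ← (X × A^1) × (X × A^1)`, `d = x - y`. -/
def diffMap (A : Type) [CommRing A] [Algebra ℂ A] :
    Polynomial (A ⊗[ℂ] A) →ₐ[ℂ] Polynomial A ⊗[ℂ] Polynomial A :=
  Polynomial.eval₂AlgHom (Algebra.TensorProduct.map Polynomial.CAlgHom Polynomial.CAlgHom)
    (Polynomial.X ⊗ₜ 1 - 1 ⊗ₜ Polynomial.X) (fun _ => Commute.all _ _)

theorem diffMap_C (A : Type) [CommRing A] [Algebra ℂ A] (a b : A) :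
    diffMap A (Polynomial.C (a ⊗ₜ b)) = Polynomial.C a ⊗ₜ Polynomial.C b := by
  simp [diffMap]

theorem diffMap_X (A : Type) [CommRing A] [Algebra ℂ A] :
    diffMap A Polynomial.X = Polynomial.X ⊗ₜ 1 - 1 ⊗ₜ Polynomial.X := by
  simp [diffMap]

theorem isGr_diffMap (X : GrAlg ℚ) (q : ℚ) :
    IsGr (X := (X.tensor X).poly q) (Y := (X.poly q).tensor (X.poly q)) (diffMap X.A) := by
  apply isGr_poly
  · have key := IsGr.tmap (isGr_polyC X q) (isGr_polyC X q)
    have e : (diffMap X.A).comp Polynomial.CAlgHom =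
        Algebra.TensorProduct.map Polynomial.CAlgHom Polynomial.CAlgHom :=
      Algebra.TensorProduct.ext' fun a b => diffMap_C X.A a b
    rw [e]
    exact key
  · rw [diffMap_X]
    exact (isGr_inclLeft (X.poly q) (X.poly q) _ _ (isHom_polyX X q)).sub
      (isGr_inclRight (X.poly q) (X.poly q) _ _ (isHom_polyX X q))

open Polynomial in
theorem diff_aux {A R S : Type} [CommRing A] [Algebra ℂ A] [CommRing R] [Algebra ℂ R] [CommRing S]
    [Algebra ℂ S] (l r : A →ₐ[ℂ] R) (i₁ i₂ : A[X] →ₐ[ℂ] S) (δ : R[X] →ₐ[ℂ] S)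
    (hl : ∀ a, δ (C (l a)) = i₁ (C a)) (hr : ∀ a, δ (C (r a)) = i₂ (C a))
    (hX : δ Polynomial.X = i₁ Polynomial.X - i₂ Polynomial.X)
    (hR : ∀ f g : R →ₐ[ℂ] R[X][X], f.comp l = g.comp l → f.comp r = g.comp r → f = g)
    (hS : ∀ f g : S →ₐ[ℂ] S, f.comp i₁ = g.comp i₁ → f.comp i₂ = g.comp i₂ → f = g)
    (lift : ∀ j₁ j₂ : A[X] →ₐ[ℂ] R[X][X],
      ∃ j : S →ₐ[ℂ] R[X][X], j.comp i₁ = j₁ ∧ j.comp i₂ = j₂) :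
    Function.Bijective (Polynomial.eval₂ (δ : R[X] →+* S) (i₁ Polynomial.X + i₂ Polynomial.X)) := by
  let f : R[X][X] →ₐ[ℂ] S :=
    Polynomial.eval₂AlgHom δ (i₁ Polynomial.X + i₂ Polynomial.X) (fun _ => Commute.all _ _)
  have fC : ∀ a, f (C a) = δ a := fun a => by simp [f]
  have fX : f Polynomial.X = i₁ Polynomial.X + i₂ Polynomial.X := by simp [f]
  let j₁ : A[X] →ₐ[ℂ] R[X][X] := Polynomial.eval₂AlgHom
    ((CAlgHom : R[X] →ₐ[ℂ] R[X][X]).comp (CAlgHom.comp l))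
    ((1 / 2 : ℂ) • (Polynomial.X + C Polynomial.X)) (fun _ => Commute.all _ _)
  let j₂ : A[X] →ₐ[ℂ] R[X][X] := Polynomial.eval₂AlgHom
    ((CAlgHom : R[X] →ₐ[ℂ] R[X][X]).comp (CAlgHom.comp r))
    ((1 / 2 : ℂ) • (Polynomial.X - C Polynomial.X)) (fun _ => Commute.all _ _)
  have j₁C : ∀ a, j₁ (C a) = C (C (l a)) := fun a => by simp [j₁]
  have j₂C : ∀ a, j₂ (C a) = C (C (r a)) := fun a => by simp [j₂]
  have j₁X : j₁ Polynomial.X = (1 / 2 : ℂ) • (Polynomial.X + C Polynomial.X) := by simp [j₁]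
  have j₂X : j₂ Polynomial.X = (1 / 2 : ℂ) • (Polynomial.X - C Polynomial.X) := by simp [j₂]
  obtain ⟨j, hj₁, hj₂⟩ := lift j₁ j₂
  have e₁ : ∀ p, j (i₁ p) = j₁ p := fun p => DFunLike.congr_fun hj₁ p
  have e₂ : ∀ p, j (i₂ p) = j₂ p := fun p => DFunLike.congr_fun hj₂ p
  have half : ∀ {V : Type} [AddCommGroup V] [Module ℂ V] (v : V), (1 / 2 : ℂ) • (v + v) = v :=
    fun v => by rw [← two_smul ℂ, smul_smul]; norm_num
  have h1 : j.comp f = AlgHom.id ℂ _ := by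
    refine Polynomial.algHom_ext' (Polynomial.algHom_ext' ?_ ?_) ?_
    · refine hR _ _ (AlgHom.ext fun a => ?_) (AlgHom.ext fun a => ?_)
      · change j (f (C (C (l a)))) = C (C (l a))
        rw [fC, hl, e₁, j₁C]
      · change j (f (C (C (r a)))) = C (C (r a))
        rw [fC, hr, e₂, j₂C]
    · change j (f (C Polynomial.X)) = C Polynomial.X
      rw [fC, hX, map_sub, e₁, e₂, j₁X, j₂X, ← smul_sub, add_sub_sub_cancel, half]
    · change j (f Polynomial.X) = Polynomial.X
      rw [fX, map_add, e₁, e₂, j₁X, j₂X, ← smul_add, add_add_sub_cancel, half]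
  have h2 : f.comp j = AlgHom.id ℂ _ := by
    refine hS _ _ (Polynomial.algHom_ext' (AlgHom.ext fun a => ?_) ?_)
      (Polynomial.algHom_ext' (AlgHom.ext fun a => ?_) ?_)
    · change f (j (i₁ (C a))) = i₁ (C a)
      rw [e₁, j₁C, fC, hl]
    · change f (j (i₁ Polynomial.X)) = i₁ Polynomial.X
      rw [e₁, j₁X, map_smul, map_add, fX, fC, hX, add_add_sub_cancel, half]
    · change f (j (i₂ (C a))) = i₂ (C a)
      rw [e₂, j₂C, fC, hr]
    · change f (j (i₂ Polynomial.X)) = i₂ Polynomial.X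
      rw [e₂, j₂X, map_smul, map_sub, fX, fC, hX, add_sub_sub_cancel, half]
  exact ⟨Function.LeftInverse.injective (g := j) fun a => DFunLike.congr_fun h1 a,
    Function.RightInverse.surjective (g := j) fun a => DFunLike.congr_fun h2 a⟩

open Polynomial in
theorem diff_bij (A : Type) [CommRing A] [Algebra ℂ A] :
    Function.Bijective (Polynomial.eval₂ (diffMap A : (A ⊗[ℂ] A)[X] →+* A[X] ⊗[ℂ] A[X])
      (Polynomial.X ⊗ₜ 1 + 1 ⊗ₜ Polynomial.X)) := by
  refine diff_aux (Algebra.TensorProduct.includeLeft : A →ₐ[ℂ] A ⊗[ℂ] A)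
    (Algebra.TensorProduct.includeRight : A →ₐ[ℂ] A ⊗[ℂ] A)
    (Algebra.TensorProduct.includeLeft : A[X] →ₐ[ℂ] A[X] ⊗[ℂ] A[X])
    (Algebra.TensorProduct.includeRight : A[X] →ₐ[ℂ] A[X] ⊗[ℂ] A[X]) (diffMap A)
    (fun a => ?_) (fun a => ?_) (diffMap_X A) (fun f g h h' => Algebra.TensorProduct.ext h h')
    (fun f g h h' => Algebra.TensorProduct.ext h h') (fun j₁ j₂ => ?_)
  · exact diffMap_C A a 1
  · exact diffMap_C A 1 a
  · refine ⟨Algebra.TensorProduct.lift j₁ j₂ (fun a b => mul_comm (j₁ a) (j₂ b)), ?_, ?_⟩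
    · exact Algebra.TensorProduct.lift_comp_includeLeft _ _ _
    · exact Algebra.TensorProduct.lift_comp_includeRight _ _ (fun a b => mul_comm (j₁ a) (j₂ b))

theorem swap_line (X : GrAlg ℚ) (q : ℚ) :
    IsLine ((X.tensor X).poly q) ((X.poly q).tensor (X.poly q)) (diffMap X.A)
      (Polynomial.X ⊗ₜ 1 + 1 ⊗ₜ Polynomial.X) :=
  ⟨⟨q, (isGr_inclLeft (X.poly q) (X.poly q) _ _ (isHom_polyX X q)).add
    (isGr_inclRight (X.poly q) (X.poly q) _ _ (isHom_polyX X q))⟩, isGr_diffMap X q,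
    diff_bij X.A⟩

end GrAlg

namespace PotVar

theorem diffMap_equiv (P : PotVar) (q : ℚ) (a : (P.swap.anti q).A) :
    diffMap P.A ((P.swap.anti q).τ a) = (P.poly q).swap.τ (diffMap P.A a) := by
  have : (diffMap P.A).comp (P.swap.anti q).τ = (P.poly q).swap.τ.comp (diffMap P.A) := by
    refine Polynomial.algHom_ext' (Algebra.TensorProduct.ext' fun a b => ?_) ?_
    · change diffMap P.A ((P.swap.anti q).τ (Polynomial.C (a ⊗ₜ b))) =
        (P.poly q).swap.τ (diffMap P.A (Polynomial.C (a ⊗ₜ b)))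
      rw [InvPot.anti_C, diffMap_C]
      refine (diffMap_C P.A b a).trans ?_
      simp
    · change diffMap P.A ((P.swap.anti q).τ Polynomial.X) =
        (P.poly q).swap.τ (diffMap P.A Polynomial.X)
      rw [InvPot.anti_X, map_neg, diffMap_X]
      simp
  exact DFunLike.congr_fun this a

theorem swap_s (P : PotVar) (q : ℚ) : (P.poly q).swap.τ
    (Polynomial.X ⊗ₜ 1 + 1 ⊗ₜ Polynomial.X) = Polynomial.X ⊗ₜ 1 + 1 ⊗ₜ Polynomial.X := by
  simp [add_comm]

theorem sym2_line (P : PotVar) (q : ℚ) :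
    IsLine (P.swap.anti q).quo.toGrAlg (P.poly q).sym2.toGrAlg
      (InvPot.map (P := P.swap.anti q) (Q := (P.poly q).swap) (diffMap P.A) (P.diffMap_equiv q))
      ⟨_, P.swap_s q⟩ :=
  InvPot.quo_line (Y := P.swap.anti q) (T := (P.poly q).swap) (swap_line P.toGrAlg q) _ _

theorem sym2_poly (P : PotVar) (q : ℚ) : cl (P.poly q).sym2 = L ^ 2 * cl P.sym2 := by
  rw [cl_of_line (P := (P.swap.anti q).quo) (Q := (P.poly q).sym2) (P.sym2_line q) ?_,
    InvPot.cl_anti, ← mul_assoc, ← pow_two]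
  refine Subtype.ext ?_
  change diffMap P.A (Polynomial.C (P.f ⊗ₜ 1 + 1 ⊗ₜ P.f)) = _
  rw [map_add, map_add, diffMap_C, diffMap_C, Polynomial.C_1]

theorem sym2_pull (X : GrAlg ℚ) : cl (pull X).sym2 = 0 := by
  have h : IsLine ((zero X).swap.anti 1).quo.toGrAlg (pull X).sym2.toGrAlg _ _ :=
    (zero X).sym2_line 1
  obtain ⟨e, he, -, h2⟩ := h.iso (q := 1) (pull X).sym2.hf
  rw [← cl_pull ((zero X).swap.anti 1).quo.toGrAlg]
  exact (cl_eq ⟨e, he, h2⟩).symm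

end PotVar

/-- The group of truncated series `1 + a t + b t²` under multiplication. -/
@[ext]
structure Lam (R : Type*) where
  /-- the coefficient of `t` -/
  fst : R
  /-- the coefficient of `t²` -/
  snd : R

namespace Lam

variable {R S : Type*} [CommRing R] [CommRing S]

instance : Add (Lam R) := ⟨fun x y => ⟨x.fst + y.fst, x.snd + y.snd + x.fst * y.fst⟩⟩
instance : Zero (Lam R) := ⟨⟨0, 0⟩⟩
instance : Neg (Lam R) := ⟨fun x => ⟨-x.fst, x.fst ^ 2 - x.snd⟩⟩

theorem add_fst (x y : Lam R) : (x + y).fst = x.fst + y.fst := rfl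
theorem add_snd (x y : Lam R) : (x + y).snd = x.snd + y.snd + x.fst * y.fst := rfl
theorem zero_fst : (0 : Lam R).fst = 0 := rfl
theorem zero_snd : (0 : Lam R).snd = 0 := rfl
theorem neg_fst (x : Lam R) : (-x).fst = -x.fst := rfl
theorem neg_snd (x : Lam R) : (-x).snd = x.fst ^ 2 - x.snd := rfl

instance : AddCommGroup (Lam R) where
  add_assoc x y z := by ext <;> simp only [add_fst, add_snd] <;> ring
  zero_add x := by ext <;> simp only [add_fst, add_snd, zero_fst, zero_snd] <;> ring
  add_zero x := by ext <;> simp only [add_fst, add_snd, zero_fst, zero_snd] <;> ring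
  add_comm x y := by ext <;> simp only [add_fst, add_snd] <;> ring
  neg_add_cancel x := by
    ext <;> simp only [add_fst, add_snd, neg_fst, neg_snd, zero_fst, zero_snd] <;> ring
  nsmul := nsmulRec
  zsmul := zsmulRec

/-- Functoriality. -/
def map (f : R →+* S) : Lam R →+ Lam S where
  toFun x := ⟨f x.fst, f x.snd⟩
  map_zero' := by ext <;> exact map_zero f
  map_add' x y := by ext <;> simp only [add_fst, add_snd, map_add, map_mul]

/-- `(a, b) ↦ (l a, l² b)`. -/
def scale (l : R) : Lam R →+ Lam R where
  toFun x := ⟨l * x.fst, l ^ 2 * x.snd⟩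
  map_zero' := by ext <;> exact mul_zero _
  map_add' x y := by ext <;> simp only [add_fst, add_snd] <;> ring

end Lam

namespace PotVar

/-- `[P] ↦ 1 + [P] t + [Sym² P] t²`. -/
def sigma : K →+ Lam K :=
  lift (fun P => ⟨cl P, cl P.sym2⟩)
    (fun P Q h => by rw [cl_eq h, cl_eq (sym2_iso h)])
    (by
      intro r hr
      cases hr with
      | scissors P Z U g φ ψ h hφ hψ =>
        rw [map_sub, map_sub, freeLift_of, freeLift_of, freeLift_of, sub_sub, sub_eq_zero]
        ext
        · exact cl_scissors h hφ hψ
        · exact sym2_scissors h hφ hψ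
      | line P q r =>
        rw [map_sub, freeLift_of, freeLift_of, sub_eq_zero, sym2_poly, sym2_poly, cl_poly, cl_poly]
      | pull X =>
        rw [freeLift_of, cl_pull, sym2_pull]
        rfl)

theorem sigma_cl (P : PotVar) : sigma (cl P) = ⟨cl P, cl P.sym2⟩ := lift_cl _ _ _ P

theorem sigma_fst (a : K) : (sigma a).fst = a := by
  let F : Lam K →+ K := { toFun := Lam.fst, map_zero' := rfl, map_add' := fun _ _ => rfl }
  have : F.comp sigma = AddMonoidHom.id K := hom_ext fun P => by
    change (sigma (cl P)).fst = cl P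
    rw [sigma_cl]
  exact DFunLike.congr_fun this a

theorem sigma_L_mul (a : K) : sigma (L * a) = Lam.scale L (sigma a) := by
  have : sigma.comp (AddMonoidHom.mulLeft L) = (Lam.scale L).comp sigma := hom_ext fun P => by
    change sigma (L * cl P) = Lam.scale L (sigma (cl P))
    rw [sigma_cl, ← cl_poly P 0, sigma_cl, cl_poly, sym2_poly]
    rfl
  exact DFunLike.congr_fun this a

end PotVar

end

section

open GrAlg

namespace Lam

universe u

variable {R : Type u} [CommRing R]

/-- The elements `l` and `l^n - 1`, `n ≥ 1`. -/
def dens (l : R) : Submonoid R := Submonoid.closure ({l} ∪ {x | ∃ n : ℕ, x = l ^ (n + 1) - 1})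

/-- `scale l` as an endomorphism. -/
def scaleEnd (l : R) : AddMonoid.End (Lam R) := scale l

theorem iter_scale (l : R) (n : ℕ) (x : Lam R) :
    ((scaleEnd l) ^ n) x = ⟨l ^ n * x.fst, (l ^ n) ^ 2 * x.snd⟩ := by
  induction n with
  | zero => ext <;> simp
  | succ n ih =>
    rw [pow_succ', AddMonoid.End.coe_mul, Function.comp_apply, ih]
    ext
    · change l * (l ^ n * x.fst) = _
      ring
    · change l ^ 2 * ((l ^ n) ^ 2 * x.snd) = _
      ring

theorem scale_bij {l : R} (hl : IsUnit l) : Function.Bijective (scale l) := by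
  obtain ⟨u, rfl⟩ := hl
  constructor
  · intro x y h
    have h1 : (u : R) * x.fst = u * y.fst := congr_arg fst h
    have h2 : (u : R) ^ 2 * x.snd = u ^ 2 * y.snd := congr_arg snd h
    ext
    · exact u.isUnit.mul_left_cancel h1
    · exact (u.isUnit.pow 2).mul_left_cancel h2
  · intro x
    refine ⟨⟨↑u⁻¹ * x.fst, ↑u⁻¹ ^ 2 * x.snd⟩, ?_⟩
    ext
    · change (u : R) * (↑u⁻¹ * x.fst) = _
      rw [← mul_assoc, Units.mul_inv, one_mul]
    · change (u : R) ^ 2 * (↑u⁻¹ ^ 2 * x.snd) = _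
      rw [← mul_assoc, ← mul_pow, Units.mul_inv, one_pow, one_mul]

theorem scale_sub_bij {l : R} (n : ℕ) (h1 : IsUnit (l ^ n - 1)) (h2 : IsUnit (l ^ (2 * n) - 1)) :
    Function.Bijective (DFunLike.coe (scaleEnd l ^ n - 1)) := by
  have key : ∀ x : Lam R, ((scaleEnd l) ^ n - 1) x =
      ⟨(l ^ n - 1) * x.fst, (l ^ (2 * n) - 1) * x.snd - (l ^ n - 1) * x.fst ^ 2⟩ := by
    intro x
    have : ((scaleEnd l) ^ n - 1) x =
      ((scaleEnd l) ^ n) x + -x := by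
      rw [← sub_eq_add_neg]; rfl
    rw [this, iter_scale]
    ext
    · rw [add_fst, neg_fst]; ring
    · rw [add_snd, neg_snd, neg_fst]; ring
  constructor
  · intro x y h
    rw [key, key] at h
    have e1 : (l ^ n - 1) * x.fst = (l ^ n - 1) * y.fst := congr_arg fst h
    have e2 : (l ^ (2 * n) - 1) * x.snd - (l ^ n - 1) * x.fst ^ 2 =
      (l ^ (2 * n) - 1) * y.snd - (l ^ n - 1) * y.fst ^ 2 := congr_arg snd h
    have e3 := h1.mul_left_cancel e1
    rw [e3, sub_left_inj] at e2
    ext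
    · exact e3
    · exact h2.mul_left_cancel e2
  · intro x
    obtain ⟨a, ha⟩ := h1.dvd (a := x.fst)
    obtain ⟨b, hb⟩ := h2.dvd (a := x.snd + (l ^ n - 1) * a ^ 2)
    refine ⟨⟨a, b⟩, ?_⟩
    rw [key]
    ext
    · exact ha.symm
    · change (l ^ (2 * n) - 1) * b - (l ^ n - 1) * a ^ 2 = x.snd
      rw [← hb]; ring

theorem exists_extend {R' : Type u} [CommRing R'] [Algebra R R'] (l : R)
    [IsLocalization (dens l) R'] (s : R →+ Lam R) (hs : ∀ a, s (l * a) = scale l (s a)) :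
    ∃! s' : R' →+ Lam R',
      (∀ a, s' (algebraMap R R' a) = map (algebraMap R R') (s a)) ∧
      ∀ x, s' (algebraMap R R' l * x) = scale (algebraMap R R' l) (s' x) := by
  set l' : R' := algebraMap R R' l with hl'
  let P := Polynomial ℤ
  let _ : Algebra P R := (Polynomial.aeval (R := ℤ) l).toRingHom.toAlgebra
  let _ : Algebra P R' := ((algebraMap R R').comp (algebraMap P R)).toAlgebra
  have hT : IsScalarTower P R R' := IsScalarTower.of_algebraMap_eq fun _ => rfl
  let ev : P →+* AddMonoid.End (Lam R') :=
    (Polynomial.aeval (R := ℤ) (scaleEnd l')).toRingHom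
  let _ : Module P (Lam R') := Module.compHom (Lam R') ev
  have hsm : ∀ (p : P) (x : Lam R'), p • x = ev p x := fun _ _ => rfl
  have evX : ev Polynomial.X = scaleEnd l' := Polynomial.aeval_X _
  have hXR : algebraMap P R Polynomial.X = l := by
    change Polynomial.aeval (R := ℤ) l Polynomial.X = l
    simp
  have hXR' : algebraMap P R' Polynomial.X = l' := by
    change algebraMap R R' (algebraMap P R Polynomial.X) = l'
    rw [hXR]
  let N : Submonoid P :=
    Submonoid.closure ({Polynomial.X} ∪ {x | ∃ n : ℕ, x = Polynomial.X ^ (n + 1) - 1})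
  have hN : Algebra.algebraMapSubmonoid R N = dens l := by
    change N.map (algebraMap P R) = dens l
    rw [MonoidHom.map_mclosure, dens, Set.image_union, Set.image_singleton]
    congr 2
    · exact congr_arg _ hXR
    · ext x
      constructor
      · rintro ⟨_, ⟨n, rfl⟩, rfl⟩
        refine ⟨n, ?_⟩
        rw [map_sub, map_pow, map_one, hXR]
      · rintro ⟨n, rfl⟩
        refine ⟨_, ⟨n, rfl⟩, ?_⟩
        rw [map_sub, map_pow, map_one, hXR]
  have hloc : IsLocalization (Algebra.algebraMapSubmonoid R N) R' := by
    rw [hN]; infer_instance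
  have hmod : IsLocalizedModule N (IsScalarTower.toAlgHom P R R').toLinearMap :=
    isLocalizedModule_iff_isLocalization.2 hloc
  have lin : ∀ {V W : Type _} [AddCommGroup V] [Module P V] [AddCommGroup W] [Module P W]
      (F : V →+ W), (∀ v, F ((Polynomial.X : P) • v) = (Polynomial.X : P) • F v) →
      ∀ (p : P) v, F (p • v) = p • F v := by
    intro V W _ _ _ _ F hF p
    have hmon : ∀ (n : ℕ) v, F ((Polynomial.X ^ n : P) • v) = (Polynomial.X ^ n : P) • F v := by
      intro n
      induction n with
      | zero => simp
      | succ n ih => intro v; rw [pow_succ, mul_smul, mul_smul, ih, hF]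
    induction p using Polynomial.induction_on' with
    | add p q hp hq => intro v; rw [add_smul, map_add, hp, hq, add_smul]
    | monomial n a =>
      intro v
      have hc1 : (Polynomial.C a : P) = (a : P) := by simp
      rw [← Polynomial.C_mul_X_pow_eq_monomial, mul_smul, mul_smul, hc1, Int.cast_smul_eq_zsmul,
        Int.cast_smul_eq_zsmul, map_zsmul, hmon]
  let g₀ : R →+ Lam R' := (map (algebraMap R R')).comp s
  have hg₀ : ∀ a, g₀ ((Polynomial.X : P) • a) = (Polynomial.X : P) • g₀ a := by
    intro a
    rw [Algebra.smul_def, hXR, hsm, evX]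
    change map (algebraMap R R') (s (l * a)) = _
    rw [hs]
    ext
    · exact map_mul (algebraMap R R') _ _
    · refine (map_mul (algebraMap R R') _ _).trans ?_
      rw [map_pow]
      rfl
  let g : R →ₗ[P] Lam R' := { toFun := g₀, map_add' := map_add g₀, map_smul' := lin g₀ hg₀ }
  have hu : ∀ p : N, IsUnit (algebraMap P (Module.End P (Lam R')) p) := by
    rintro ⟨p, hp⟩
    rw [Module.End.isUnit_iff]
    change Function.Bijective fun x : Lam R' => p • x
    have hunit : ∀ {x : R}, x ∈ dens l → IsUnit (algebraMap R R' x) := fun {x} hx =>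
      IsLocalization.map_units R' (⟨x, hx⟩ : dens l)
    induction hp using Submonoid.closure_induction with
    | mem p hp =>
      rcases hp with rfl | ⟨n, rfl⟩
      · have : (fun x : Lam R' => (Polynomial.X : P) • x) = scale l' := by
          ext1 x; rw [hsm, evX]
          try rfl
        rw [this]
        exact scale_bij (hunit (Submonoid.subset_closure (Or.inl rfl)))
      · have : (fun x : Lam R' => (Polynomial.X ^ (n + 1) - 1 : P) • x) =
            DFunLike.coe (scaleEnd l' ^ (n + 1) - 1) := by
          ext1 x; rw [hsm, map_sub, map_pow, evX, map_one]
        rw [this]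
        refine scale_sub_bij (n + 1) ?_ ?_
        · have := hunit (Submonoid.subset_closure (Or.inr ⟨n, rfl⟩) : l ^ (n + 1) - 1 ∈ dens l)
          rwa [map_sub, map_pow, map_one] at this
        · have := hunit (Submonoid.subset_closure (Or.inr ⟨2 * n + 1, rfl⟩) :
            l ^ (2 * n + 1 + 1) - 1 ∈ dens l)
          rwa [map_sub, map_pow, map_one] at this
    | one =>
      have : (fun x : Lam R' => (1 : P) • x) = id := by
        ext1 x; exact one_smul P x
      rw [this]
      exact Function.bijective_id
    | mul p q _ _ hp hq =>
      have : (fun x : Lam R' => (p * q) • x) = (fun x => p • x) ∘ fun x => q • x := by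
        ext1 x; exact mul_smul p q x
      rw [this]
      exact hp.comp hq
  obtain ⟨F, hF, huniq⟩ := IsLocalizedModule.is_universal N (IsScalarTower.toAlgHom P R R').toLinearMap g hu
  refine ⟨F.toAddMonoidHom, ⟨fun a => LinearMap.congr_fun hF a, fun x => ?_⟩, ?_⟩
  · have := F.map_smul (Polynomial.X : P) x
    rwa [Algebra.smul_def, hXR', hsm, evX] at this
  · rintro s' ⟨h1, h2⟩
    have hX : ∀ x, s' ((Polynomial.X : P) • x) = (Polynomial.X : P) • s' x := by
      intro x
      rw [Algebra.smul_def, hXR', hsm, evX, h2]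
      rfl
    have := huniq { toFun := s', map_add' := map_add s', map_smul' := lin s' hX }
      (LinearMap.ext fun a => h1 a)
    ext1 x
    exact LinearMap.congr_fun this x

end Lam

end

section

open GrAlg

namespace MuVar

/-- The class `𝕃` of the affine line. -/
def lef : K0 := cl (pt.poly 0)

theorem phi_L : PotVar.phi PotVar.L = lef := by
  rw [PotVar.L, PotVar.phi_cl, cl_eq (PotVar.fib_poly _ _ _), cl_eq (PotVar.fib_poly _ _ _)]
  have h0 : GrAlg.Iso ((PotVar.pt.fib 0).poly (QZ.mk 0)) (pt.poly 0) := by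
    obtain ⟨e, he⟩ := fib_pt_zero
    refine ⟨Polynomial.mapAlgEquiv e, ?_⟩
    apply isGr_poly
    · intro r a ha
      simpa using isGr_polyC pt 0 _ _ (he _ _ ha)
    · simpa using isHom_polyX pt 0
  have h1 : Subsingleton ((PotVar.pt.fib 1).poly (QZ.mk 0)).A := by
    have := fib_pt 1 one_ne_zero
    change Subsingleton (Polynomial (PotVar.pt.fib 1).A)
    infer_instance
  rw [cl_eq h0, cl_subsingleton h1, sub_zero, lef]

/-- The operations `σ¹, σ²` on the Grothendieck ring of `μ̂`-varieties: `a ↦ (a, σ²(a))`. -/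
def sigma : K0 →+ Lam K0 := (Lam.map ringEquiv.toRingHom).comp (PotVar.sigma.comp psi)

theorem sigma_lef_mul (a : K0) : sigma (lef * a) = Lam.scale lef (sigma a) := by
  have h : psi lef = PotVar.L := by rw [← phi_L, PotVar.psi_phi]
  change Lam.map _ (PotVar.sigma (psi (lef * a))) = _
  rw [psi_mul, h, PotVar.sigma_L_mul]
  have e : ringEquiv PotVar.L = lef := phi_L
  ext
  · change ringEquiv (PotVar.L * _) = _
    rw [map_mul, e]; rfl
  · change ringEquiv (PotVar.L ^ 2 * _) = _
    rw [map_mul, map_pow, e]; rfl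

end MuVar

/-- `K₀^μ̂(Var_ℂ)[𝕃⁻¹, (𝕃^n - 1)⁻¹ : n ≥ 1]`. -/
def Mot : Type 1 := Localization (Lam.dens MuVar.lef)

instance : CommRing Mot := inferInstanceAs (CommRing (Localization (Lam.dens MuVar.lef)))

instance : Algebra MuVar.K0 Mot :=
  inferInstanceAs (Algebra MuVar.K0 (Localization (Lam.dens MuVar.lef)))

instance : IsLocalization (Lam.dens MuVar.lef) Mot :=
  inferInstanceAs (IsLocalization (Lam.dens MuVar.lef) (Localization (Lam.dens MuVar.lef)))

/-- The class `[X]` of an affine `μ̂`-variety. -/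
def mot (X : MuVar) : Mot := algebraMap MuVar.K0 Mot (MuVar.cl X)

/-- The class `𝕃` of the affine line. -/
def lef : Mot := mot (MuVar.pt.poly 0)

theorem existsUnique_sigma : ∃! s : Mot →+ Lam Mot,
    (∀ a, s (algebraMap MuVar.K0 Mot a) = Lam.map (algebraMap MuVar.K0 Mot) (MuVar.sigma a)) ∧
    ∀ x, s (lef * x) = Lam.scale lef (s x) :=
  Lam.exists_extend (R' := Mot) MuVar.lef MuVar.sigma MuVar.sigma_lef_mul

/-- The operation `σ²` on `Mot`: the extension that satisfies `σ²(𝕃 x) = 𝕃² σ²(x)`. -/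
def sigma2 (x : Mot) : Mot := (existsUnique_sigma.choose x).snd

/-- The series `σ_T(a) = 1 + a T + σ²(a) T²` up to terms of order 3 in `T`. -/
def sigmaSeries (a : Mot) (T : PowerSeries Mot) : PowerSeries Mot :=
  1 + PowerSeries.C a * T + PowerSeries.C (sigma2 a) * T ^ 2

/-- The coefficient of `t²` in the plethystic exponential
`Exp(∑_{n ≥ 1} a_n t^n) = ∏_{n ≥ 1} σ_{t^n}(a_n)`. -/
def expCoeffTwo (F : PowerSeries Mot) : Mot :=
  PowerSeries.coeff 2 (∏ n ∈ Finset.Icc 1 2, sigmaSeries (PowerSeries.coeff n F)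
    (PowerSeries.X ^ n))

namespace GrAlg

variable {Γ : Type} [AddCommGroup Γ]

/-- The affine space whose `i`-th coordinate has degree `q i`. -/
abbrev affine {ι : Type} [Finite ι] (q : ι → Γ) : GrAlg Γ where
  A := MvPolynomial ι ℂ
  co := MvPolynomial.aeval fun i => single (q i) (MvPolynomial.X i)
  gen := ⟨Set.range MvPolynomial.X, Set.finite_range _, MvPolynomial.adjoin_range_X, by
    rintro _ ⟨i, rfl⟩
    exact ⟨q i, MvPolynomial.aeval_X _ _⟩⟩

theorem isHom_affineX {ι : Type} [Finite ι] (q : ι → Γ) (i : ι) :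
    (affine q).IsHom (q i) (MvPolynomial.X i : MvPolynomial ι ℂ) := MvPolynomial.aeval_X _ _

end GrAlg

/-- The variety `μ_m = {x^m = 1}` on which `μ_m` acts by multiplication. -/
def MuVar.mu (m : ℕ) (hm : m ≠ 0) : MuVar :=
  (MuVar.pt.poly (QZ.mk (1 / m))).quot (Polynomial.X ^ m - 1 : Polynomial ℂ) (q := 0) (by
    refine IsHom.sub ?_ isHom_one
    have := (isHom_polyX MuVar.pt (QZ.mk (1 / m))).pow m
    rwa [← map_nsmul, nsmul_eq_mul, mul_one_div_cancel (by exact_mod_cast hm), QZ.mk_one] at this)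

/-- The general linear group with the trivial action. -/
def MuVar.gl (n : ℕ) : MuVar :=
  GrAlg.triv (Localization.Away (Matrix.mvPolynomialX (Fin n) (Fin n) ℂ).det)
    (.trans (S := MvPolynomial (Fin n × Fin n) ℂ) inferInstance
      (IsLocalization.finiteType_of_monoid_fg
        (Submonoid.powers (Matrix.mvPolynomialX (Fin n) (Fin n) ℂ).det) _))

/-- The noncommutative polynomials of degree `d` in `X_1, …, X_m`. -/
def ncHomogeneous (m d : ℕ) : Submodule ℂ (FreeAlgebra ℂ (Fin m)) :=
  Submodule.span ℂ (Set.range (FreeAlgebra.ι ℂ)) ^ d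

/-- The `i`-th generic `n × n` matrix. -/
def genericMatrix (m n : ℕ) (i : Fin m) :
    Matrix (Fin n) (Fin n) (MvPolynomial (Fin m × Fin n × Fin n) ℂ) :=
  Matrix.of fun a b => MvPolynomial.X (i, a, b)

/-- The function `Tr(W)` on the affine space of `m`-tuples of `n × n` matrices. -/
def traceFun {m : ℕ} (W : FreeAlgebra ℂ (Fin m)) (n : ℕ) :
    MvPolynomial (Fin m × Fin n × Fin n) ℂ :=
  Matrix.trace (FreeAlgebra.lift ℂ (genericMatrix m n) W)

/-- The affine space of `m`-tuples of `n × n` matrices, on which `μ_d` acts by scalars. -/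
abbrev matrixSpace (m n d : ℕ) : MuVar :=
  GrAlg.affine fun _ : Fin m × Fin n × Fin n => QZ.mk (1 / d)

theorem isHom_matrix {m d : ℕ} {W : FreeAlgebra ℂ (Fin m)} (n e : ℕ) (hW : W ∈ ncHomogeneous m e)
    (a b : Fin n) :
    (matrixSpace m n d).IsHom (e • QZ.mk (1 / d)) (FreeAlgebra.lift ℂ (genericMatrix m n) W a b) := by
  induction e generalizing W a b with
  | zero =>
    rw [ncHomogeneous, pow_zero] at hW
    obtain ⟨c, rfl⟩ := Submodule.mem_one.1 hW
    rw [AlgHom.commutes, Matrix.algebraMap_matrix_apply, zero_smul]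
    split_ifs
    · exact isHom_algebraMap (X := matrixSpace m n d) c
    · exact isHom_zero _
  | succ e ih =>
    rw [ncHomogeneous, pow_succ] at hW
    induction hW using Submodule.mul_induction_on' with
    | mem_mul_mem u hu v hv =>
      rw [map_mul, Matrix.mul_apply]
      refine isHom_sum _ _ fun j _ => ?_
      rw [succ_nsmul]
      refine (ih hu a j).mul ?_
      induction hv using Submodule.span_induction with
      | mem v hv =>
        obtain ⟨i, rfl⟩ := hv
        rw [FreeAlgebra.lift_ι_apply]
        exact isHom_affineX _ (i, j, b)
      | zero => rw [map_zero]; exact isHom_zero _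
      | add v w _ _ h1 h2 => rw [map_add]; exact h1.add h2
      | smul c v _ h => rw [map_smul]; exact h.smul c
    | add u _ v _ h1 h2 => rw [map_add]; exact h1.add h2

theorem isHom_trace {m d : ℕ} {W : FreeAlgebra ℂ (Fin m)} (hW : W ∈ ncHomogeneous m d) (n : ℕ) :
    (matrixSpace m n d).IsHom 0 (traceFun W n - 1) := by
  refine IsHom.sub ?_ isHom_one
  have h : d • QZ.mk (1 / d) = 0 := by
    by_cases hd : d = 0
    · rw [hd, zero_smul]
    · rw [← map_nsmul, nsmul_eq_mul, mul_one_div_cancel (by exact_mod_cast hd), QZ.mk_one]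
  rw [← h]
  exact isHom_sum _ _ fun a _ => isHom_matrix n d hW a a

/-- The fibre `Tr(W) = 0` with the trivial action. -/
def fibreZero {m : ℕ} (W : FreeAlgebra ℂ (Fin m)) (n : ℕ) : MuVar :=
  GrAlg.triv (MvPolynomial (Fin m × Fin n × Fin n) ℂ ⧸ Ideal.span {traceFun W n}) inferInstance

/-- The fibre `Tr(W) = 1` of a potential that is homogeneous of degree `d`, with the action of
`μ̂` through the multiplication by scalars in `μ_d`. -/
def fibreOne {m d : ℕ} {W : FreeAlgebra ℂ (Fin m)} (hW : W ∈ ncHomogeneous m d) (n : ℕ) : MuVar :=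
  (matrixSpace m n d).quot (traceFun W n - 1) (isHom_trace hW n)

/-- The motivic Donaldson-Thomas series `∑ 𝕃^(-n²) ([Tr(W) = 0] - [Tr(W) = 1]) / [GL_n] t^n` of a
homogeneous superpotential in three variables. -/
def dtSeries {d : ℕ} {W : FreeAlgebra ℂ (Fin 3)} (hW : W ∈ ncHomogeneous 3 d) : PowerSeries Mot :=
  PowerSeries.mk fun n => Ring.inverse lef ^ n ^ 2 *
    (mot (fibreZero W n) - mot (fibreOne hW n)) * Ring.inverse (mot (MuVar.gl n))

open FreeAlgebra in
/-- `W = XYZ - XZY - X³/3`. -/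
def weylPotential : FreeAlgebra ℂ (Fin 3) :=
  ι ℂ 0 * ι ℂ 1 * ι ℂ 2 - ι ℂ 0 * ι ℂ 2 * ι ℂ 1 - (1 / 3 : ℂ) • ι ℂ 0 ^ 3

theorem weylPotential_mem : weylPotential ∈ ncHomogeneous 3 3 := by
  have h : ∀ i : Fin 3, FreeAlgebra.ι ℂ i ∈ Submodule.span ℂ (Set.range (FreeAlgebra.ι ℂ)) :=
    fun i => Submodule.subset_span ⟨i, rfl⟩
  have h3 : ∀ i j k : Fin 3, FreeAlgebra.ι ℂ i * FreeAlgebra.ι ℂ j * FreeAlgebra.ι ℂ k ∈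
      ncHomogeneous 3 3 := fun i j k => by
    rw [ncHomogeneous, pow_succ, pow_two]
    exact Submodule.mul_mem_mul (Submodule.mul_mem_mul (h i) (h j)) (h k)
  refine sub_mem (sub_mem (h3 0 1 2) (h3 0 2 1)) (Submodule.smul_mem _ _ ?_)
  rw [pow_succ, pow_two]
  exact h3 0 0 0

/-- The virtual motive `1 - [μ_3]`. -/
def mTilde : Mot := 1 - mot (MuVar.mu 3 three_ne_zero)

end

end

end Motivic

namespace Motivic

noncomputable section

open AddMonoidAlgebra (single mapAlgHom)
open TensorProduct GrAlg

/-! ### Scissor decompositions times an affine line, and quotients with equal kernels -/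

namespace GrAlg

variable {Γ : Type} [AddCommGroup Γ] {X Y Z U : GrAlg Γ}

/-! Write the first matrix as `X` with diagonal entries `s`, `t` and off-diagonal entries `b`, `c`.
Put p = (s - t, b, c), and let y and z be the vectors formed in the same way from `Y` and `Z`. The
trace of XYZ - XZY is Tr(X[Y,Z]), which sees the matrices only modulo scalars and equals det(p, y,
z). Hence Tr(W) = det(p, y, z) - (s³ + t³)/3 - (s + t)bc, and two of the twelve coordinates, one
from `Y` and one from `Z`, do not occur at all (`trace_weyl`, `exists_equiv`).

The only tool needed to compute the class is integration along a line on which the function is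
affine (`cl_lin`). For f + g z the part g ≠ 0 is isomorphic to a variety whose function is the
coordinate of a line, and such classes are zero; on g = 0 the line is a free factor. Integrating out
z therefore leaves L³ times the locus p × y = 0. Over p ≠ 0 the vector y runs through the line
spanned by p, over p = 0 through the whole space, and `cl_trip_of_isClosed` adds up the two
contributions. The locus p = 0 consists of the scalar matrices `X`, with the function -(2/3)s³. The
class of the space of all `X` is found by the same method, as bc occurs with the coefficient -(s +
t), and the line s + t = 0 carries the function zero (`cl_tetra`). With C the class of the affine
line with x³, the outcome is `cl_weyl`, a polynomial in L and C.

It remains to pass to `Mot`. Under [X, f] ↦ [f = 0] - [f = 1] the class C becomes the virtual motive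
`mTilde`, as x³ = 0 is a fat point and x³ = 1 is μ₃ (`toMot_cubeClass`). The class of Tr(W) becomes
the difference of its fibres, except that the fibre over 0 arrives with the scalar action instead of
the trivial one. This fibre is a cone. After multiplication with a torus the action on it can be
untwisted, and the factor L - 1 introduced in this way is invertible in `Mot` (`toMot_zero_wt`,
`toMot_weyl`). The class of GL₂ follows from computing the class of z det on the product of the
matrices with a line in two ways (`mot_gl_two`). Division gives `coeff_dtSeries_weyl`.

For the exponential, the coefficient of t² is σ²(α) + α with (L - 1)α = L M, where M is `mTilde`. On
the symmetric square of the line the functions s = x + y and D = (x - y)² are coordinates, and x³ +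
y³ = s³/4 + (3/4)sD is affine in D, so that integration over D gives σ²(M) = L (`cl_sym2_cubic`,
`sigma2_mTilde`). Applying σ² to Lα = α + L M determines (L² - 1)σ²(α) as L³ + α L M (`sigma2_div`),
and the two sides agree after multiplication by (L² - 1)(L - 1). -/

theorem isHom_C {r : Γ} {a : X.A} (q : Γ) (h : X.IsHom r a) :
    (X.poly q).IsHom r (Polynomial.C a : Polynomial X.A) :=
  isGr_polyC X q _ _ h

theorem IsGr.polyMap {φ : X.A →ₐ[ℂ] Y.A} (h : IsGr φ) (q : Γ) :
    IsGr (X := X.poly q) (Y := Y.poly q) (Polynomial.mapAlgHom φ) := by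
  apply isGr_poly
  · intro r a ha
    simpa using isHom_C q (h _ _ ha)
  · simpa using isHom_polyX Y q

theorem polyMap_eq_zero {φ : X.A →ₐ[ℂ] Y.A} {p : Polynomial X.A} :
    Polynomial.mapAlgHom φ p = 0 ↔ ∀ n, φ (p.coeff n) = 0 := by
  rw [Polynomial.ext_iff]
  simp

/-- Kernels and localizations of polynomial rings are computed coefficient by coefficient. Through
this lemma a stratification of the base is carried up a tower of lines. -/
theorem IsScissors.poly {g : X.A} {φ : X.A →ₐ[ℂ] Z.A} {ψ : X.A →ₐ[ℂ] U.A}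
    (h : IsScissors X Z U g φ ψ) (q : Γ) :
    IsScissors (X.poly q) (Z.poly q) (U.poly q) (Polynomial.C g) (Polynomial.mapAlgHom φ)
      (Polynomial.mapAlgHom ψ) := by
  obtain ⟨r, hr⟩ := h.hom
  refine IsScissors.mk' (isHom_C q hr) (h.grφ.polyMap q) (h.grψ.polyMap q)
    (Polynomial.map_surjective _ h.surj) (by simp [h.map_g]) ?_ ?_ ?_ ?_
  · intro p hp
    rw [polyMap_eq_zero] at hp
    change Polynomial.C g ∣ p
    rw [Polynomial.C_dvd_iff_dvd_coeff]
    exact fun n => h.ker' _ (hp n)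
  · simpa using h.unit.map (Polynomial.C)
  · intro u
    induction u using Polynomial.induction_on' with
    | add p r hp hr =>
      obtain ⟨n, a, ha⟩ := hp
      obtain ⟨m, b, hb⟩ := hr
      refine ⟨n + m, a * Polynomial.C g ^ m + b * Polynomial.C g ^ n, ?_⟩
      rw [map_add, map_mul, map_mul, ← ha, ← hb, map_pow, map_pow]
      ring
    | monomial m a =>
      obtain ⟨n, b, hb⟩ := h.lsurj a
      refine ⟨n, Polynomial.monomial m b, ?_⟩
      simp only [Polynomial.coe_mapAlgHom, Polynomial.map_C, Polynomial.map_monomial,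
        RingHom.coe_coe]
      rw [← hb, ← map_pow, Polynomial.monomial_mul_C]
  · intro p hp
    rw [polyMap_eq_zero] at hp
    choose n hn using fun k => h.lker _ (hp k)
    -- The sum of the exponents over the finite support kills all coefficients at once.
    refine ⟨∑ k ∈ p.support, n k, Polynomial.ext fun k => ?_⟩
    rw [← map_pow, Polynomial.coeff_C_mul, Polynomial.coeff_zero]
    by_cases hk : k ∈ p.support
    · rw [← Finset.sum_erase_add _ _ hk, pow_add, mul_assoc, hn, mul_zero]
    · rw [Polynomial.notMem_support_iff.1 hk, mul_zero]

/-- Quotients with the same kernel are isomorphic. -/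
theorem iso_of_ker {π : X.A →ₐ[ℂ] Y.A} {ρ : X.A →ₐ[ℂ] Z.A} (hπ : IsGr π) (hρ : IsGr ρ)
    (sπ : Function.Surjective π) (sρ : Function.Surjective ρ) (h : ∀ a, π a = 0 ↔ ρ a = 0) :
    ∃ e : Y.A ≃ₐ[ℂ] Z.A, IsGr (e : Y.A →ₐ[ℂ] Z.A) ∧ ∀ a, e (π a) = ρ a := by
  have hk : RingHom.ker π = RingHom.ker ρ := by ext a; exact h a
  let e : Y.A ≃ₐ[ℂ] Z.A := (Ideal.quotientKerAlgEquivOfSurjective sπ).symm.trans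
    ((Ideal.quotientEquivAlgOfEq ℂ hk).trans (Ideal.quotientKerAlgEquivOfSurjective sρ))
  have he : ∀ a, e (π a) = ρ a := by
    intro a
    have : (Ideal.quotientKerAlgEquivOfSurjective sπ).symm (π a) =
        Ideal.Quotient.mk (RingHom.ker π) a := by
      rw [AlgEquiv.symm_apply_eq]; rfl
    simp only [e, AlgEquiv.trans_apply, this]
    rfl
  refine ⟨e, IsGr.of_comp_surj hπ sπ ?_, he⟩
  intro q a ha
  change Z.IsHom q (e (π a))
  rw [he]
  exact hρ q a ha

end GrAlg

/-! ### Integration along lines on which the function is affine -/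

namespace PotVar

/-- The function `f + g z` on the product with the affine line with coordinate `z`. -/
abbrev lin (P : PotVar) (g : P.A) (q : ℚ) (hg : P.IsHom (1 - q) g) : PotVar where
  toGrAlg := P.toGrAlg.poly q
  f := Polynomial.C P.f + Polynomial.C g * Polynomial.X
  hf := (isHom_C q P.hf).add (by
    have := (isHom_C q hg).mul (isHom_polyX P.toGrAlg q)
    rwa [sub_add_cancel] at this)

theorem cl_lin_zero (P : PotVar) (g : P.A) (q : ℚ) (hg : P.IsHom (1 - q) g) (h : g = 0) :
    cl (P.lin g q hg) = L * cl P := by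
  rw [← cl_poly P q]
  exact cl_eq ⟨AlgEquiv.refl, fun _ _ h => h, by simp [h]⟩

/-- The function f + u z can itself serve as the coordinate on the line. In this coordinate the pair
is of the form `pull`, whose class is zero by definition of the ring. -/
theorem cl_lin_unit (P : PotVar) (g : P.A) (q : ℚ) (hg : P.IsHom (1 - q) g) (h : IsUnit g) :
    cl (P.lin g q hg) = 0 := by
  obtain ⟨u, rfl⟩ := h
  rw [← cl_pull P.toGrAlg]
  let a : Polynomial P.A →ₐ[ℂ] Polynomial P.A := Polynomial.eval₂AlgHom Polynomial.CAlgHom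
    (Polynomial.C P.f + Polynomial.C (u : P.A) * Polynomial.X) (fun _ => Commute.all _ _)
  let b : Polynomial P.A →ₐ[ℂ] Polynomial P.A := Polynomial.eval₂AlgHom Polynomial.CAlgHom
    (Polynomial.C (↑u⁻¹ : P.A) * (Polynomial.X - Polynomial.C P.f)) (fun _ => Commute.all _ _)
  have aC : ∀ x, a (Polynomial.C x) = Polynomial.C x := fun x => by simp [a]
  have bC : ∀ x, b (Polynomial.C x) = Polynomial.C x := fun x => by simp [b]
  have aX : a Polynomial.X = Polynomial.C P.f + Polynomial.C (u : P.A) * Polynomial.X := by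
    simp [a]
  have bX : b Polynomial.X = Polynomial.C (↑u⁻¹ : P.A) * (Polynomial.X - Polynomial.C P.f) := by
    simp [b]
  have hu : (Polynomial.C (u : P.A)) * Polynomial.C (↑u⁻¹ : P.A) = 1 := by
    rw [← map_mul, Units.mul_inv, map_one]
  have hab : a.comp b = AlgHom.id ℂ _ := by
    refine Polynomial.algHom_ext' (AlgHom.ext fun x => ?_) ?_
    · change a (b (Polynomial.C x)) = Polynomial.C x
      rw [bC, aC]
    · change a (b Polynomial.X) = Polynomial.X
      rw [bX, map_mul, map_sub, aX, aC, aC, add_sub_cancel_left, ← mul_assoc, mul_comm _ (_ : Polynomial P.A), mul_comm (Polynomial.C _), hu, mul_one]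
  have hba : b.comp a = AlgHom.id ℂ _ := by
    refine Polynomial.algHom_ext' (AlgHom.ext fun x => ?_) ?_
    · change b (a (Polynomial.C x)) = Polynomial.C x
      rw [aC, bC]
    · change b (a Polynomial.X) = Polynomial.X
      rw [aX, map_add, map_mul, bX, bC, bC, ← mul_assoc, hu, one_mul, add_sub_cancel]
  refine (cl_eq (P := pull P.toGrAlg) (Q := P.lin _ q hg) ⟨AlgEquiv.ofAlgHom a b hab hba, ?_, aX⟩).symm
  refine isGr_poly (X := P.toGrAlg) (Z := P.toGrAlg.poly q) (φ := a) ?_ ?_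
  · intro r x hx
    change (P.toGrAlg.poly q).IsHom r (a (Polynomial.C x))
    rw [aC]
    exact isHom_C q hx
  · rw [aX]
    exact (P.lin _ q hg).hf

theorem lin_map {P Z : PotVar} {φ : P.A →ₐ[ℂ] Z.A} (hf : φ P.f = Z.f) {g : P.A} {g' : Z.A}
    {q : ℚ} {hg : P.IsHom (1 - q) g} {hg' : Z.IsHom (1 - q) g'} (e : φ g = g') :
    Polynomial.mapAlgHom φ (P.lin g q hg).f = (Z.lin g' q hg').f := by
  simp [hf, e]

/-- Integration over a line along which the function is affine. -/
theorem cl_lin (P : PotVar) (g : P.A) (q : ℚ) (hg : P.IsHom (1 - q) g) :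
    cl (P.lin g q hg) = L * cl (P.quot g hg) := by
  have h := P.toGrAlg.loc_scissors g hg
  have h1 : (P.quot g hg).IsHom (1 - q) (P.toGrAlg.toQuot g hg g) := isGr_toQuot _ _ hg _ _ hg
  have h2 : (P.loc g hg).IsHom (1 - q) (P.toGrAlg.toLoc g hg g) := isGr_toLoc _ _ hg _ _ hg
  -- Only the stratum g = 0 contributes, and there the term g z disappears.
  rw [cl_scissors (P := P.lin g q hg) (Z := (P.quot g hg).lin _ q h1)
    (U := (P.loc g hg).lin _ q h2) (h.poly q) (lin_map (Z := P.quot g hg) rfl rfl)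
    (lin_map (Z := P.loc g hg) rfl rfl),
    cl_lin_unit (P.loc g hg) _ _ _ h.unit, cl_lin_zero (P.quot g hg) _ _ _ h.map_g, add_zero]

theorem cl_quotient {P Z Z' : PotVar} {π : P.A →ₐ[ℂ] Z.A} {ρ : P.A →ₐ[ℂ] Z'.A}
    (hπ : IsGr (X := P.toGrAlg) (Y := Z.toGrAlg) π)
    (hρ : IsGr (X := P.toGrAlg) (Y := Z'.toGrAlg) ρ)
    (sπ : Function.Surjective π) (sρ : Function.Surjective ρ) (fπ : π P.f = Z.f)
    (fρ : ρ P.f = Z'.f) (h : ∀ a, π a = 0 ↔ ρ a = 0) : cl Z = cl Z' := by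
  obtain ⟨e, he, h1⟩ := iso_of_ker hπ hρ sπ sρ h
  exact cl_eq ⟨e, he, by rw [← fπ, h1, fρ]⟩

/-- `π` exhibits `Z` as the closed subvariety of `P` with the ideal `I`. -/
structure IsClosed (P Z : PotVar) (I : Ideal P.A) (π : P.A →ₐ[ℂ] Z.A) : Prop where
  gr : IsGr (X := P.toGrAlg) (Y := Z.toGrAlg) π
  surj : Function.Surjective π
  f : π P.f = Z.f
  ker : ∀ a, π a = 0 ↔ a ∈ I

namespace IsClosed

variable {P Z Z' Z'' : PotVar} {I : Ideal P.A} {π : P.A →ₐ[ℂ] Z.A}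

/-- A locus reached by imposing equations one after another can thus be exchanged for any explicit
model with the same ideal. -/
theorem cl_eq {ρ : P.A →ₐ[ℂ] Z'.A} (h : IsClosed P Z I π) (h' : IsClosed P Z' I ρ) :
    cl Z = cl Z' :=
  cl_quotient h.gr h'.gr h.surj h'.surj h.f h'.f fun a => (h.ker a).trans (h'.ker a).symm

theorem quot (P : PotVar) (g : P.A) {q : ℚ} (hg : P.IsHom q g) :
    IsClosed P (P.quot g hg) (Ideal.span {g}) (P.toGrAlg.toQuot g hg) :=
  ⟨isGr_toQuot _ _ hg, toQuot_surjective _ _ hg, rfl, fun a => by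
    rw [toQuot_eq_zero, Ideal.mem_span_singleton]; rfl⟩

/-- The preimage under π of the ideal generated by π(T) is ker π plus the ideal generated by T. The
second set of generators is required to be an image π(T) so that the composite ideal is again the
span of an explicit set in the coordinate ring of `P`. -/
theorem trans {S T : Set P.A} {T' : Set Z.A} {ρ : Z.A →ₐ[ℂ] Z'.A}
    (h : IsClosed P Z (Ideal.span S) π) (h' : IsClosed Z Z' (Ideal.span T') ρ) (hT : T' = π '' T) :
    IsClosed P Z' (Ideal.span (S ∪ T)) (ρ.comp π) where
  gr := h'.gr.comp h.gr
  surj := h'.surj.comp h.surj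
  f := by rw [AlgHom.comp_apply, h.f, h'.f]
  ker a := by
    subst hT
    have e : (Ideal.span S) = RingHom.ker π := by ext a; exact (h.ker a).symm
    rw [AlgHom.comp_apply, h'.ker, Ideal.span_union, ← Ideal.map_span π,
      Ideal.mem_map_iff_of_surjective π h.surj]
    constructor
    · rintro ⟨b, hb, hab⟩
      have : a = (a - b) + b := by ring
      rw [this]
      refine Submodule.add_mem_sup ?_ hb
      rw [← h.ker, map_sub, hab, sub_self]
    · intro ha
      obtain ⟨y, hy, b, hb, rfl⟩ := Submodule.mem_sup.1 ha
      exact ⟨b, hb, by rw [map_add, (h.ker y).2 hy, zero_add]⟩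

/-- A closed embedding is determined by a section that inverts it modulo the ideal. -/
theorem of_section (gr : IsGr (X := P.toGrAlg) (Y := Z.toGrAlg) π) (f : π P.f = Z.f)
    (σ : Z.A →ₐ[ℂ] P.A) (h : ∀ z, π (σ z) = z) (hI : I ≤ RingHom.ker π)
    (hσ : ((Ideal.Quotient.mkₐ ℂ I).comp σ).comp π = Ideal.Quotient.mkₐ ℂ I) :
    IsClosed P Z I π where
  gr := gr
  surj z := ⟨σ z, h z⟩
  f := f
  ker a := by
    refine ⟨fun ha => ?_, fun ha => hI ha⟩
    -- The hypothesis says that σ(π(a)) and a agree modulo I. If π(a) = 0, this puts a into I.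
    have := DFunLike.congr_fun hσ a
    simp only [AlgHom.comp_apply, ha, map_zero] at this
    exact Ideal.Quotient.eq_zero_iff_mem.1 this.symm

theorem lin (h : IsClosed P Z I π) {g : P.A} {q : ℚ} (hg : P.IsHom (1 - q) g)
    {g' : Z.A} (hg' : Z.IsHom (1 - q) g') (e : π g = g') :
    IsClosed (P.lin g q hg) (Z.lin g' q hg') (I.map Polynomial.C) (Polynomial.mapAlgHom π) where
  gr := h.gr.polyMap q
  surj := Polynomial.map_surjective _ h.surj
  f := lin_map h.f e
  ker p := by
    rw [polyMap_eq_zero, Ideal.mem_map_C_iff]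
    exact forall_congr' fun n => h.ker _

end IsClosed

theorem cl_lin_of_isClosed {P Z : PotVar} {g : P.A} {π : P.A →ₐ[ℂ] Z.A}
    (h : IsClosed P Z (Ideal.span {g}) π) (q : ℚ) (hg : P.IsHom (1 - q) g) :
    cl (P.lin g q hg) = L * cl Z := by
  rw [cl_lin, (IsClosed.quot P g hg).cl_eq h]

/-- The outer line is integrated first. Its coefficient comes from the base `P`, hence it cuts out
the restriction of the inner `lin` to a closed subvariety of `P`. -/
theorem cl_lin_C {P Z : PotVar} {g g₁ : P.A} {π : P.A →ₐ[ℂ] Z.A}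
    (h : IsClosed P Z (Ideal.span {g}) π) {q q₁ : ℚ} (hg₁ : P.IsHom (1 - q₁) g₁)
    (hg : (P.lin g₁ q₁ hg₁).IsHom (1 - q) (Polynomial.C g : Polynomial P.A)) :
    cl ((P.lin g₁ q₁ hg₁).lin (Polynomial.C g) q hg) =
      L * cl (Z.lin (π g₁) q₁ (h.gr _ _ hg₁)) := by
  have := h.lin hg₁ (h.gr _ _ hg₁) rfl
  rw [Ideal.map_span, Set.image_singleton] at this
  exact cl_lin_of_isClosed this q hg

/-- The same reduction with two affine lines in between: both of their coefficients are restricted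
to the locus where the outermost coefficient vanishes. -/
theorem cl_lin_CC {P Z : PotVar} {g g₁ g₂ : P.A} {π : P.A →ₐ[ℂ] Z.A}
    (h : IsClosed P Z (Ideal.span {g}) π) {q q₁ q₂ : ℚ} (hg₁ : P.IsHom (1 - q₁) g₁)
    (hg₂ : (P.lin g₁ q₁ hg₁).IsHom (1 - q₂) (Polynomial.C g₂ : Polynomial P.A))
    (hg₂' : (Z.lin (π g₁) q₁ (h.gr _ _ hg₁)).IsHom (1 - q₂)
      (Polynomial.C (π g₂) : Polynomial Z.A))
    (hg : ((P.lin g₁ q₁ hg₁).lin (Polynomial.C g₂) q₂ hg₂).IsHom (1 - q)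
      (Polynomial.C (Polynomial.C g) : Polynomial (Polynomial P.A))) :
    cl (((P.lin g₁ q₁ hg₁).lin (Polynomial.C g₂) q₂ hg₂).lin
        (Polynomial.C (Polynomial.C g)) q hg) =
      L * cl ((Z.lin (π g₁) q₁ (h.gr _ _ hg₁)).lin (Polynomial.C (π g₂)) q₂ hg₂') := by
  have h1 := h.lin hg₁ (h.gr _ _ hg₁) rfl
  rw [Ideal.map_span, Set.image_singleton] at h1
  have h2 := h1.lin hg₂ hg₂' (by simp)
  rw [Ideal.map_span, Set.image_singleton] at h2
  exact cl_lin_of_isClosed h2 q hg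

/-- Integration over three lines along which the function is affine. -/
theorem cl_lin_lin_lin {P Z : PotVar} {g₁ g₂ g₃ : P.A} {π : P.A →ₐ[ℂ] Z.A}
    (h : IsClosed P Z (Ideal.span {g₁, g₂, g₃}) π) {q : ℚ} (h₁ : P.IsHom (1 - q) g₁)
    (h₂ : P.IsHom (1 - q) g₂) (h₃ : P.IsHom (1 - q) g₃) :
    cl (((P.lin g₁ q h₁).lin (Polynomial.C g₂) q (isHom_C q h₂)).lin
        (Polynomial.C (Polynomial.C g₃)) q (isHom_C q (isHom_C q h₃))) = L ^ 3 * cl Z := by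
  have c3 := IsClosed.quot P g₃ h₃
  have h₁' := c3.gr _ _ h₁
  have h₂' := c3.gr _ _ h₂
  -- Integration goes from the outermost line inwards, so that the equations are imposed in the
  -- order g₃, g₂, g₁. The ideals for the two orders are compared at the end.
  rw [cl_lin_CC c3 h₁ _ (isHom_C q h₂') _]
  have c2 := IsClosed.quot (P.quot g₃ h₃) _ h₂'
  rw [cl_lin_C c2 h₁' _]
  have c1 := IsClosed.quot ((P.quot g₃ h₃).quot _ h₂') _ (c2.gr _ _ h₁')
  rw [cl_lin_of_isClosed c1]
  have c321 := (c3.trans c2 Set.image_singleton.symm).trans (T := {g₁}) c1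
    (by rw [Set.image_singleton]; rfl)
  have e : ({g₃} ∪ {g₂} ∪ {g₁} : Set P.A) = {g₁, g₂, g₃} := by
    ext x; simp only [Set.mem_union, Set.mem_insert_iff, Set.mem_singleton_iff]; tauto
  rw [e] at c321
  rw [c321.cl_eq h]
  ring

end PotVar

/-! ### The function f + det(p, y, z) and the locus p × y = 0 -/

namespace PotVar

/-- This is the degree that `lin` demands: in a function of degree 1, the coefficient of a
coordinate of degree 1/3 has degree 1 - 1/3. -/
theorem isHom_two_thirds {X : PotVar} {a b c d : X.A} (ha : X.IsHom (1 / 3) a)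
    (hb : X.IsHom (1 / 3) b) (hc : X.IsHom (1 / 3) c) (hd : X.IsHom (1 / 3) d) :
    X.IsHom (1 - 1 / 3) (a * b - c * d) := by
  have := (ha.mul hb).sub (hc.mul hd)
  norm_num at this ⊢
  exact this

/-- The product of `X` with affine three-space. -/
abbrev space (X : PotVar) : PotVar := ((X.poly (1 / 3)).poly (1 / 3)).poly (1 / 3)

/-- The coordinates on `X.space`. -/
abbrev y₁ (X : PotVar) : X.space.A := Polynomial.C (Polynomial.C Polynomial.X)
/-- The coordinates on `X.space`. -/
abbrev y₂ (X : PotVar) : X.space.A := Polynomial.C Polynomial.X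
/-- The coordinates on `X.space`. -/
abbrev y₃ (X : PotVar) : X.space.A := Polynomial.X

/-- Pull-back of functions to `X.space`. -/
abbrev toSpace (X : PotVar) : X.A →ₐ[ℂ] X.space.A :=
  Polynomial.CAlgHom.comp (Polynomial.CAlgHom.comp Polynomial.CAlgHom)

variable {X Z U : PotVar}

theorem isHom_y₁ : X.space.IsHom (1 / 3) X.y₁ := isHom_C _ (isHom_C _ (isHom_polyX _ _))
theorem isHom_y₂ : X.space.IsHom (1 / 3) X.y₂ := isHom_C _ (isHom_polyX _ _)
theorem isHom_y₃ : X.space.IsHom (1 / 3) X.y₃ := isHom_polyX _ _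
theorem isHom_toSpace {q : ℚ} {a : X.A} (h : X.IsHom q a) : X.space.IsHom q (X.toSpace a) :=
  isHom_C _ (isHom_C _ (isHom_C _ h))

/-- Three homogeneous functions of degree `1 / 3`. -/
structure Vec (X : PotVar) where
  /-- the components -/
  (a b c : X.A)
  ha : X.IsHom (1 / 3) a
  hb : X.IsHom (1 / 3) b
  hc : X.IsHom (1 / 3) c

/-- The image of a vector. -/
abbrev Vec.map (p : X.Vec) (φ : X.A →ₐ[ℂ] Z.A)
    (h : IsGr (X := X.toGrAlg) (Y := Z.toGrAlg) φ) : Z.Vec :=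
  ⟨φ p.a, φ p.b, φ p.c, h _ _ p.ha, h _ _ p.hb, h _ _ p.hc⟩

/-- The first component of `p × y`. -/
abbrev Vec.g₁ (p : X.Vec) : X.space.A := X.toSpace p.b * X.y₃ - X.toSpace p.c * X.y₂
/-- The second component of `p × y`. -/
abbrev Vec.g₂ (p : X.Vec) : X.space.A := X.toSpace p.c * X.y₁ - X.toSpace p.a * X.y₃
/-- The third component of `p × y`. -/
abbrev Vec.g₃ (p : X.Vec) : X.space.A := X.toSpace p.a * X.y₂ - X.toSpace p.b * X.y₁

theorem Vec.hg₁ (p : X.Vec) : X.space.IsHom (1 - 1 / 3) p.g₁ :=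
  isHom_two_thirds (isHom_toSpace p.hb) isHom_y₃ (isHom_toSpace p.hc) isHom_y₂
theorem Vec.hg₂ (p : X.Vec) : X.space.IsHom (1 - 1 / 3) p.g₂ :=
  isHom_two_thirds (isHom_toSpace p.hc) isHom_y₁ (isHom_toSpace p.ha) isHom_y₃
theorem Vec.hg₃ (p : X.Vec) : X.space.IsHom (1 - 1 / 3) p.g₃ :=
  isHom_two_thirds (isHom_toSpace p.ha) isHom_y₂ (isHom_toSpace p.hb) isHom_y₁

/-- The product of `X` with two affine three-spaces, with the function `f + det (p, y, z)`. -/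
abbrev trip (X : PotVar) (p : X.Vec) : PotVar :=
  ((X.space.lin p.g₁ (1 / 3) p.hg₁).lin (Polynomial.C p.g₂) (1 / 3) (isHom_C _ p.hg₂)).lin
    (Polynomial.C (Polynomial.C p.g₃)) (1 / 3) (isHom_C _ (isHom_C _ p.hg₃))

theorem cl_trip (p : X.Vec) {π : X.space.A →ₐ[ℂ] Z.A}
    (h : IsClosed X.space Z (Ideal.span {p.g₁, p.g₂, p.g₃}) π) :
    cl (X.trip p) = L ^ 3 * cl Z := cl_lin_lin_lin h p.hg₁ p.hg₂ p.hg₃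

theorem cl_space (X : PotVar) : cl X.space = L ^ 3 * cl X := by
  rw [cl_poly, cl_poly, cl_poly]; ring

/-- For p = 0 the condition p × y = 0 is empty, and y and z are six free coordinates. -/
theorem cl_trip_zero (p : X.Vec) (ha : p.a = 0) (hb : p.b = 0) (hc : p.c = 0) :
    cl (X.trip p) = L ^ 6 * cl X := by
  have h : IsClosed X.space X.space (Ideal.span {p.g₁, p.g₂, p.g₃}) (AlgHom.id ℂ _) :=
    ⟨IsGr.id, Function.surjective_id, rfl, fun a => by
      have h₁ : p.g₁ = 0 := by rw [Vec.g₁, hb, hc]; simp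
      have h₂ : p.g₂ = 0 := by rw [Vec.g₂, ha, hc]; simp
      have h₃ : p.g₃ = 0 := by rw [Vec.g₃, ha, hb]; simp
      rw [h₁, h₂, h₃]
      simp only [Set.insert_eq_of_mem, Set.mem_singleton_iff, Ideal.mem_span_singleton]
      exact zero_dvd_iff.symm⟩
  rw [cl_trip p h, cl_space]; ring

/-- The line spanned by `p`. -/
def Vec.line (p : X.Vec) : X.space.A →ₐ[ℂ] (X.poly 0).A :=
  Polynomial.eval₂AlgHom (Polynomial.eval₂AlgHom (Polynomial.eval₂AlgHom Polynomial.CAlgHom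
    (Polynomial.C p.a * Polynomial.X) fun _ => Commute.all _ _)
    (Polynomial.C p.b * Polynomial.X) fun _ => Commute.all _ _)
    (Polynomial.C p.c * Polynomial.X) fun _ => Commute.all _ _

theorem Vec.line_toSpace (p : X.Vec) (x : X.A) : p.line (X.toSpace x) = Polynomial.C x := by
  simp [Vec.line]
theorem Vec.line_y₁ (p : X.Vec) : p.line X.y₁ = Polynomial.C p.a * Polynomial.X := by
  simp [Vec.line]
theorem Vec.line_y₂ (p : X.Vec) : p.line X.y₂ = Polynomial.C p.b * Polynomial.X := by
  simp [Vec.line]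
theorem Vec.line_y₃ (p : X.Vec) : p.line X.y₃ = Polynomial.C p.c * Polynomial.X := by
  simp [Vec.line]

theorem space_hom_ext {B : Type} [CommRing B] [Algebra ℂ B] {φ ψ : X.space.A →ₐ[ℂ] B}
    (h : ∀ x, φ (X.toSpace x) = ψ (X.toSpace x)) (h₁ : φ X.y₁ = ψ X.y₁) (h₂ : φ X.y₂ = ψ X.y₂)
    (h₃ : φ X.y₃ = ψ X.y₃) : φ = ψ :=
  Polynomial.algHom_ext' (Polynomial.algHom_ext' (Polynomial.algHom_ext' (AlgHom.ext h) h₁) h₂) h₃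

theorem isGr_space {φ : X.space.A →ₐ[ℂ] Z.A}
    (h : IsGr (X := X.toGrAlg) (Y := Z.toGrAlg) (φ.comp X.toSpace))
    (h₁ : Z.IsHom (1 / 3) (φ X.y₁)) (h₂ : Z.IsHom (1 / 3) (φ X.y₂))
    (h₃ : Z.IsHom (1 / 3) (φ X.y₃)) : IsGr (X := X.space.toGrAlg) (Y := Z.toGrAlg) φ :=
  isGr_poly (X := ((X.poly (1 / 3)).poly (1 / 3)).toGrAlg)
    (isGr_poly (X := (X.poly (1 / 3)).toGrAlg) (isGr_poly (X := X.toGrAlg) h h₁) h₂) h₃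

/-- The parameter λ in y = λp has degree 0, since the components of p and of y all have degree 1/3.
-/
theorem Vec.isGr_line (p : X.Vec) :
    IsGr (X := X.space.toGrAlg) (Y := (X.poly 0).toGrAlg) p.line := by
  have h : ∀ {a : X.A}, X.IsHom (1 / 3) a →
      (X.poly 0).IsHom (1 / 3) (Polynomial.C a * Polynomial.X) := fun ha => by
    simpa using (isHom_C 0 ha).mul (isHom_polyX X.toGrAlg 0)
  refine isGr_space (Z := X.poly 0) (fun q x hx => ?_) ?_ ?_ ?_
  · change (X.poly 0).IsHom q (p.line (X.toSpace x))
    rw [p.line_toSpace]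
    exact isHom_C 0 hx
  · rw [p.line_y₁]; exact h p.ha
  · rw [p.line_y₂]; exact h p.hb
  · rw [p.line_y₃]; exact h p.hc

/-- Here `u` is intended to be an invertible component of p and `v` the corresponding component of
y. The relations u yᵢ = pᵢ v say that y = (v/u)p. Accordingly the inverse modulo the ideal sends the
parameter of the line to v/u. -/
theorem Vec.isClosed_line (p : X.Vec) (u : X.A) (v : X.space.A)
    (hv : p.line v = Polynomial.X * Polynomial.C u) (hu : IsUnit u)
    (h₁ : X.toSpace u * X.y₁ - X.toSpace p.a * v ∈ Ideal.span {p.g₁, p.g₂, p.g₃})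
    (h₂ : X.toSpace u * X.y₂ - X.toSpace p.b * v ∈ Ideal.span {p.g₁, p.g₂, p.g₃})
    (h₃ : X.toSpace u * X.y₃ - X.toSpace p.c * v ∈ Ideal.span {p.g₁, p.g₂, p.g₃}) :
    IsClosed X.space (X.poly 0) (Ideal.span {p.g₁, p.g₂, p.g₃}) p.line := by
  obtain ⟨u, rfl⟩ := hu
  have hu : X.toSpace (↑u⁻¹ : X.A) * X.toSpace (u : X.A) = 1 := by
    rw [← map_mul, Units.inv_mul, map_one]
  let σ : (X.poly 0).A →ₐ[ℂ] X.space.A := Polynomial.eval₂AlgHom X.toSpace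
    (X.toSpace ↑u⁻¹ * v) fun _ => Commute.all _ _
  have σC : ∀ x, σ (Polynomial.C x) = X.toSpace x := fun x => by simp [σ]
  have σX : σ Polynomial.X = X.toSpace ↑u⁻¹ * v := by simp [σ]
  refine IsClosed.of_section p.isGr_line (p.line_toSpace _) σ ?_ ?_ ?_
  · refine DFunLike.congr_fun (f := p.line.comp σ) (g := AlgHom.id ℂ _)
      (Polynomial.algHom_ext' (AlgHom.ext fun x => ?_) ?_)
    · change p.line (σ (Polynomial.C x)) = Polynomial.C x
      rw [σC, p.line_toSpace]
    · change p.line (σ Polynomial.X) = Polynomial.X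
      rw [σX, map_mul, p.line_toSpace, hv, mul_left_comm, ← map_mul, Units.inv_mul, map_one,
        mul_one]
  · rw [Ideal.span_le]
    rintro x (rfl | rfl | rfl)
    -- The three components of p × λp cancel identically.
    all_goals
      change p.line _ = 0
      rw [map_sub, map_mul, map_mul, p.line_toSpace, p.line_toSpace]
      simp only [p.line_y₁, p.line_y₂, p.line_y₃]
      ring
  · have aux : ∀ (y : X.space.A) (a : X.A), p.line y = Polynomial.C a * Polynomial.X →
        X.toSpace (u : X.A) * y - X.toSpace a * v ∈ Ideal.span {p.g₁, p.g₂, p.g₃} →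
        Ideal.Quotient.mkₐ ℂ (Ideal.span {p.g₁, p.g₂, p.g₃}) (σ (p.line y)) =
          Ideal.Quotient.mkₐ ℂ (Ideal.span {p.g₁, p.g₂, p.g₃}) y := by
      intro y a hy h
      rw [hy, map_mul, σC, σX]
      refine (Ideal.Quotient.eq.2 ?_).symm
      have e : y - X.toSpace a * (X.toSpace ↑u⁻¹ * v) =
          X.toSpace ↑u⁻¹ * (X.toSpace (u : X.A) * y - X.toSpace a * v) := by
        linear_combination (-y) * hu
      rw [e]
      exact Ideal.mul_mem_left _ _ h
    refine space_hom_ext (fun x => ?_) (aux _ _ p.line_y₁ h₁) (aux _ _ p.line_y₂ h₂)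
      (aux _ _ p.line_y₃ h₃)
    change Ideal.Quotient.mkₐ ℂ _ (σ (p.line (X.toSpace x))) = _
    rw [p.line_toSpace, σC]

/-- Dividing by the invertible component turns p × y = 0 into y = λp. The solutions form a trivial
line bundle, which gives one factor L in addition to the L³ from z. -/
theorem cl_trip_unit (p : X.Vec) (h : IsUnit p.a ∨ IsUnit p.b ∨ IsUnit p.c) :
    cl (X.trip p) = L ^ 4 * cl X := by
  have m₁ : p.g₁ ∈ Ideal.span {p.g₁, p.g₂, p.g₃} := Ideal.subset_span (by simp)
  have m₂ : p.g₂ ∈ Ideal.span {p.g₁, p.g₂, p.g₃} := Ideal.subset_span (by simp)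
  have m₃ : p.g₃ ∈ Ideal.span {p.g₁, p.g₂, p.g₃} := Ideal.subset_span (by simp)
  have m₀ : ∀ x : X.space.A, x - x ∈ Ideal.span {p.g₁, p.g₂, p.g₃} := fun x => by
    rw [sub_self]; exact zero_mem _
  have key : IsClosed X.space (X.poly 0) (Ideal.span {p.g₁, p.g₂, p.g₃}) p.line := by
    rcases h with h | h | h
    -- Of the three relations one is trivial and the other two are components of p × y up to sign.
    · refine p.isClosed_line p.a X.y₁ (by rw [p.line_y₁, mul_comm]) h (m₀ _) m₃ ?_
      rw [← neg_sub]; exact neg_mem m₂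
    · refine p.isClosed_line p.b X.y₂ (by rw [p.line_y₂, mul_comm]) h ?_ (m₀ _) m₁
      rw [← neg_sub]; exact neg_mem m₃
    · refine p.isClosed_line p.c X.y₃ (by rw [p.line_y₃, mul_comm]) h m₂ ?_ (m₀ _)
      rw [← neg_sub]; exact neg_mem m₁
  rw [cl_trip p key, cl_poly]; ring

theorem cl_trip_scissors {g : X.A} {φ : X.A →ₐ[ℂ] Z.A} {ψ : X.A →ₐ[ℂ] U.A}
    (h : IsScissors X.toGrAlg Z.toGrAlg U.toGrAlg g φ ψ) (hφ : φ X.f = Z.f) (hψ : ψ X.f = U.f)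
    (p : X.Vec) :
    cl (X.trip p) = cl (Z.trip (p.map φ h.grφ)) + cl (U.trip (p.map ψ h.grψ)) := by
  refine cl_scissors ((((((h.poly _).poly _).poly _).poly _).poly _).poly _) ?_ ?_
  · simp [hφ]
  · simp [hψ]

/-- One step of the stratification: where the chosen component of p does not vanish, `cl_trip_unit`
applies, and the class of this open part is a difference of classes. -/
theorem cl_trip_loc (p : X.Vec) {g : X.A} (hg : X.IsHom (1 / 3) g)
    (h : p.a = g ∨ p.b = g ∨ p.c = g) :
    cl (X.trip p) = cl ((X.quot g hg).trip (p.map (X.toGrAlg.toQuot g hg) (isGr_toQuot _ _ hg))) +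
      L ^ 4 * (cl X - cl (X.quot g hg)) := by
  have hs := X.toGrAlg.loc_scissors g hg
  rw [cl_trip_scissors (Z := X.quot g hg) (U := X.loc g hg) hs rfl rfl p, X.cl_loc g hg,
    add_sub_cancel_left, cl_trip_unit (X := X.loc g hg)]
  have hu : ∀ x, x = g → IsUnit (X.toGrAlg.toLoc g hg x) := fun x hx => by
    rw [hx]; exact hs.unit
  exact h.imp (hu _) (Or.imp (hu _) (hu _))

/-- The components of p are set to zero one at a time. The differences from `cl_trip_loc` telescope
to L⁴ times the class of the part p ≠ 0, and on the last stratum p = 0 the six coordinates y and z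
are free. -/
theorem cl_trip_of_isClosed (p : X.Vec) {π : X.A →ₐ[ℂ] Z.A}
    (h : IsClosed X Z (Ideal.span {p.a, p.b, p.c}) π) :
    cl (X.trip p) = L ^ 4 * cl X + (L ^ 6 - L ^ 4) * cl Z := by
  have c₁ := IsClosed.quot X p.a p.ha
  have hb := c₁.gr _ _ p.hb
  have c₂ := IsClosed.quot (X.quot p.a p.ha) _ hb
  have hc := c₂.gr _ _ (c₁.gr _ _ p.hc)
  have c₃ := IsClosed.quot ((X.quot p.a p.ha).quot _ hb) _ hc
  rw [cl_trip_loc p p.ha (Or.inl rfl), cl_trip_loc (p.map _ c₁.gr) hb (Or.inr (Or.inl rfl)),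
    cl_trip_loc ((p.map _ c₁.gr).map _ c₂.gr) hc (Or.inr (Or.inr rfl)), cl_trip_zero]
  · have c₃₂₁ := (c₁.trans c₂ Set.image_singleton.symm).trans (T := {p.c}) c₃
      (by rw [Set.image_singleton]; rfl)
    have e : ({p.a} ∪ {p.b} ∪ {p.c} : Set X.A) = {p.a, p.b, p.c} := by
      ext x; simp only [Set.mem_union, Set.mem_insert_iff, Set.mem_singleton_iff]; tauto
    rw [e] at c₃₂₁
    rw [c₃₂₁.cl_eq h]
    ring
  · change ((X.quot p.a p.ha).quot _ hb).toGrAlg.toQuot _ hc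
      ((X.quot p.a p.ha).toGrAlg.toQuot _ hb (X.toGrAlg.toQuot _ p.ha p.a)) = 0
    rw [(c₁.ker _).2 (Ideal.mem_span_singleton_self _), map_zero, map_zero]
  · change ((X.quot p.a p.ha).quot _ hb).toGrAlg.toQuot _ hc
      ((X.quot p.a p.ha).toGrAlg.toQuot _ hb (X.toGrAlg.toQuot _ p.ha p.b)) = 0
    rw [(c₂.ker _).2 (Ideal.mem_span_singleton_self _), map_zero]
  · exact (c₃.ker _).2 (Ideal.mem_span_singleton_self _)

/-- The function `f + h y z` on the product with an affine plane. -/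
theorem cl_lin_mul_X (Y : PotVar) (h : Y.A) (q r : ℚ) (hh : Y.IsHom (1 - r - q) h)
    (hg : (Y.poly q).IsHom (1 - r) (Polynomial.C h * Polynomial.X : Polynomial Y.A)) :
    cl ((Y.poly q).lin (Polynomial.C h * Polynomial.X) r hg) =
      L * cl Y + (L ^ 2 - L) * cl (Y.quot h hh) := by
  have hs := Y.toGrAlg.loc_scissors h hh
  have hQ := ((isGr_toQuot _ _ hh).polyMap q) _ _ hg
  have hU := ((isGr_toLoc _ _ hh).polyMap q) _ _ hg
  -- Over h = 0 both lines are free, which gives L². Over h ≠ 0 integration over z forces h y = 0,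
  -- that is y = 0, and only one factor L remains.
  rw [cl_scissors (Z := ((Y.quot h hh).poly q).lin _ r hQ) (U := ((Y.loc h hh).poly q).lin _ r hU)
    ((hs.poly q).poly r) (by simp) (by simp), cl_lin_zero, cl_poly, Y.cl_loc h hh]
  · have hu : IsUnit (Y.toGrAlg.toLoc h hh h) := hs.unit
    let π : ((Y.loc h hh).poly q).A →ₐ[ℂ] (Y.loc h hh).A := Polynomial.aeval 0 |>.restrictScalars ℂ
    have hπ : IsClosed ((Y.loc h hh).poly q) (Y.loc h hh)
        (Ideal.span {Polynomial.mapAlgHom (Y.toGrAlg.toLoc h hh)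
          (Polynomial.C h * Polynomial.X)}) π := by
      refine ⟨isGr_poly (X := (Y.loc h hh).toGrAlg) ?_ ?_, fun a => ⟨Polynomial.C a, ?_⟩, ?_, ?_⟩
      · intro r a ha
        simpa [π] using ha
      · simpa [π] using isHom_zero q
      · simp [π]
      · simp [π]
      · intro a
        -- The coefficient h has become a unit, so the ideal generated by h y is the one generated
        -- by y.
        have e : Polynomial.mapAlgHom (Y.toGrAlg.toLoc h hh) (Polynomial.C h * Polynomial.X) =
          Polynomial.C (Y.toGrAlg.toLoc h hh h) * Polynomial.X := by simp
        rw [e, Ideal.mem_span_singleton, (hu.map Polynomial.C).mul_left_dvd, Polynomial.X_dvd_iff,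
          Polynomial.coeff_zero_eq_aeval_zero]
        rfl
    rw [cl_lin_of_isClosed hπ]
    ring
  · have := hs.map_g
    simp [this]

end PotVar

/-! ### The cubic line and the space of the first matrix -/

namespace PotVar

theorem cl_pt : cl pt = 1 := rfl

theorem isGr_pt {Z : GrAlg ℚ} (φ : ℂ →ₐ[ℂ] Z.A) : IsGr (X := pt.toGrAlg) (Y := Z) φ :=
  MuVar.isGr_triv (h := inferInstance) fun a => by
    rw [← Algebra.algebraMap_self_apply a, AlgHom.commutes]
    exact isHom_algebraMap a

theorem isGr_pt_poly {Z : GrAlg ℚ} {q : ℚ} {φ : Polynomial ℂ →ₐ[ℂ] Z.A}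
    (h : Z.IsHom q (φ Polynomial.X)) : IsGr (X := pt.toGrAlg.poly q) (Y := Z) φ :=
  isGr_poly (isGr_pt _) h

theorem isHom_third {Z : GrAlg ℚ} {a : Z.A} (h : Z.IsHom (1 / 3) a) : Z.IsHom 1 (a ^ 3) := by
  have := h.pow 3
  norm_num at this
  exact this

theorem isHom_line : (pt.poly (1 / 3)).IsHom (1 / 3) (Polynomial.X : Polynomial ℂ) :=
  isHom_polyX pt.toGrAlg (1 / 3)

/-- The affine line with the function `k x³`. -/
abbrev cubic (k : ℂ) : PotVar where
  toGrAlg := pt.toGrAlg.poly (1 / 3)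
  f := k • (Polynomial.X : Polynomial ℂ) ^ 3
  hf := (isHom_third (Z := (pt.poly (1 / 3)).toGrAlg) isHom_line).smul k

/-- The class of the affine line with the function `x³`. -/
def cubeClass : K := cl (cubic 1)

/-- Scaling the coordinate by a cube root of k turns x³ into k x³. -/
theorem cl_cubic (k : ℂ) (hk : k ≠ 0) : cl (cubic k) = cubeClass := by
  obtain ⟨r, hr⟩ := IsAlgClosed.exists_pow_nat_eq k (n := 3) (by norm_num)
  have hr0 : r ≠ 0 := by rintro rfl; exact hk (by rw [← hr]; norm_num)
  refine (cl_eq (P := cubic 1) (Q := cubic k) ⟨AlgEquiv.ofAlgHom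
    (Polynomial.aeval (r • Polynomial.X)) (Polynomial.aeval (r⁻¹ • Polynomial.X)) ?_ ?_,
    isGr_pt_poly ?_, ?_⟩).symm
  · refine Polynomial.algHom_ext ?_
    simp [smul_smul, hr0]
  · refine Polynomial.algHom_ext ?_
    simp [smul_smul, hr0]
  · change (pt.poly (1 / 3)).IsHom (1 / 3) (Polynomial.aeval (r • Polynomial.X) Polynomial.X)
    rw [Polynomial.aeval_X]
    exact isHom_line.smul r
  · simp [smul_pow, hr]

/-- The affine plane. -/
abbrev plane : GrAlg ℚ := (pt.toGrAlg.poly (1 / 3)).poly (1 / 3)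

/-- The first coordinate on the plane. -/
abbrev ps : plane.A := Polynomial.C Polynomial.X
/-- The second coordinate on the plane. -/
abbrev pt' : plane.A := Polynomial.X

theorem isHom_ps : plane.IsHom (1 / 3) ps := isHom_C _ isHom_line
theorem isHom_pt' : plane.IsHom (1 / 3) pt' := isHom_polyX _ _

/-- The affine plane with the function `k (s³ + t³)`. -/
abbrev cubes (k : ℂ) : PotVar where
  toGrAlg := plane
  f := k • (ps ^ 3 + pt' ^ 3)
  hf := ((isHom_third isHom_ps).add (isHom_third isHom_pt')).smul k

/-- The variables separate, and the product of classes is by definition the class of the product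
with the sum of the functions. -/
theorem cl_cubes (k : ℂ) (hk : k ≠ 0) : cl (cubes k) = cubeClass ^ 2 := by
  rw [pow_two]
  -- Each factor is first replaced by the line with k x³, so that the product carries exactly the
  -- function on the plane.
  conv_rhs => rw [← cl_cubic k hk, cl_mul]
  have e1 : ∀ p : Polynomial ℂ, (polyEquivTensor ℂ (Polynomial ℂ)).symm (p ⊗ₜ 1) =
      Polynomial.C p := fun p => by
    rw [polyEquivTensor_symm_apply_tmul_eq_smul, Polynomial.map_one, Polynomial.smul_eq_C_mul,
      mul_one]
  have e2 : ∀ p : Polynomial ℂ, (polyEquivTensor ℂ (Polynomial ℂ)).symm (1 ⊗ₜ p) =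
      p.map (algebraMap ℂ (Polynomial ℂ)) := fun p => by
    rw [polyEquivTensor_symm_apply_tmul_eq_smul, one_smul]
  refine (cl_eq (P := (cubic k).tensor (cubic k)) (Q := cubes k)
    ⟨(polyEquivTensor ℂ (Polynomial ℂ)).symm, isGr_tensor ?_ ?_, ?_⟩).symm
  · refine isGr_pt_poly ?_
    change plane.IsHom (1 / 3) ((polyEquivTensor ℂ (Polynomial ℂ)).symm (Polynomial.X ⊗ₜ 1))
    rw [e1]
    exact isHom_ps
  · refine isGr_pt_poly ?_
    change plane.IsHom (1 / 3) ((polyEquivTensor ℂ (Polynomial ℂ)).symm (1 ⊗ₜ Polynomial.X))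
    rw [e2, Polynomial.map_X]
    exact isHom_pt'
  · rw [map_add, e1, e2]
    simp only [cubes, smul_add]
    congr 1
    · rw [← Polynomial.smul_C, map_pow]
    · simp [Algebra.smul_def, IsScalarTower.algebraMap_apply ℂ (Polynomial ℂ) (Polynomial (Polynomial ℂ))]

theorem plane_hom_ext {B : Type} [CommRing B] [Algebra ℂ B] {φ ψ : plane.A →ₐ[ℂ] B}
    (h₁ : φ ps = ψ ps) (h₂ : φ pt' = ψ pt') : φ = ψ :=
  Polynomial.algHom_ext' (Polynomial.algHom_ext h₁) h₂

theorem isHom_sum : plane.IsHom (1 / 3) (-(ps + pt')) := (isHom_ps.add isHom_pt').neg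

theorem isHom_sum' (k : ℂ) : (cubes k).IsHom (1 - 1 / 3 - 1 / 3) (-(ps + pt')) := by
  norm_num; simpa using isHom_sum

/-- On t = -s the function k(s³ + t³) vanishes identically, so the locus is a line with potential
zero. -/
theorem cl_cubes_quot (k : ℂ) : cl ((cubes k).quot (-(ps + pt')) (isHom_sum' k)) = L := by
  let π : plane.A →ₐ[ℂ] Polynomial ℂ := Polynomial.eval₂AlgHom (AlgHom.id ℂ _) (-Polynomial.X)
    fun _ => Commute.all _ _
  have π₁ : π ps = Polynomial.X := by simp [π]
  have π₂ : π pt' = -Polynomial.X := by simp [π]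
  have h : IsClosed (cubes k) (pt.poly (1 / 3)) (Ideal.span {-(ps + pt')}) π := by
    refine IsClosed.of_section (isGr_poly (isGr_pt_poly ?_) ?_) ?_ (Polynomial.aeval ps) ?_ ?_ ?_
    · change (pt.poly (1 / 3)).IsHom (1 / 3) (π ps)
      rw [π₁]; exact isHom_line
    · rw [π₂]; exact isHom_line.neg
    · change π (k • (ps ^ 3 + pt' ^ 3)) = Polynomial.C 0
      rw [map_smul, map_add, map_pow, map_pow, π₁, π₂, map_zero]
      ring_nf
      exact smul_zero k
    · refine DFunLike.congr_fun (f := π.comp (Polynomial.aeval ps)) (g := AlgHom.id ℂ _)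
        (Polynomial.algHom_ext ?_)
      simpa using π₁
    · rw [Ideal.span_singleton_le_iff_mem]
      change π _ = 0
      rw [map_neg, map_add, π₁, π₂, add_neg_cancel, neg_zero]
    · refine plane_hom_ext ?_ ?_
      · simp only [AlgHom.comp_apply, π₁, Polynomial.aeval_X]
      · simp only [AlgHom.comp_apply, π₂, map_neg, Polynomial.aeval_X]
        rw [← map_neg]
        refine Ideal.Quotient.eq.2 ?_
        rw [← neg_add']
        exact Ideal.mem_span_singleton_self _
  rw [(IsClosed.quot _ _ _).cl_eq h, cl_poly, cl_pt, mul_one]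

/-- Affine four-space with the function `-(s³ + t³) / 3 - (s + t) b c`. -/
abbrev tetra : PotVar :=
  ((cubes (-(1 / 3))).poly (1 / 3)).lin (Polynomial.C (-(ps + pt')) * Polynomial.X) (1 / 3) (by
    have := (isHom_C (1 / 3) isHom_sum).mul (isHom_polyX plane (1 / 3))
    norm_num at this ⊢
    exact this)

/-- The product bc appears with the coefficient -(s + t), which makes `cl_lin_mul_X` applicable over
the plane of s and t; the exceptional locus is s + t = 0. -/
theorem cl_tetra : cl tetra = L * cubeClass ^ 2 + (L ^ 2 - L) * L := by
  rw [cl_lin_mul_X _ _ _ _ (isHom_sum' _), cl_cubes_quot, cl_cubes _ (by norm_num)]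

/-- The pull-back of functions from the plane. -/
abbrev toTetra : plane.A →ₐ[ℂ] tetra.A := Polynomial.CAlgHom.comp Polynomial.CAlgHom

/-- The vector `(s - t, b, c)`. -/
abbrev tetraVec : tetra.Vec where
  a := toTetra (ps - pt')
  b := Polynomial.C Polynomial.X
  c := Polynomial.X
  ha := isHom_C _ (isHom_C _ (isHom_ps.sub isHom_pt'))
  hb := isHom_C _ (isHom_polyX _ _)
  hc := isHom_polyX _ _

theorem tetra_hom_ext {B : Type} [CommRing B] [Algebra ℂ B] {φ ψ : tetra.A →ₐ[ℂ] B}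
    (h₁ : φ (toTetra ps) = ψ (toTetra ps)) (h₂ : φ (toTetra pt') = ψ (toTetra pt'))
    (h₃ : φ tetraVec.b = ψ tetraVec.b) (h₄ : φ tetraVec.c = ψ tetraVec.c) : φ = ψ :=
  Polynomial.algHom_ext' (Polynomial.algHom_ext' (plane_hom_ext h₁ h₂) h₃) h₄

theorem tetra_f : tetra.f = (-(1 / 3) : ℂ) • (toTetra ps ^ 3 + toTetra pt' ^ 3) -
    (toTetra ps + toTetra pt') * tetraVec.b * tetraVec.c := by
  change toTetra ((-(1 / 3) : ℂ) • (ps ^ 3 + pt' ^ 3)) +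
    Polynomial.C (Polynomial.C (-(ps + pt')) * Polynomial.X) * tetraVec.c = _
  rw [map_smul, map_add, map_pow, map_pow, map_mul]
  have : Polynomial.C (Polynomial.C (-(ps + pt'))) = -(toTetra ps + toTetra pt') := by
    rw [map_neg, map_neg, map_add, map_add]; rfl
  rw [this]
  ring

/-- The conditions s = t and b = c = 0 single out the scalar matrices. They form a line on which
-(s³ + t³)/3 becomes -(2/3)s³. -/
theorem exists_isClosed_tetraVec : ∃ π, IsClosed tetra (cubic (-(2 / 3)))
    (Ideal.span {tetraVec.a, tetraVec.b, tetraVec.c}) π := by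
  let π₀ : plane.A →ₐ[ℂ] Polynomial ℂ := Polynomial.eval₂AlgHom (AlgHom.id ℂ _) Polynomial.X
    fun _ => Commute.all _ _
  let π : tetra.A →ₐ[ℂ] Polynomial ℂ := Polynomial.eval₂AlgHom (Polynomial.eval₂AlgHom π₀ 0
    fun _ => Commute.all _ _) 0 fun _ => Commute.all _ _
  have π₁ : π (toTetra ps) = Polynomial.X := by simp [π, π₀]
  have π₂ : π (toTetra pt') = Polynomial.X := by simp [π, π₀]
  have π₃ : π tetraVec.b = 0 := by simp [π]
  have π₄ : π tetraVec.c = 0 := by simp [π]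
  have ha : tetraVec.a = toTetra ps - toTetra pt' := map_sub _ _ _
  have e := tetra_f
  have mb : tetraVec.b ∈ Ideal.span {tetraVec.a, tetraVec.b, tetraVec.c} :=
    Ideal.subset_span (Or.inr (Or.inl rfl))
  have mc : tetraVec.c ∈ Ideal.span {tetraVec.a, tetraVec.b, tetraVec.c} :=
    Ideal.subset_span (Or.inr (Or.inr rfl))
  have h0 : (cubic (-(2 / 3))).IsHom (1 / 3) 0 := isHom_zero _
  refine ⟨π, IsClosed.of_section ?_ ?_ (Polynomial.aeval (toTetra ps)) ?_ ?_ ?_⟩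
  · refine isGr_poly (X := ((cubes (-(1 / 3))).poly (1 / 3)).toGrAlg)
      (isGr_poly (X := (cubes (-(1 / 3))).toGrAlg) (isGr_poly (isGr_pt_poly ?_) ?_) ?_) ?_
    · change (cubic (-(2 / 3))).IsHom (1 / 3) (π (toTetra ps))
      rw [π₁]; exact isHom_line
    · change (cubic (-(2 / 3))).IsHom (1 / 3) (π (toTetra pt'))
      rw [π₂]; exact isHom_line
    · change (cubic (-(2 / 3))).IsHom (1 / 3) (π tetraVec.b)
      rw [π₃]; exact h0
    · change (cubic (-(2 / 3))).IsHom (1 / 3) (π tetraVec.c)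
      rw [π₄]; exact h0
  -- The term with bc dies together with c, and the two equal cubes add up to the constant -(2/3).
  · rw [e, map_sub, map_mul, π₄, mul_zero, sub_zero, map_smul, map_add, map_pow, map_pow, π₁, π₂,
      ← two_smul ℂ, smul_smul]
    norm_num
  · refine DFunLike.congr_fun (f := π.comp (Polynomial.aeval (toTetra ps))) (g := AlgHom.id ℂ _)
      (Polynomial.algHom_ext ?_)
    simpa using π₁
  · rw [Ideal.span_le]
    rintro x (rfl | rfl | rfl)
    · change π _ = 0
      rw [ha, map_sub, π₁, π₂, sub_self]
    · exact π₃
    · exact π₄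
  · refine tetra_hom_ext ?_ ?_ ?_ ?_
    · change Ideal.Quotient.mkₐ ℂ _ (Polynomial.aeval (toTetra ps) (π (toTetra ps))) = _
      rw [π₁, Polynomial.aeval_X]
    · change Ideal.Quotient.mkₐ ℂ _ (Polynomial.aeval (toTetra ps) (π (toTetra pt'))) = _
      rw [π₂, Polynomial.aeval_X]
      refine Ideal.Quotient.eq.2 ?_
      change toTetra ps - toTetra pt' ∈ _
      rw [← ha]
      exact Ideal.subset_span (Or.inl rfl)
    · change Ideal.Quotient.mkₐ ℂ _ (Polynomial.aeval (toTetra ps) (π tetraVec.b)) = _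
      rw [π₃, map_zero, map_zero]
      exact (Ideal.Quotient.eq_zero_iff_mem.2 mb).symm
    · change Ideal.Quotient.mkₐ ℂ _ (Polynomial.aeval (toTetra ps) (π tetraVec.c)) = _
      rw [π₄, map_zero, map_zero]
      exact (Ideal.Quotient.eq_zero_iff_mem.2 mc).symm

theorem cl_tetra_trip : cl (tetra.trip tetraVec) =
    L ^ 5 * (cubeClass ^ 2 + L * (L - 1)) + (L ^ 6 - L ^ 4) * cubeClass := by
  obtain ⟨π, h⟩ := exists_isClosed_tetraVec
  rw [cl_trip_of_isClosed _ h, cl_tetra, cl_cubic _ (by norm_num)]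
  ring

end PotVar

/-! ### The trace function on triples of 2 × 2 matrices in adapted coordinates -/

namespace PotVar

/-- The index set for the entries of three matrices of size two. -/
abbrev Ind : Type := Fin 3 × Fin 2 × Fin 2

/-- The extension of an algebra homomorphism to polynomials. -/
abbrev extend {A B : Type} [CommRing A] [Algebra ℂ A] [CommRing B] [Algebra ℂ B] (φ : A →ₐ[ℂ] B)
    (b : B) : Polynomial A →ₐ[ℂ] B :=
  Polynomial.eval₂AlgHom φ b fun _ => Commute.all _ _

theorem extend_C {A B : Type} [CommRing A] [Algebra ℂ A] [CommRing B] [Algebra ℂ B]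
    (φ : A →ₐ[ℂ] B) (b : B) (a : A) : extend φ b (Polynomial.C a) = φ a := by simp

theorem extend_X {A B : Type} [CommRing A] [Algebra ℂ A] [CommRing B] [Algebra ℂ B]
    (φ : A →ₐ[ℂ] B) (b : B) : extend φ b Polynomial.X = b := by simp

/-- The affine space of dimension twelve, in the coordinates adapted to `Tr(W)`. -/
abbrev twelve : PotVar := ((tetra.trip tetraVec).poly (1 / 3)).poly (1 / 3)

namespace twelve

/-- Pull-back of functions from `tetra.space`. -/
abbrev iS : tetra.space.A →ₐ[ℂ] twelve.A :=
  Polynomial.CAlgHom.comp (Polynomial.CAlgHom.comp (Polynomial.CAlgHom.comp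
    (Polynomial.CAlgHom.comp Polynomial.CAlgHom)))

theorem isGr_iS : IsGr (X := tetra.space.toGrAlg) (Y := twelve.toGrAlg) iS := fun _ _ h =>
  isHom_C _ (isHom_C _ (isHom_C _ (isHom_C _ (isHom_C _ h))))

/-- Pull-back of functions from `tetra`. -/
abbrev iT : tetra.A →ₐ[ℂ] twelve.A := iS.comp tetra.toSpace

theorem isGr_iT : IsGr (X := tetra.toGrAlg) (Y := twelve.toGrAlg) iT := fun _ _ h =>
  isGr_iS _ _ (isHom_toSpace h)

/-- The coordinates. -/
def s : twelve.A := iT (toTetra ps)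
/-- The coordinates. -/
def t : twelve.A := iT (toTetra pt')
/-- The coordinates. -/
def b : twelve.A := iT tetraVec.b
/-- The coordinates. -/
def c : twelve.A := iT tetraVec.c
/-- The coordinates. -/
def y₁ : twelve.A := iS tetra.y₁
/-- The coordinates. -/
def y₂ : twelve.A := iS tetra.y₂
/-- The coordinates. -/
def y₃ : twelve.A := iS tetra.y₃
/-- The coordinates. -/
def z₁ : twelve.A := Polynomial.C (Polynomial.C (Polynomial.C (Polynomial.C Polynomial.X)))
/-- The coordinates. -/
def z₂ : twelve.A := Polynomial.C (Polynomial.C (Polynomial.C Polynomial.X))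
/-- The coordinates. -/
def z₃ : twelve.A := Polynomial.C (Polynomial.C Polynomial.X)
/-- The coordinates. -/
def y₀ : twelve.A := Polynomial.C Polynomial.X
/-- The coordinates. -/
def z₀ : twelve.A := Polynomial.X

theorem hom_ext {B : Type} [CommRing B] [Algebra ℂ B] {φ ψ : twelve.A →ₐ[ℂ] B}
    (hs : φ s = ψ s) (ht : φ t = ψ t) (hb : φ b = ψ b) (hc : φ c = ψ c)
    (hy₁ : φ y₁ = ψ y₁) (hy₂ : φ y₂ = ψ y₂) (hy₃ : φ y₃ = ψ y₃) (hz₁ : φ z₁ = ψ z₁)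
    (hz₂ : φ z₂ = ψ z₂) (hz₃ : φ z₃ = ψ z₃) (hy₀ : φ y₀ = ψ y₀) (hz₀ : φ z₀ = ψ z₀) : φ = ψ := by
  refine Polynomial.algHom_ext' (Polynomial.algHom_ext' (Polynomial.algHom_ext'
    (Polynomial.algHom_ext' (Polynomial.algHom_ext' ?_ hz₁) hz₂) hz₃) hy₀) hz₀
  have h : φ.comp iT = ψ.comp iT := tetra_hom_ext hs ht hb hc
  exact space_hom_ext (DFunLike.congr_fun h) hy₁ hy₂ hy₃

/-- The homomorphism with given values on the coordinates. -/
theorem exists_hom {B : Type} [CommRing B] [Algebra ℂ B]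
    (s' t' b' c' y₁' y₂' y₃' z₁' z₂' z₃' y₀' z₀' : B) :
    ∃ φ : twelve.A →ₐ[ℂ] B, φ s = s' ∧ φ t = t' ∧ φ b = b' ∧ φ c = c' ∧ φ y₁ = y₁' ∧ φ y₂ = y₂' ∧
      φ y₃ = y₃' ∧ φ z₁ = z₁' ∧ φ z₂ = z₂' ∧ φ z₃ = z₃' ∧ φ y₀ = y₀' ∧ φ z₀ = z₀' := by
  let φ₁ : plane.A →ₐ[ℂ] B := extend (Polynomial.aeval s') t'
  let φ₂ : tetra.A →ₐ[ℂ] B := extend (extend φ₁ b') c'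
  let φ₃ : tetra.space.A →ₐ[ℂ] B := extend (extend (extend φ₂ y₁') y₂') y₃'
  let φ : twelve.A →ₐ[ℂ] B := extend (extend (extend (extend (extend φ₃ z₁') z₂') z₃') y₀') z₀'
  have e₃ : ∀ x, φ (iS x) = φ₃ x := fun x => by
    change φ (Polynomial.C (Polynomial.C (Polynomial.C (Polynomial.C (Polynomial.C x))))) = _
    rw [extend_C, extend_C, extend_C, extend_C, extend_C]
  have e₂ : ∀ x, φ (iT x) = φ₂ x := fun x => by
    refine (e₃ _).trans ?_
    change φ₃ (Polynomial.C (Polynomial.C (Polynomial.C x))) = _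
    rw [extend_C, extend_C, extend_C]
  have e₁ : ∀ x, φ (iT (toTetra x)) = φ₁ x := fun x => by
    refine (e₂ _).trans ?_
    change φ₂ (Polynomial.C (Polynomial.C x)) = _
    rw [extend_C, extend_C]
  refine ⟨φ, (e₁ _).trans ?_, (e₁ _).trans ?_, (e₂ _).trans ?_, (e₂ _).trans ?_, (e₃ _).trans ?_,
    (e₃ _).trans ?_, (e₃ _).trans ?_, ?_, ?_, ?_, ?_, ?_⟩
  · rw [extend_C, Polynomial.aeval_X]
  · rw [extend_X]
  · rw [extend_C, extend_X]
  · rw [extend_X]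
  · rw [extend_C, extend_C, extend_X]
  · rw [extend_C, extend_X]
  · rw [extend_X]
  · rw [z₁, extend_C, extend_C, extend_C, extend_C, extend_X]
  · rw [z₂, extend_C, extend_C, extend_C, extend_X]
  · rw [z₃, extend_C, extend_C, extend_X]
  · rw [y₀, extend_C, extend_X]
  · rw [z₀, extend_X]

/-- The tower of `lin` and `poly` is flattened into a polynomial in the twelve named coordinates,
for comparison with `trace_weyl`. -/
theorem f_eq : twelve.f = (-(1 / 3) : ℂ) • (s ^ 3 + t ^ 3) - (s + t) * b * c +
    (b * y₃ - c * y₂) * z₁ + (c * y₁ - (s - t) * y₃) * z₂ + ((s - t) * y₂ - b * y₁) * z₃ := by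
  have h : twelve.f = iT tetra.f + iS tetraVec.g₁ * z₁ + iS tetraVec.g₂ * z₂ +
      iS tetraVec.g₃ * z₃ := by
    change Polynomial.C (Polynomial.C _) = _
    simp only [map_add, map_mul]
    rfl
  have e₀ : tetra.f = (-(1 / 3) : ℂ) • (toTetra ps ^ 3 + toTetra pt' ^ 3) -
      (toTetra ps + toTetra pt') * tetraVec.b * tetraVec.c := tetra_f
  have ha : iT tetraVec.a = s - t := by
    have : tetraVec.a = toTetra ps - toTetra pt' := map_sub _ _ _
    rw [this, map_sub]; rfl
  have e₁ : iS tetraVec.g₁ = b * y₃ - c * y₂ := by rw [map_sub, map_mul, map_mul]; rfl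
  have e₂ : iS tetraVec.g₂ = c * y₁ - (s - t) * y₃ := by
    rw [map_sub, map_mul, map_mul]
    change c * y₁ - iT tetraVec.a * y₃ = _
    rw [ha]
  have e₃ : iS tetraVec.g₃ = (s - t) * y₂ - b * y₁ := by
    rw [map_sub, map_mul, map_mul]
    change iT tetraVec.a * y₂ - b * y₁ = _
    rw [ha]
  rw [h, e₀, e₁, e₂, e₃, map_sub, map_smul, map_mul, map_mul, map_add, map_add, map_pow, map_pow]
  rfl

end twelve

/-- The entries of the generic matrices. -/
abbrev x (i : Fin 3) (a b : Fin 2) : MvPolynomial Ind ℂ := MvPolynomial.X (i, a, b)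

/-- The first line of the right-hand side is -Tr(X³)/3, the rest is Tr([X,Y]Z). A commutator ignores
scalar parts and has trace zero, which is why the diagonal entries of `Y` and `Z` enter only through
their differences. For `X` the same holds in the commutator term, but not in the cubic one. -/
theorem trace_weyl : traceFun weylPotential 2 =
    (-(1 / 3) : ℂ) • (x 0 0 0 ^ 3 + x 0 1 1 ^ 3) - (x 0 0 0 + x 0 1 1) * x 0 0 1 * x 0 1 0 +
    (x 0 0 1 * x 1 1 0 - x 0 1 0 * x 1 0 1) * (x 2 0 0 - x 2 1 1) +
    (x 0 1 0 * (x 1 0 0 - x 1 1 1) - (x 0 0 0 - x 0 1 1) * x 1 1 0) * x 2 0 1 +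
    ((x 0 0 0 - x 0 1 1) * x 1 0 1 - x 0 0 1 * (x 1 0 0 - x 1 1 1)) * x 2 1 0 := by
  have h3 : MvPolynomial.C (1 / 3 : ℂ) * (3 : MvPolynomial Ind ℂ) = 1 := by
    rw [← map_ofNat MvPolynomial.C 3, ← map_mul]; norm_num
  simp only [traceFun, weylPotential, map_sub, map_mul, map_smul,
    FreeAlgebra.lift_ι_apply, Matrix.trace, Matrix.diag, Fin.sum_univ_two, Matrix.sub_apply,
    Matrix.smul_apply, pow_succ, pow_zero, one_mul, Matrix.mul_apply, genericMatrix, Matrix.of_apply,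
    MvPolynomial.smul_eq_C_mul, map_neg]
  -- The mixed part of Tr(X³) is 3(s + t)bc, whose factor 3 has to be cancelled against the constant
  -- 1/3.
  linear_combination (-(x 0 0 0 + x 0 1 1) * x 0 0 1 * x 0 1 0) * h3

/-- The coordinates of `twelve` as functions of the entries of the matrices. -/
theorem exists_equiv : ∃ e : MvPolynomial Ind ℂ ≃ₐ[ℂ] twelve.A,
    IsGr (X := affine fun _ : Ind => (1 / 3 : ℚ)) (Y := twelve.toGrAlg)
      (e : MvPolynomial Ind ℂ →ₐ[ℂ] twelve.A) ∧ e (traceFun weylPotential 2) = twelve.f := by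
  -- The unused coordinates y₀ and z₀ are the lower right entries. The upper left entries are y₁ +
  -- y₀ and z₁ + z₀, so that y₁ and z₁ are the differences of the diagonal entries.
  let m : Ind → twelve.A := fun i =>
    (![![![twelve.s, twelve.b], ![twelve.c, twelve.t]],
      ![![twelve.y₁ + twelve.y₀, twelve.y₂], ![twelve.y₃, twelve.y₀]],
      ![![twelve.z₁ + twelve.z₀, twelve.z₂], ![twelve.z₃, twelve.z₀]]] :
        Fin 3 → Fin 2 → Fin 2 → twelve.A) i.1 i.2.1 i.2.2
  let φ : MvPolynomial Ind ℂ →ₐ[ℂ] twelve.A := MvPolynomial.aeval m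
  have hφ : ∀ i a b, φ (x i a b) = m (i, a, b) := fun i a b => MvPolynomial.aeval_X _ _
  obtain ⟨ψ, hs, ht, hb, hc, hy₁, hy₂, hy₃, hz₁, hz₂, hz₃, hy₀, hz₀⟩ :=
    twelve.exists_hom (x 0 0 0) (x 0 1 1) (x 0 0 1) (x 0 1 0) (x 1 0 0 - x 1 1 1) (x 1 0 1)
      (x 1 1 0) (x 2 0 0 - x 2 1 1) (x 2 0 1) (x 2 1 0) (x 1 1 1) (x 2 1 1)
  refine ⟨AlgEquiv.ofAlgHom φ ψ ?_ ?_, ?_, ?_⟩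
  · apply twelve.hom_ext
    all_goals
      simp only [AlgHom.comp_apply, AlgHom.id_apply, hs, ht, hb, hc, hy₁, hy₂, hy₃, hz₁, hz₂, hz₃,
        hy₀, hz₀, map_sub, hφ]
      simp [m]
  · refine MvPolynomial.algHom_ext fun i => ?_
    obtain ⟨i, a, b⟩ := i
    change ψ (φ (x i a b)) = x i a b
    rw [hφ]
    fin_cases i <;> fin_cases a <;> fin_cases b <;>
      simp [m, hs, ht, hb, hc, hy₁, hy₂, hy₃, hz₁, hz₂, hz₃, hy₀, hz₀]
  · refine isGr_of_adjoin (X := affine fun _ : Ind => (1 / 3 : ℚ)) (Y := twelve.toGrAlg)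
      MvPolynomial.adjoin_range_X ?_
    rintro _ ⟨⟨i, a, b⟩, rfl⟩
    refine ⟨1 / 3, isHom_affineX _ _, ?_⟩
    have hy₀ : twelve.IsHom (1 / 3) twelve.y₀ := isHom_C _ (isHom_polyX _ _)
    have hz₀ : twelve.IsHom (1 / 3) twelve.z₀ := isHom_polyX _ _
    change twelve.IsHom (1 / 3) (φ (x i a b))
    rw [hφ]
    fin_cases i <;> fin_cases a <;> fin_cases b
    · exact twelve.isGr_iT _ _ (isHom_C _ (isHom_C _ isHom_ps))
    · exact twelve.isGr_iT _ _ tetraVec.hb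
    · exact twelve.isGr_iT _ _ tetraVec.hc
    · exact twelve.isGr_iT _ _ (isHom_C _ (isHom_C _ isHom_pt'))
    · exact (twelve.isGr_iS _ _ isHom_y₁).add hy₀
    · exact twelve.isGr_iS _ _ isHom_y₂
    · exact twelve.isGr_iS _ _ isHom_y₃
    · exact hy₀
    · exact (isHom_C _ (isHom_C _ (isHom_C _ (isHom_C _ (isHom_polyX _ _))))).add hz₀
    · exact isHom_C _ (isHom_C _ (isHom_C _ (isHom_polyX _ _)))
    · exact isHom_C _ (isHom_C _ (isHom_polyX _ _))
    · exact hz₀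
  · change φ _ = _
    rw [trace_weyl, twelve.f_eq]
    simp only [map_add, map_sub, map_mul, map_smul, map_pow, hφ]
    simp [m]

/-- The affine space of triples of `2 × 2` matrices with the function `Tr(W)`. -/
abbrev weyl : PotVar where
  toGrAlg := affine fun _ : Ind => (1 / 3 : ℚ)
  f := traceFun weylPotential 2
  hf := by
    -- Homogeneity of the trace is read off from `twelve`, where it is part of the construction, and
    -- is reflected along the graded isomorphism.
    obtain ⟨e, he, hf⟩ := exists_equiv
    refine he.reflect e.injective ?_
    change twelve.IsHom 1 (e _)
    rw [hf]
    exact twelve.hf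

/-- The coordinates y₀ and z₀ are absent from the function and contribute L² to the class computed
in `cl_tetra_trip`. -/
theorem cl_weyl : cl weyl =
    L ^ 6 * (L * cubeClass ^ 2 + L ^ 2 * (L - 1) + (L ^ 2 - 1) * cubeClass) := by
  obtain ⟨e, he, hf⟩ := exists_equiv
  rw [cl_eq (Q := twelve) ⟨e, he, hf⟩, cl_poly, cl_poly, cl_tetra_trip]
  ring

end PotVar

namespace GrAlg

variable {Γ : Type} [AddCommGroup Γ] {X Y : GrAlg Γ}

theorem isGr_of_isHom_zero (h : ∀ a, X.IsHom 0 a) {φ : X.A →ₐ[ℂ] Y.A}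
    (hφ : ∀ a, Y.IsHom 0 (φ a)) : IsGr φ := by
  intro q a ha
  by_cases hq : q = 0
  · rw [hq]; exact hφ a
  · rw [ha.eq_zero (h a) hq, map_zero]; exact isHom_zero q

theorem isHom_push_zero {Γ' : Type} [AddCommGroup Γ'] (h : Γ →+ Γ') (hh : ∀ q, h q = 0) (a : X.A) :
    (X.push h).IsHom 0 a := by
  induction a using hom_induction with
  | hom q a ha => rw [← hh q]; exact ha.push h
  | add a b ha hb => exact ha.add hb

end GrAlg

/-! ### Passage to the localization -/

namespace PotVar

/-- The ring homomorphism `[X, f] ↦ [f = 0] - [f = 1]` with values in the localization. -/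
def toMot : K →+* Mot := (algebraMap MuVar.K0 Mot).comp MuVar.ringEquiv.toRingHom

theorem toMot_apply (a : K) : toMot a = algebraMap MuVar.K0 Mot (phi a) := rfl

theorem toMot_L : toMot L = lef := by rw [toMot_apply, MuVar.phi_L]; rfl

/-- The part f ≠ 0 is the total space of the fibre f = 1, whose class is minus `psi` of the fibre.
In contrast to `phi_cl`, the locus f = 0 is kept as a `ℚ`-graded variety with potential zero, and
this leaves its action open to modification in `toMot_zero_wt`. -/
theorem phi_cl' (P : PotVar) :
    phi (cl P) = phi (cl (zero (P.toGrAlg.quot P.f P.hf))) - MuVar.cl (P.fib 1) := by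
  rw [cl_eq_add, map_add, sub_eq_add_neg, ← neg_neg (cl (P.fib 1).tot), ← MuVar.psi_cl, map_neg,
    MuVar.phi_psi]

theorem phi_zero (X : GrAlg ℚ) : phi (cl (zero X)) = MuVar.cl (X.push QZ.mk) := by
  rw [cl_zero, ← MuVar.psi_cl, MuVar.phi_psi]

theorem isUnit_dens {x : MuVar.K0} (h : x ∈ Lam.dens MuVar.lef) :
    IsUnit (algebraMap MuVar.K0 Mot x) := IsLocalization.map_units Mot (⟨x, h⟩ : Lam.dens MuVar.lef)

theorem isUnit_lef : IsUnit lef := isUnit_dens (Submonoid.subset_closure (Or.inl rfl))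

theorem isUnit_lef_pow_sub (n : ℕ) : IsUnit (lef ^ (n + 1) - 1) := by
  have := isUnit_dens (Submonoid.subset_closure (Or.inr ⟨n, rfl⟩) :
    MuVar.lef ^ (n + 1) - 1 ∈ Lam.dens MuVar.lef)
  rwa [map_sub, map_pow, map_one] at this

theorem isUnit_lef_sub : IsUnit (lef - 1) := by simpa using isUnit_lef_pow_sub 0

theorem isUnit_lef_sq_sub : IsUnit (lef ^ 2 - 1) := isUnit_lef_pow_sub 1

/-! ### Removing the action on a graded variety with potential zero -/

section torus

variable (X : GrAlg ℤ) (r : ℚ)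

/-- The grading with the degrees multiplied by `r`. -/
abbrev wt (s : ℚ) : GrAlg ℚ := X.push (zmultiplesHom ℚ s)

/-- The product with a torus. -/
abbrev torus (s : ℚ) : PotVar :=
  ((zero (wt X s)).poly (-r)).loc (Polynomial.X : Polynomial X.A) (isHom_polyX _ _)

theorem isHom_wt_zero (a : X.A) : (wt X 0).IsHom 0 a :=
  isHom_push_zero (zmultiplesHom ℚ 0) (fun q => smul_zero q) a

/-- A torus is an affine line without its origin. Its coordinate is given the degree -r whatever the
weight s on `X` is, which prepares the comparison of s = 0 with s = r. -/
theorem cl_torus (s : ℚ) : (L - 1) * cl (zero (wt X s)) = cl (torus X r s) := by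
  let π : Polynomial X.A →ₐ[ℂ] X.A := (Polynomial.aeval (0 : X.A)).restrictScalars ℂ
  have h : IsClosed ((zero (wt X s)).poly (-r)) (zero (wt X s))
      (Ideal.span {(Polynomial.X : Polynomial X.A)}) π := by
    refine ⟨isGr_poly (X := wt X s) ?_ ?_, fun a => ⟨Polynomial.C a, ?_⟩, ?_, ?_⟩
    · intro q a ha
      simpa [π] using ha
    · simpa [π] using isHom_zero (X := wt X s) (-r)
    · simp [π]
    · simp [π]
    · intro a
      rw [Ideal.mem_span_singleton, Polynomial.X_dvd_iff, Polynomial.coeff_zero_eq_aeval_zero]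
      rfl
  have := cl_loc ((zero (wt X s)).poly (-r)) (Polynomial.X : Polynomial X.A) (isHom_polyX _ _)
  rw [(IsClosed.quot _ _ _).cl_eq h, cl_poly] at this
  rw [sub_mul, one_mul, this, add_sub_cancel_left]

/-- The universal property of the product with a torus. -/
structure IsTorus (s : ℚ) (P : PotVar) (ι : X.A →ₐ[ℂ] P.A) (u : P.Aˣ) : Prop where
  ext : ∀ {B : Type} [CommRing B] [Algebra ℂ B] (φ ψ : P.A →ₐ[ℂ] B), (∀ a, φ (ι a) = ψ (ι a)) →
    φ u = ψ u → φ = ψ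
  lift : ∀ {B : Type} [CommRing B] [Algebra ℂ B] (φ : X.A →ₐ[ℂ] B) (v : Bˣ),
    ∃ ψ : P.A →ₐ[ℂ] B, (∀ a, ψ (ι a) = φ a) ∧ ψ u = v
  isHom_u : P.IsHom (-r) u
  isHom_inv : P.IsHom (- -r) (↑u⁻¹ : P.A)
  isHom_ι : ∀ {q : ℚ} {a : X.A}, (wt X s).IsHom q a → P.IsHom q (ι a)
  isGr : ∀ {Q : GrAlg ℚ} {φ : P.A →ₐ[ℂ] Q.A}, IsGr (X := wt X s) (Y := Q) (φ.comp ι) →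
    Q.IsHom (-r) (φ u) → Q.IsHom (- -r) (φ ↑u⁻¹) → IsGr (X := P.toGrAlg) (Y := Q) φ
  f : P.f = 0

variable {X r}

/-- `a ↦ a v^q` for `a` of degree `q`. -/
def twist {B : Type} [CommRing B] [Algebra ℂ B] (ι : X.A →ₐ[ℂ] B) (v : Bˣ) : X.A →ₐ[ℂ] B :=
  (AddMonoidAlgebra.liftNCAlgHom ι ((Units.coeHom B).comp (zpowersHom Bˣ v))
    (fun _ _ => Commute.all _ _)).comp X.co

theorem twist_hom {B : Type} [CommRing B] [Algebra ℂ B] (ι : X.A →ₐ[ℂ] B) (v : Bˣ) {n : ℤ}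
    {a : X.A} (h : X.IsHom n a) : twist ι v a = ι a * ↑(v ^ n) := by
  rw [twist, AlgHom.comp_apply, h]
  exact AddMonoidAlgebra.liftNC_single _ _ _ _

namespace IsTorus

variable {P Q : PotVar} {ι : X.A →ₐ[ℂ] P.A} {u : P.Aˣ} {κ : X.A →ₐ[ℂ] Q.A} {v : Q.Aˣ} {s : ℚ}

theorem isHom_zpow (h : IsTorus X r s P ι u) (n : ℤ) :
    P.IsHom (-(n • r)) (↑(u ^ n) : P.A) := by
  obtain ⟨n, rfl | rfl⟩ := n.eq_nat_or_neg
  · have := h.isHom_u.pow n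
    rw [zpow_natCast, Units.val_pow_eq_pow_val]
    simpa using this
  · have := h.isHom_inv.pow n
    rw [zpow_neg, zpow_natCast, ← inv_pow, Units.val_pow_eq_pow_val]
    simpa using this

/-- On a homogeneous element of degree n the two maps multiply by the n-th powers of w and w', and
these powers cancel because the image of w is inverse to w'. The torus coordinate itself is fixed.
-/
theorem comp_eq_id {φ : P.A →ₐ[ℂ] Q.A} {ψ : Q.A →ₐ[ℂ] P.A} (h : IsTorus X r s P ι u)
    {w : Q.Aˣ} {w' : P.Aˣ} (hw : φ u = v) (hw' : ψ v = u) (hww : Units.map (ψ : Q.A →* P.A) w * w' = 1)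
    (hφ : ∀ a, φ (ι a) = twist κ w a) (hψ : ∀ a, ψ (κ a) = twist ι w' a) :
    ψ.comp φ = AlgHom.id ℂ _ := by
  refine h.ext _ _ (fun a => ?_) ?_
  · rw [AlgHom.comp_apply, hφ, AlgHom.id_apply]
    induction a using hom_induction with
    | hom n a ha =>
      have e : ψ ↑(w ^ n) = ↑(Units.map (ψ : Q.A →* P.A) w ^ n) := by
        rw [← map_zpow]; rfl
      rw [twist_hom _ _ ha, map_mul, hψ, twist_hom _ _ ha, e, mul_assoc, ← Units.val_mul,
        ← mul_zpow, mul_comm w', hww, one_zpow, Units.val_one, mul_one]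
    | add a b ha hb => rw [map_add, map_add, ha, hb, map_add]
  · rw [AlgHom.comp_apply, hw, hw', AlgHom.id_apply]

/-- This is the untwisting (x, u) ↦ (u·x, u): in the product with a torus the action on the factor
`X` can be absorbed by the torus, at the price of an automorphism. On functions, `a` of degree n
goes to a vⁿ. The degrees are integers here, since vⁿ must make sense for them. -/
theorem iso (h : IsTorus X r 0 P ι u) (h' : IsTorus X r r Q κ v) : Iso P Q := by
  obtain ⟨φ, hφ, hu⟩ := h.lift (twist κ v) v
  obtain ⟨ψ, hψ, hv⟩ := h'.lift (twist ι u⁻¹) u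
  have mu : Units.map (φ : P.A →* Q.A) u = v := Units.ext hu
  have mv : Units.map (ψ : Q.A →* P.A) v = u := Units.ext hv
  refine ⟨AlgEquiv.ofAlgHom φ ψ ?_ ?_, ?_, ?_⟩
  · refine h'.comp_eq_id hv hu (w := u⁻¹) (w' := v) ?_ hψ hφ
    rw [map_inv, mu, inv_mul_cancel]
  · refine h.comp_eq_id hu hv (w := v) (w' := u⁻¹) ?_ hφ hψ
    rw [mv, mul_inv_cancel]
  · refine h.isGr (φ := φ) ?_ ?_ ?_
    · refine isGr_of_isHom_zero (isHom_wt_zero X) fun a => ?_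
      rw [AlgHom.comp_apply, hφ]
      refine hom_induction (X := X) (P := fun a => Q.IsHom 0 (twist κ v a)) (fun n a ha => ?_)
        (fun a b ha hb => ?_) a
      · rw [twist_hom _ _ ha]
        -- The function `a` has degree n r and vⁿ has degree -n r, so that the product is invariant.
        have := (h'.isHom_ι (ha.push (zmultiplesHom ℚ r))).mul (h'.isHom_zpow n)
        rwa [zmultiplesHom_apply, add_neg_cancel] at this
      · rw [map_add]; exact ha.add hb
    · rw [hu]; exact h'.isHom_u
    · have e : φ ↑u⁻¹ = ↑(Units.map (φ : P.A →* Q.A) u)⁻¹ := rfl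
      rw [e, mu]; exact h'.isHom_inv
  · change φ P.f = Q.f
    rw [h.f, h'.f, map_zero]

end IsTorus

/-- The coordinate ring is A[T][S]/(TS - 1), with the classes of T and S as the unit and its
inverse. The comparison of two such products uses only the properties verified here, not the
presentation. -/
theorem exists_isTorus (s : ℚ) : ∃ ι u, IsTorus X r s (torus X r s) ι u := by
  let P := torus X r s
  let q : Polynomial (Polynomial X.A) →ₐ[ℂ] (torus X r s).A := Ideal.Quotient.mkₐ ℂ _
  have hT : q (Polynomial.C Polynomial.X) * q Polynomial.X = 1 := by
    rw [← sub_eq_zero, ← map_mul, ← map_one q, ← map_sub]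
    exact Ideal.Quotient.eq_zero_iff_mem.2 (Ideal.mem_span_singleton_self _)
  let u : (torus X r s).Aˣ := ⟨q (Polynomial.C Polynomial.X), q Polynomial.X, hT,
    by rw [mul_comm, hT]⟩
  have hg : IsGr (X := ((wt X s).poly (-r)).poly (- -r)) (Y := (torus X r s).toGrAlg) q :=
    isGr_toQuot (((wt X s).poly (-r)).poly (- -r)) _
      (((wt X s).poly (-r)).loc_hom (isHom_polyX _ _))
  refine ⟨q.comp (Polynomial.CAlgHom.comp Polynomial.CAlgHom), u, ?_, ?_, ?_, ?_, ?_, ?_, ?_⟩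
  · intro B _ _ φ ψ h hu
    refine Ideal.Quotient.algHom_ext _ (Polynomial.algHom_ext' (Polynomial.algHom_ext'
      (AlgHom.ext h) hu) ?_)
    have : Units.map (φ : (torus X r s).A →* B) u = Units.map (ψ : (torus X r s).A →* B) u :=
      Units.ext hu
    exact congr_arg (fun x : Bˣ => (↑x⁻¹ : B)) this
  · intro B _ _ φ v
    refine ⟨Ideal.Quotient.liftₐ _ (extend (extend φ v) ↑v⁻¹) ?_, fun a => ?_, ?_⟩
    · intro a ha
      obtain ⟨b, rfl⟩ := Ideal.mem_span_singleton'.1 ha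
      rw [map_mul, map_sub, map_mul, extend_C, extend_X, extend_X, Units.mul_inv, map_one,
        sub_self, mul_zero]
    · change extend (extend φ v) ↑v⁻¹ (Polynomial.C (Polynomial.C a)) = _
      rw [extend_C, extend_C]
    · change extend (extend φ v) ↑v⁻¹ (Polynomial.C Polynomial.X) = _
      rw [extend_C, extend_X]
  · exact hg _ _ (isHom_C _ (isHom_polyX (wt X s) (-r)))
  · exact hg _ _ (isHom_polyX ((wt X s).poly (-r)) (- -r))
  · exact fun h => hg _ _ (isHom_C _ (isHom_C _ h))
  · intro Q φ h₁ h₂ h₃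
    exact IsGr.of_comp_surj hg Ideal.Quotient.mk_surjective
      (isGr_poly (isGr_poly (X := wt X s) h₁ h₂) h₃)
  · change q (Polynomial.C (Polynomial.C 0)) = 0
    rw [map_zero, map_zero, map_zero]

/-- The action of the torus does not affect the class in the localization. -/
theorem toMot_zero_wt (X : GrAlg ℤ) (r : ℚ) : toMot (cl (zero (wt X r))) = toMot (cl (zero (wt X 0))) := by
  obtain ⟨ι, u, h₀⟩ := exists_isTorus (X := X) (r := r) 0
  obtain ⟨κ, v, h₁⟩ := exists_isTorus (X := X) (r := r) r
  have h : (L - 1) * cl (zero (wt X r)) = (L - 1) * cl (zero (wt X 0)) := by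
    rw [cl_torus X r r, cl_torus X r 0, cl_eq (h₀.iso h₁)]
  -- Up to this point both classes are multiplied by L - 1. Cancellation is available only after
  -- localization.
  have h1 := congr_arg toMot h
  rw [map_mul, map_mul, map_sub, map_one, toMot_L] at h1
  exact isUnit_lef_sub.mul_left_cancel h1

theorem toMot_zero_wt_eq (X : GrAlg ℤ) (A : Type) [CommRing A] [Algebra ℂ A] (h : Algebra.FiniteType ℂ A)
    (e : X.A ≃ₐ[ℂ] A) : toMot (cl (zero (wt X 0))) = mot (GrAlg.triv A h) := by
  rw [toMot_apply, phi_zero]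
  refine congr_arg (algebraMap MuVar.K0 Mot) (MuVar.cl_eq (X := (wt X 0).push QZ.mk)
    (Y := GrAlg.triv A h) ⟨e, isGr_of_isHom_zero (fun a => ?_) fun a => MuVar.isHom_triv h _⟩)
  have := (isHom_wt_zero X a).push QZ.mk
  rwa [map_zero] at this

end torus

end PotVar

/-! ### The fibres of the cubic and of Tr(W) -/

namespace PotVar

theorem toMot_cl (P : PotVar) :
    toMot (cl P) = toMot (cl (zero (P.toGrAlg.quot P.f P.hf))) - mot (P.fib 1) := by
  rw [toMot_apply, phi_cl', map_sub, ← toMot_apply]; rfl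

/-- The locus x³ = 0 is the origin with nilpotents, and nilpotents do not affect classes (`cl_nil`).
-/
theorem cl_zero_cubic : cl (zero ((cubic 1).toGrAlg.quot (cubic 1).f (cubic 1).hf)) = 1 := by
  let π : Polynomial ℂ →ₐ[ℂ] ℂ := Polynomial.aeval 0
  have πX : π Polynomial.X = 0 := Polynomial.aeval_X _
  let φ : (Polynomial ℂ ⧸ Ideal.span {(cubic 1).f}) →ₐ[ℂ] ℂ :=
    Ideal.Quotient.liftₐ _ π (by
      intro a ha
      obtain ⟨b, rfl⟩ := Ideal.mem_span_singleton'.1 ha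
      rw [map_mul, map_smul, map_pow, πX, zero_pow three_ne_zero, smul_zero, mul_zero])
  rw [← cl_pt]
  refine cl_nil (P := zero ((cubic 1).toGrAlg.quot (cubic 1).f (cubic 1).hf)) (Q := pt) φ ?_ ?_ ?_ ?_
  · refine IsGr.of_comp_surj (isGr_toQuot _ _ (cubic 1).hf)
      (toQuot_surjective _ _ (cubic 1).hf) (isGr_pt_poly ?_)
    change pt.IsHom (1 / 3) (π Polynomial.X)
    rw [πX]
    exact isHom_zero _
  · exact map_zero φ
  · exact fun c => ⟨algebraMap ℂ _ c, φ.commutes c⟩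
  · intro a ha
    obtain ⟨a, rfl⟩ := Ideal.Quotient.mk_surjective a
    obtain ⟨b, rfl⟩ : Polynomial.X ∣ a := by
      rw [Polynomial.X_dvd_iff, Polynomial.coeff_zero_eq_aeval_zero]; exact ha
    -- A function that vanishes at the origin is divisible by x, so its cube lies in the ideal
    -- generated by x³.
    refine ⟨3, ?_⟩
    rw [← map_pow]
    refine Ideal.Quotient.eq_zero_iff_mem.2 (Ideal.mem_span_singleton'.2 ⟨b ^ 3, ?_⟩)
    change b ^ 3 * ((1 : ℂ) • Polynomial.X ^ 3) = _
    rw [one_smul]; ring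

theorem mk_third : QZ.mk (1 / 3) = QZ.mk (1 / (3 : ℕ)) := by norm_num

theorem isHom_cube_sub_one : (MuVar.pt.poly (QZ.mk (1 / (3 : ℕ)))).IsHom 0
    (Polynomial.X ^ 3 - 1 : Polynomial ℂ) := by
  refine IsHom.sub ?_ isHom_one
  have := (isHom_polyX MuVar.pt (QZ.mk (1 / (3 : ℕ)))).pow 3
  rwa [← map_nsmul, nsmul_eq_mul, mul_one_div_cancel (by norm_num), QZ.mk_one] at this

theorem fib_cubic : GrAlg.Iso ((cubic 1).fib 1) (MuVar.mu 3 three_ne_zero) := by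
  refine Iso.quot (X := (cubic 1).toGrAlg.push QZ.mk) (Y := MuVar.pt.poly (QZ.mk (1 / (3 : ℕ))))
    (e := AlgEquiv.refl) ?_ ((cubic 1).hom_sub 1)
    isHom_cube_sub_one ?_
  · refine isGr_poly_push (X := pt.toGrAlg) ?_ ?_
    · exact isGr_of_isHom_zero (X := pt.toGrAlg.push QZ.mk) (fun a => by
        have := (MuVar.isHom_triv inferInstance a : pt.IsHom 0 a).push QZ.mk
        rwa [map_zero] at this) fun a => isHom_C _ (MuVar.isHom_triv _ a)
    · rw [mk_third]
      exact isHom_polyX MuVar.pt _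
  · simp

/-- The fibre of x³ over 0 counts as a point, and the fibre over 1 is μ₃ with its canonical action
because the coordinate has degree 1/3. -/
theorem toMot_cubeClass : toMot cubeClass = mTilde := by
  rw [cubeClass, toMot_cl, cl_zero_cubic, map_one, mTilde, mot, MuVar.cl_eq fib_cubic]
  rfl

/-- The untwisting by a torus works for integral degrees. The cone Tr(W) = 0 is therefore first
given the grading in which all matrix entries have degree 1; the degrees 1/3 are recovered by
rescaling. -/
theorem isHom_weyl_int : (affine fun _ : Ind => (1 : ℤ)).IsHom 3 (traceFun weylPotential 2) := by
  have hx : ∀ i a b, (affine fun _ : Ind => (1 : ℤ)).IsHom 1 (x i a b) := fun i a b =>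
    isHom_affineX _ _
  rw [trace_weyl]
  refine IsHom.add (IsHom.add (IsHom.add (IsHom.sub (IsHom.smul _ (IsHom.add ?_ ?_)) ?_) ?_) ?_) ?_
  · exact (hx _ _ _).pow 3
  · exact (hx _ _ _).pow 3
  · exact (((hx _ _ _).add (hx _ _ _)).mul (hx _ _ _)).mul (hx _ _ _)
  · exact (((hx _ _ _).mul (hx _ _ _)).sub ((hx _ _ _).mul (hx _ _ _))).mul
      ((hx _ _ _).sub (hx _ _ _))
  · exact (((hx _ _ _).mul ((hx _ _ _).sub (hx _ _ _))).sub (((hx _ _ _).sub (hx _ _ _)).mul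
      (hx _ _ _))).mul (hx _ _ _)
  · exact ((((hx _ _ _).sub (hx _ _ _)).mul (hx _ _ _)).sub ((hx _ _ _).mul ((hx _ _ _).sub
      (hx _ _ _)))).mul (hx _ _ _)

/-- The cone `Tr(W) = 0`. -/
abbrev weylCone : GrAlg ℤ :=
  (affine fun _ : Ind => (1 : ℤ)).quot (traceFun weylPotential 2) isHom_weyl_int

theorem weylCone_iso : GrAlg.Iso (wt weylCone (1 / 3)) (weyl.toGrAlg.quot weyl.f weyl.hf) := by
  refine ⟨AlgEquiv.refl, ?_⟩
  refine IsGr.of_comp_surj ((isGr_toQuot _ _ isHom_weyl_int).push (zmultiplesHom ℚ (1 / 3)))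
    (toQuot_surjective _ _ isHom_weyl_int) ?_
  refine isGr_of_adjoin MvPolynomial.adjoin_range_X ?_
  rintro _ ⟨i, rfl⟩
  refine ⟨1 / 3, ?_, isGr_toQuot _ _ weyl.hf _ _ (isHom_affineX _ i)⟩
  have := (isHom_affineX (fun _ : Ind => (1 : ℤ)) i).push (zmultiplesHom ℚ (1 / 3))
  rwa [zmultiplesHom_apply, one_smul] at this

theorem fib_weyl : GrAlg.Iso (weyl.fib 1) (fibreOne weylPotential_mem 2) := by
  refine Iso.quot (X := weyl.toGrAlg.push QZ.mk) (Y := matrixSpace 3 2 3) (e := AlgEquiv.refl) ?_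
    (weyl.hom_sub 1) (isHom_trace weylPotential_mem 2) ?_
  · refine isGr_of_adjoin MvPolynomial.adjoin_range_X ?_
    rintro _ ⟨i, rfl⟩
    refine ⟨QZ.mk (1 / 3), (isHom_affineX (fun _ : Ind => (1 / 3 : ℚ)) i).push QZ.mk, ?_⟩
    rw [mk_third]
    exact isHom_affineX _ i
  · simp

/-- Directly, the fibre over 0 comes with the scalar action, while `fibreZero` carries the trivial
one. As the fibre is a cone, `toMot_zero_wt` reconciles the two in the localization. -/
theorem toMot_weyl : toMot (cl weyl) =
    mot (fibreZero weylPotential 2) - mot (fibreOne weylPotential_mem 2) := by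
  rw [toMot_cl, ← cl_eq (zero_iso weylCone_iso), toMot_zero_wt]
  congr 1
  · exact toMot_zero_wt_eq weylCone _ inferInstance AlgEquiv.refl
  · exact congr_arg (algebraMap MuVar.K0 Mot) (MuVar.cl_eq fib_weyl)

end PotVar

/-! ### The symmetric square of the cubic line -/

namespace InvPot

/-- The invariants under d ↦ -d with fixed coefficients are the polynomials in d². In addition to
the class, the coordinate d² and its degree are recorded, because the cubic function has to be
written in terms of them. -/
theorem isLine_anti (B : InvPot) (q : ℚ) (hB : ∀ a, B.τ a = a) :
    ∃ ι y, IsLine B.quo.toGrAlg (B.anti q).quo.toGrAlg ι y ∧ (B.anti q).quo.IsHom (2 • q) y ∧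
      y.1 = (Polynomial.X ^ 2 : Polynomial B.A) := by
  let ι : B.quo.A →ₐ[ℂ] (B.anti q).quo.A := map (P := B) (Q := B.anti q) Polynomial.CAlgHom
    (fun a => by simp)
  let y : (B.anti q).quo.A := ⟨Polynomial.X ^ 2, by rw [mem_inv]; simp⟩
  have key : ∀ p : Polynomial B.quo.A, (Polynomial.eval₂ (ι : B.quo.A →+* (B.anti q).quo.A) y p).1 =
      Polynomial.expand B.A 2 (p.map (GrAlg.inv B.τ).val.toRingHom) := by
    intro p
    induction p using Polynomial.induction_on' with
    | add p r hp hr =>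
      rw [Polynomial.eval₂_add, Polynomial.map_add, map_add, ← hp, ← hr]
      rfl
    | monomial m a =>
      rw [Polynomial.map_monomial, Polynomial.eval₂_monomial, Polynomial.expand_monomial]
      change Polynomial.C a.1 * (Polynomial.X ^ 2) ^ m = _
      rw [← pow_mul, Polynomial.C_mul_X_pow_eq_monomial, mul_comm]
      rfl
  have hy : (B.anti q).quo.IsHom (2 • q) y := isHom_quo.2 ((isHom_polyX B.toGrAlg q).pow 2)
  refine ⟨ι, y, ⟨⟨_, hy⟩, isGr_map _ _ (isGr_polyC B.toGrAlg q), ?_, ?_⟩, hy, rfl⟩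
  · intro p p' hp
    have h1 := congr_arg Subtype.val hp
    rw [key, key] at h1
    exact Polynomial.map_injective _ Subtype.val_injective
      (Polynomial.expand_injective two_pos h1)
  · intro t
    -- Invariance makes an odd coefficient equal to its own negative.
    have hodd : ∀ n, ¬ 2 ∣ n → Polynomial.coeff t.1 n = 0 := fun n hn => by
      have h1 := anti_coeff (q := q) t.1 n
      rw [hB, (Nat.odd_iff.2 (by omega)).neg_one_pow, neg_one_mul] at h1
      have h2 : Polynomial.coeff t.1 n = -Polynomial.coeff t.1 n :=
        (congr_arg (fun p => Polynomial.coeff p n) t.2).symm.trans h1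
      rw [eq_neg_iff_add_eq_zero, ← two_smul ℂ] at h2
      exact (smul_eq_zero_iff_right (two_ne_zero (α := ℂ))).1 h2
    let p := Polynomial.contract 2 (t.1 : Polynomial B.A)
    obtain ⟨p', hp'⟩ := (Polynomial.mem_lifts p).1 ((Polynomial.lifts_iff_coeff_lifts
      (f := (GrAlg.inv B.τ).val.toRingHom) p).2 (fun n => ⟨⟨p.coeff n, hB _⟩, rfl⟩))
    refine ⟨p', Subtype.ext ?_⟩
    rw [key, hp']
    refine Polynomial.ext fun n => ?_
    rw [Polynomial.coeff_expand two_pos]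
    split_ifs with hn
    · rw [Polynomial.coeff_contract two_ne_zero, Nat.div_mul_cancel hn]
    · exact (hodd n hn).symm

end InvPot

namespace PotVar

theorem swap_pt (a : pt.swap.A) : pt.swap.τ a = a := by
  have : pt.swap.τ = AlgHom.id ℂ _ := Algebra.TensorProduct.ext' fun a b => by
    change b ⊗ₜ[ℂ] a = a ⊗ₜ[ℂ] b
    rw [← mul_one b, ← smul_eq_mul, TensorProduct.smul_tmul, smul_eq_mul, ← mul_one a,
      ← smul_eq_mul a, TensorProduct.smul_tmul]
    simp [mul_comm]
  rw [this]; rfl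

theorem cl_sym2_pt : cl pt.sym2 = 1 := by
  rw [← cl_pt]
  refine (cl_eq (P := pt) (Q := pt.sym2) ⟨AlgEquiv.ofBijective (Algebra.ofId ℂ _) ⟨?_, ?_⟩,
    isGr_pt _, ?_⟩).symm
  · intro a b h
    have h1 := congr_arg (fun t : pt.sym2.A => Algebra.TensorProduct.lid ℂ ℂ t.1) h
    simpa [Algebra.ofId_apply] using h1
  · intro t
    refine ⟨Algebra.TensorProduct.lid ℂ ℂ t.1, Subtype.ext ?_⟩
    refine (Algebra.TensorProduct.lid ℂ ℂ).injective ?_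
    simp [Algebra.ofId_apply]
  · exact (map_zero _).trans (Subtype.ext (by simp))

/-- The line over `pt.sym2` with the function `s³ / 4`. -/
abbrev symLine : PotVar where
  toGrAlg := pt.sym2.toGrAlg.poly (1 / 3)
  f := (1 / 4 : ℂ) • (Polynomial.X : Polynomial pt.sym2.A) ^ 3
  hf := (isHom_third (Z := pt.sym2.toGrAlg.poly (1 / 3)) (isHom_polyX _ _)).smul _

theorem isHom_symLine : symLine.IsHom (1 - 2 / 3) ((3 / 4 : ℂ) • Polynomial.X) := by
  have := (isHom_polyX pt.sym2.toGrAlg (1 / 3)).smul (3 / 4)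
  norm_num at this ⊢
  exact this

/-- The symmetric square of the line has the coordinates s = x + y and D = (x - y)², and x³ + y³ =
s³/4 + (3/4)sD. This is affine in D with a coefficient that vanishes only at s = 0, where the
remaining function is zero. Integration over D leaves L times a point. -/
theorem cl_sym2_cubic : cl (cubic 1).sym2 = L := by
  obtain ⟨ι, y, hl, hy, hy2⟩ := InvPot.isLine_anti pt.swap (1 / 3) swap_pt
  obtain ⟨e', he', e'C, e'X⟩ := hl.iso hy
  have hs : (pt.poly (1 / 3)).sym2.IsHom (1 / 3)
      ⟨Polynomial.X ⊗ₜ 1 + 1 ⊗ₜ Polynomial.X, pt.swap_s (1 / 3)⟩ := ge_hom isHom_line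
  obtain ⟨e, he, eC, eX⟩ := (pt.sym2_line (1 / 3)).iso hs
  -- The symmetric square is presented with s as the outer and D as the inner variable. The two are
  -- exchanged, as `lin` integrates over the outer one.
  let E : Polynomial (Polynomial pt.sym2.A) ≃ₐ[ℂ] (pt.poly (1 / 3)).sym2.A :=
    ((Polynomial.Bivariate.swap (R := pt.sym2.A)).restrictScalars ℂ).trans
      ((Polynomial.mapAlgEquiv e').trans e)
  have E1 : ∀ a, E (Polynomial.C (Polynomial.C a)) = e (Polynomial.C (e' (Polynomial.C a))) :=
    fun a => (congr_arg (fun p => e (Polynomial.mapAlgEquiv e' p))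
      (Polynomial.Bivariate.swap_C_C a)).trans (by simp)
  have E2 : E (Polynomial.C Polynomial.X) = e Polynomial.X :=
    (congr_arg (fun p => e (Polynomial.mapAlgEquiv e' p)) Polynomial.Bivariate.swap_X).trans
      (by simp)
  have E3 : E Polynomial.X = e (Polynomial.C (e' Polynomial.X)) :=
    (congr_arg (fun p => e (Polynomial.mapAlgEquiv e' p)) Polynomial.Bivariate.swap_Y).trans
      (by simp)
  have h1 : cl (cubic 1).sym2 = cl (symLine.lin _ (2 / 3) isHom_symLine) := by
    refine (cl_eq (P := symLine.lin _ (2 / 3) isHom_symLine) (Q := (cubic 1).sym2)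
      ⟨E, ?_, ?_⟩).symm
    · refine isGr_poly (X := pt.sym2.toGrAlg.poly (1 / 3)) (isGr_poly (X := pt.sym2.toGrAlg)
        (fun q a ha => ?_) ?_) ?_
      · change (pt.poly (1 / 3)).sym2.IsHom q (E (Polynomial.C (Polynomial.C a)))
        rw [E1]
        exact he _ _ (isHom_C _ (he' _ _ (isHom_C _ ha)))
      · change (pt.poly (1 / 3)).sym2.IsHom (1 / 3) (E (Polynomial.C Polynomial.X))
        rw [E2]
        exact he _ _ (isHom_polyX _ _)
      · change (pt.poly (1 / 3)).sym2.IsHom (2 / 3) (E Polynomial.X)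
        rw [E3]
        have h := he' _ _ (isHom_polyX _ _)
        have h2 := he _ _ (isHom_C _ h)
        norm_num at h2
        exact h2
    · change E (Polynomial.C ((1 / 4 : ℂ) • Polynomial.X ^ 3) +
        Polynomial.C ((3 / 4 : ℂ) • Polynomial.X) * Polynomial.X) = _
      rw [← Polynomial.smul_C, ← Polynomial.smul_C, map_pow, map_add, map_mul, map_smul, map_smul,
        map_pow, E2, E3, eX, e'X, eC]
      refine Subtype.ext ?_
      change (1 / 4 : ℂ) • (Polynomial.X ⊗ₜ[ℂ] 1 + 1 ⊗ₜ[ℂ] Polynomial.X) ^ 3 +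
        (3 / 4 : ℂ) • (Polynomial.X ⊗ₜ[ℂ] 1 + 1 ⊗ₜ[ℂ] Polynomial.X) * diffMap ℂ y.1 =
          ((1 : ℂ) • Polynomial.X ^ 3) ⊗ₜ[ℂ] 1 + 1 ⊗ₜ[ℂ] ((1 : ℂ) • Polynomial.X ^ 3)
      rw [hy2, map_pow, diffMap_X, one_smul]
      have p1 : (Polynomial.X ^ 3 : Polynomial ℂ) ⊗ₜ[ℂ] (1 : Polynomial ℂ) =
        (Polynomial.X ⊗ₜ[ℂ] 1) ^ 3 := by simp
      have p2 : (1 : Polynomial ℂ) ⊗ₜ[ℂ] (Polynomial.X ^ 3 : Polynomial ℂ) =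
        (1 ⊗ₜ[ℂ] Polynomial.X) ^ 3 := by simp
      rw [p1, p2]
      generalize (Polynomial.X : Polynomial ℂ) ⊗ₜ[ℂ] (1 : Polynomial ℂ) = a
      generalize (1 : Polynomial ℂ) ⊗ₜ[ℂ] (Polynomial.X : Polynomial ℂ) = b
      have h34 : (3 / 4 : ℂ) • (a + b) = (1 / 4 : ℂ) • (3 * (a + b)) := by
        rw [show (3 / 4 : ℂ) = 1 / 4 * 3 by norm_num, mul_smul, ofNat_smul_eq_nsmul, nsmul_eq_mul]
        norm_num
      rw [h34, smul_mul_assoc, ← smul_add]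
      -- The identity x³ + y³ = s³/4 + (3/4)sD with the denominators cleared.
      have : (a + b) ^ 3 + 3 * (a + b) * (a - b) ^ 2 = (4 : ℕ) • (a ^ 3 + b ^ 3) := by
        rw [nsmul_eq_mul]; push_cast; ring
      rw [this, ← Nat.cast_smul_eq_nsmul ℂ, smul_smul]
      norm_num
  let π : symLine.A →ₐ[ℂ] pt.sym2.A := (Polynomial.aeval (0 : pt.sym2.A)).restrictScalars ℂ
  have hπ : IsClosed symLine pt.sym2 (Ideal.span {(3 / 4 : ℂ) • Polynomial.X}) π := by
    refine ⟨isGr_poly (X := pt.sym2.toGrAlg) ?_ ?_, fun a => ⟨Polynomial.C a, ?_⟩, ?_, ?_⟩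
    · intro r a ha
      simpa [π] using ha
    · simpa [π] using isHom_zero (X := pt.sym2.toGrAlg) (1 / 3)
    · simp [π]
    · have : pt.sym2.f = 0 := Subtype.ext (by simp)
      rw [this]
      simp [π]
    · intro a
      -- The scalar 3/4 is a unit, so the coefficient (3/4)s cuts out exactly s = 0.
      have hu : IsUnit (algebraMap ℂ symLine.A (3 / 4)) := (IsUnit.mk0 _ (by norm_num)).map _
      rw [Ideal.mem_span_singleton, Algebra.smul_def, hu.mul_left_dvd, Polynomial.X_dvd_iff,
        Polynomial.coeff_zero_eq_aeval_zero]
      rfl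
  rw [h1, cl_lin_of_isClosed hπ, cl_sym2_pt, mul_one]

/-- As `mTilde` comes from the class of an actual variety with potential, the cubic line, σ² on it
is the class of the geometric symmetric square, with no need for the extension to denominators. -/
theorem sigma2_mTilde : sigma2 mTilde = lef := by
  have h := existsUnique_sigma.choose_spec.1.1 (phi cubeClass)
  have e : MuVar.sigma (phi cubeClass) = Lam.map MuVar.ringEquiv.toRingHom
      (sigma (cl (cubic 1))) := by
    change Lam.map MuVar.ringEquiv.toRingHom (sigma (MuVar.psi (phi cubeClass))) = _
    rw [psi_phi]; rfl
  rw [e, sigma_cl, cl_sym2_cubic, ← toMot_apply, toMot_cubeClass] at h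
  exact (congr_arg Lam.snd h).trans toMot_L

theorem fst_sigma (a : MuVar.K0) : (MuVar.sigma a).fst = a := by
  change phi (PotVar.sigma (MuVar.psi a)).fst = a
  rw [sigma_fst, MuVar.phi_psi]

/-- The extension is characterized only by its values on `K0` and its compatibility with L, so the
identity in the first component needs an argument. The first component is additive and commutes with
L, hence with every Lⁿ - 1 and with all denominators. Clearing a denominator reduces the claim to
`K0`. -/
theorem fst_choose_sigma (x : Mot) : (existsUnique_sigma.choose x).fst = x := by
  obtain ⟨h1, h2⟩ := existsUnique_sigma.choose_spec.1
  generalize existsUnique_sigma.choose = s at h1 h2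
  have hl : ∀ x, (s (lef * x)).fst = lef * (s x).fst := fun x => congr_arg Lam.fst (h2 x)
  have hp : ∀ (n : ℕ) x, (s (lef ^ n * x)).fst = lef ^ n * (s x).fst := by
    intro n
    induction n with
    | zero => simp
    | succ n ih => intro x; rw [pow_succ', mul_assoc, hl, ih, mul_assoc]
  have hd : ∀ d ∈ Lam.dens MuVar.lef, ∀ x, (s (algebraMap MuVar.K0 Mot d * x)).fst =
      algebraMap MuVar.K0 Mot d * (s x).fst := by
    intro d hd
    induction hd using Submonoid.closure_induction with
    | mem d hd =>
      rcases hd with rfl | ⟨n, rfl⟩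
      · exact hl
      -- Subtraction in `Lam` is division of series, but on the first component it is ordinary
      -- subtraction.
      · intro x
        rw [map_sub, map_pow, map_one, sub_mul, sub_mul, map_sub, one_mul, one_mul, sub_eq_add_neg,
          Lam.add_fst, Lam.neg_fst, ← sub_eq_add_neg]
        exact congr_arg (· - (s x).fst) (hp (n + 1) x)
    | one => simp
    | mul d d' _ _ h h' => intro x; rw [map_mul (algebraMap MuVar.K0 Mot), mul_assoc, h, h', mul_assoc]
  obtain ⟨⟨a, d⟩, hx⟩ := IsLocalization.surj (Lam.dens MuVar.lef) x
  refine (IsLocalization.map_units Mot d).mul_left_cancel ?_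
  rw [← hd d d.2, mul_comm, hx, h1]
  exact congr_arg (algebraMap MuVar.K0 Mot) (fst_sigma a)

theorem sigma2_lef_mul (x : Mot) : sigma2 (lef * x) = lef ^ 2 * sigma2 x :=
  congr_arg Lam.snd (existsUnique_sigma.choose_spec.1.2 x)

/-- The mixed term is that of the group law of `Lam`, the multiplication of truncated series. It
involves the first components, which `fst_choose_sigma` identifies. -/
theorem sigma2_add (x y : Mot) : sigma2 (x + y) = sigma2 x + sigma2 y + x * y := by
  rw [sigma2, map_add, Lam.add_snd, fst_choose_sigma, fst_choose_sigma]
  rfl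

/-- The recursion for `σ²` under division by `𝕃 - 1`. -/
theorem sigma2_div (a b : Mot) (h : (lef - 1) * a = b) :
    (lef ^ 2 - 1) * sigma2 a = sigma2 b + a * b := by
  -- The relation is rewritten as L a = a + b, and σ² is evaluated on both sides.
  have h1 : lef * a = a + b := by rw [← h]; ring
  have h2 := sigma2_lef_mul a
  rw [h1, sigma2_add] at h2
  linear_combination -h2

end PotVar

/-! ### The class of GL₂ -/

namespace PotVar

/-- The line whose coordinate has degree one, with the function `0`. -/
abbrev unitLine : PotVar := pt.poly 1

/-- The coordinate of `unitLine`. -/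
abbrev uz : unitLine.A := (Polynomial.X : Polynomial ℂ)

theorem isHom_uz : unitLine.IsHom 1 uz := isHom_polyX _ _

theorem isHom_uz_mul : (unitLine.poly 0).IsHom (1 - 0) (Polynomial.C uz * Polynomial.X) := by
  have := (isHom_C 0 isHom_uz).mul (isHom_polyX unitLine.toGrAlg 0)
  rwa [add_zero, ← sub_zero 1] at this

/-- The function `z a d`. -/
abbrev diagDet : PotVar := (unitLine.poly 0).lin (Polynomial.C uz * Polynomial.X) 0 isHom_uz_mul

/-- The coordinate `z`, with the opposite sign. -/
abbrev dz : diagDet.A := -Polynomial.C (Polynomial.C uz)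

theorem isHom_dz : diagDet.IsHom 1 dz := (isHom_C _ (isHom_C _ isHom_uz)).neg

theorem isHom_dz_mul : (diagDet.poly 0).IsHom (1 - 0) (Polynomial.C dz * Polynomial.X) := by
  have := (isHom_C 0 isHom_dz).mul (isHom_polyX diagDet.toGrAlg 0)
  rwa [add_zero, ← sub_zero 1] at this

/-- The function `z (a d - b c)`. -/
abbrev fullDet : PotVar := (diagDet.poly 0).lin (Polynomial.C dz * Polynomial.X) 0 isHom_dz_mul

theorem isHom_sub_zero {X : PotVar} {a : X.A} (h : X.IsHom 1 a) : X.IsHom (1 - 0 - 0) a := by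
  rwa [sub_zero, sub_zero]

theorem cl_unitLine_quot : cl (unitLine.quot uz (isHom_sub_zero isHom_uz)) = 1 := by
  rw [← cl_pt]
  let π : unitLine.A →ₐ[ℂ] pt.A := Polynomial.aeval (0 : ℂ)
  have h : IsClosed unitLine pt (Ideal.span {uz}) π := by
    refine ⟨isGr_pt_poly ?_, fun a => ⟨Polynomial.C a, ?_⟩, ?_, ?_⟩
    · simpa [π] using isHom_zero (X := pt.toGrAlg) 1
    · simp [π]
    · simp [π]
    · intro a
      rw [Ideal.mem_span_singleton, Polynomial.X_dvd_iff, Polynomial.coeff_zero_eq_aeval_zero]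
  exact (IsClosed.quot _ _ _).cl_eq h

/-- This is `cl_lin_mul_X` for the product ad with the coefficient z; the exceptional locus z = 0 is
a point. -/
theorem cl_diagDet : cl diagDet = 2 * L ^ 2 - L := by
  rw [cl_lin_mul_X unitLine uz 0 0 (isHom_sub_zero isHom_uz), cl_unitLine_quot, cl_poly, cl_pt]
  ring

/-- Setting z = 0 annihilates the function z a d and leaves a and d free. -/
theorem cl_diagDet_quot : cl (diagDet.quot dz (isHom_sub_zero isHom_dz)) = L ^ 2 := by
  let π₀ : unitLine.A →ₐ[ℂ] pt.A := Polynomial.aeval (0 : ℂ)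
  let π : diagDet.A →ₐ[ℂ] ((pt.poly 0).poly 0).A :=
    Polynomial.mapAlgHom (Polynomial.mapAlgHom π₀)
  have h₀ : IsGr (X := unitLine.toGrAlg) (Y := pt.toGrAlg) π₀ := by
    refine isGr_pt_poly ?_
    simpa [π₀] using isHom_zero (X := pt.toGrAlg) 1
  have h : IsClosed diagDet ((pt.poly 0).poly 0) (Ideal.span {dz}) π := by
    refine ⟨(h₀.polyMap 0).polyMap 0, ?_, ?_, ?_⟩
    · exact Polynomial.map_surjective _ (Polynomial.map_surjective _ fun a =>
        ⟨Polynomial.C a, by simp [π₀]⟩)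
    · simp [π, π₀]
    · intro a
      have e : dz = -Polynomial.C (Polynomial.C uz) := rfl
      rw [e, Ideal.span_singleton_neg, ← Set.image_singleton, ← Ideal.map_span,
        ← Set.image_singleton, ← Ideal.map_span, Ideal.mem_map_C_iff]
      simp only [Ideal.mem_map_C_iff, Ideal.mem_span_singleton, Polynomial.X_dvd_iff,
        Polynomial.coeff_zero_eq_aeval_zero]
      refine (polyMap_eq_zero (X := (unitLine.poly 0).toGrAlg) (Y := (pt.poly 0).toGrAlg)).trans ?_
      exact forall_congr' fun n =>
        polyMap_eq_zero (X := unitLine.toGrAlg) (Y := pt.toGrAlg)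
  rw [(IsClosed.quot _ _ _).cl_eq h, cl_poly, cl_poly, cl_pt]
  ring

/-- The term -z bc is integrated over the plane of b and c, with the already known class of z a d as
the base. -/
theorem cl_fullDet : cl fullDet = L ^ 4 + L ^ 3 - L ^ 2 := by
  rw [cl_lin_mul_X diagDet dz 0 0 (isHom_sub_zero isHom_dz), cl_diagDet_quot, cl_diagDet]
  ring

/-- The space of matrices of size two. -/
abbrev matTwo : GrAlg ℚ := GrAlg.triv (MvPolynomial (Fin 2 × Fin 2) ℂ)
  inferInstance

/-- The determinant. -/
abbrev detTwo : MvPolynomial (Fin 2 × Fin 2) ℂ := (Matrix.mvPolynomialX (Fin 2) (Fin 2) ℂ).det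

theorem isHom_detTwo : (zero matTwo).IsHom 0 detTwo :=
  MuVar.isHom_triv (A := MvPolynomial (Fin 2 × Fin 2) ℂ) inferInstance _

/-- The entries of a matrix, as functions on `fullDet`. -/
def entry (i : Fin 2 × Fin 2) : fullDet.A :=
  -- The tower introduces the entries in the order a, d, b, c, which explains the numbers of
  -- constant embeddings.
  !![Polynomial.C (Polynomial.C (Polynomial.C Polynomial.X)), Polynomial.C Polynomial.X;
    Polynomial.X, Polynomial.C (Polynomial.C Polynomial.X)] i.1 i.2

/-- The coordinate `z` on `fullDet`. -/
def fz : fullDet.A := Polynomial.C (Polynomial.C (Polynomial.C (Polynomial.C uz)))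

theorem isHom_entry (i : Fin 2 × Fin 2) : fullDet.IsHom 0 (entry i) := by
  obtain ⟨i, j⟩ := i
  fin_cases i <;> fin_cases j
  · exact isHom_C _ (isHom_C _ (isHom_C _ (isHom_polyX _ _)))
  · exact isHom_C _ (isHom_polyX _ _)
  · exact isHom_polyX _ _
  · exact isHom_C _ (isHom_C _ (isHom_polyX _ _))

/-- The same pair is now fibred over the space of matrices, with z as the coordinate of a line along
which z det is linear. Comparing the two ways of integrating yields the class of det = 0. The degree
1 of z makes z det homogeneous of degree 1 while the matrix entries have degree 0. -/
theorem exists_equiv_fullDet :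
    ∃ e : Polynomial (MvPolynomial (Fin 2 × Fin 2) ℂ) ≃ₐ[ℂ] fullDet.A,
      IsGr (X := matTwo.poly 1) (Y := fullDet.toGrAlg) (e : _ →ₐ[ℂ] fullDet.A) ∧
      e (Polynomial.C detTwo * Polynomial.X) = fullDet.f := by
  let φ : Polynomial (MvPolynomial (Fin 2 × Fin 2) ℂ) →ₐ[ℂ] fullDet.A :=
    extend (MvPolynomial.aeval entry) fz
  let m (i j : Fin 2) : Polynomial (MvPolynomial (Fin 2 × Fin 2) ℂ) :=
    Polynomial.C (MvPolynomial.X (i, j))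
  let ψ : fullDet.A →ₐ[ℂ] Polynomial (MvPolynomial (Fin 2 × Fin 2) ℂ) :=
    extend (extend (extend (extend (Polynomial.aeval Polynomial.X) (m 0 0)) (m 1 1)) (m 0 1))
      (m 1 0)
  have φX : φ Polynomial.X = fz := extend_X _ _
  have φC : ∀ i, φ (Polynomial.C (MvPolynomial.X i)) = entry i := fun i => by
    rw [extend_C, MvPolynomial.aeval_X]
  have ψz : ψ fz = Polynomial.X := by
    simp only [ψ, fz, extend_C]
    exact Polynomial.aeval_X _
  have ψe : ∀ i j, ψ (entry (i, j)) = m i j := by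
    intro i j
    fin_cases i <;> fin_cases j
    · change ψ (Polynomial.C (Polynomial.C (Polynomial.C Polynomial.X))) = _
      simp only [ψ, extend_C, extend_X]; rfl
    · change ψ (Polynomial.C Polynomial.X) = _
      simp only [ψ, extend_C, extend_X]; rfl
    · change ψ Polynomial.X = _
      simp only [ψ, extend_X]; rfl
    · change ψ (Polynomial.C (Polynomial.C Polynomial.X)) = _
      simp only [ψ, extend_C, extend_X]; rfl
  refine ⟨AlgEquiv.ofAlgHom φ ψ ?_ ?_, ?_, ?_⟩
  · have h : ∀ i j, (φ.comp ψ) (entry (i, j)) = entry (i, j) := fun i j => by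
      rw [AlgHom.comp_apply, ψe, φC]
    refine Polynomial.algHom_ext' (Polynomial.algHom_ext' (Polynomial.algHom_ext'
      (Polynomial.algHom_ext' (Polynomial.algHom_ext ?_) (h 0 0)) (h 1 1)) (h 0 1)) (h 1 0)
    change φ (ψ fz) = fz
    rw [ψz, φX]
  · refine Polynomial.algHom_ext' (MvPolynomial.algHom_ext fun i => ?_) ?_
    · change ψ (φ (Polynomial.C (MvPolynomial.X i))) = _
      rw [φC, ψe]
      rfl
    · change ψ (φ Polynomial.X) = _
      rw [φX, ψz]
      rfl
  · refine isGr_poly (X := matTwo) (isGr_of_adjoin MvPolynomial.adjoin_range_X ?_) ?_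
    · rintro _ ⟨i, rfl⟩
      refine ⟨0, MuVar.isHom_triv _ _, ?_⟩
      change fullDet.IsHom 0 (φ (Polynomial.C (MvPolynomial.X i)))
      rw [φC]
      exact isHom_entry i
    · change fullDet.IsHom 1 (φ Polynomial.X)
      rw [φX]
      exact isHom_C _ (isHom_C _ (isHom_C _ (isHom_C _ isHom_uz)))
  · change φ _ = _
    rw [detTwo, Matrix.det_fin_two]
    simp only [Matrix.mvPolynomialX_apply, map_sub, map_mul, φX, φC]
    simp [entry, fz]
    ring

theorem finiteType_glTwo : Algebra.FiniteType ℂ (Localization.Away detTwo) :=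
  .trans (S := MvPolynomial (Fin 2 × Fin 2) ℂ) inferInstance
    (IsLocalization.finiteType_of_monoid_fg (Submonoid.powers detTwo) _)

/-- The general linear group of size two. -/
abbrev glTwo : GrAlg ℚ := GrAlg.triv (Localization.Away detTwo) finiteType_glTwo

theorem isHom_glTwo (a : glTwo.A) : glTwo.IsHom 0 a := MuVar.isHom_triv finiteType_glTwo a

/-- In `IsScissors` the localization is stated for the algebra structure defined by the map, which
has to be identified with the given instance. -/
theorem isLocalization_toAlgebra {A B : Type*} [CommRing A] [CommRing B] [Algebra A B] (g : A)
    [h : IsLocalization.Away g B] {ψ : A →+* B} (hψ : ψ = algebraMap A B) :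
    @IsLocalization.Away A _ g B _ ψ.toAlgebra := by
  have e : ψ.toAlgebra = ‹Algebra A B› := Algebra.algebra_ext _ _ fun a => by
    rw [hψ]; rfl
  rw [e]
  exact h

theorem cl_matTwo : cl (zero matTwo) = cl ((zero matTwo).quot detTwo isHom_detTwo) +
    cl (zero glTwo) := by
  have h : IsScissors matTwo (matTwo.quot detTwo isHom_detTwo) glTwo detTwo
      (matTwo.toQuot detTwo isHom_detTwo)
      (IsScalarTower.toAlgHom ℂ (MvPolynomial (Fin 2 × Fin 2) ℂ) (Localization.Away detTwo)) :=
    { hom := ⟨0, isHom_detTwo⟩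
      grφ := isGr_toQuot _ _ _
      grψ := isGr_of_isHom_zero
        (MuVar.isHom_triv (A := MvPolynomial (Fin 2 × Fin 2) ℂ) inferInstance)
        fun _ => isHom_glTwo _
      surj := toQuot_surjective _ _ _
      ker := Ideal.Quotient.mkₐ_ker ℂ _
      loc := by
        exact isLocalization_toAlgebra detTwo rfl }
  exact cl_scissors (P := zero matTwo) (Z := (zero matTwo).quot detTwo isHom_detTwo)
    (U := zero glTwo) h rfl (map_zero _)

/-- The coordinates of `exists_equiv_fullDet` are reused with potential zero. The extra line with
coordinate z accounts for the factor L, which cannot be cancelled before localization. -/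
theorem L_mul_cl_matTwo : L * cl (zero matTwo) = L ^ 5 := by
  obtain ⟨e, he, -⟩ := exists_equiv_fullDet
  rw [← cl_poly _ 1, cl_eq (P := (zero matTwo).poly 1)
    (Q := (((unitLine.poly 0).poly 0).poly 0).poly 0) ⟨e, he, ?_⟩]
  · simp only [cl_poly, cl_pt]
    ring
  · simp

/-- Integrating z det over z gives L times the class of det = 0; integrating it over the entries
gives `cl_fullDet`. -/
theorem L_mul_cl_detTwo : L * cl ((zero matTwo).quot detTwo isHom_detTwo) =
    L ^ 4 + L ^ 3 - L ^ 2 := by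
  obtain ⟨e, he, hf⟩ := exists_equiv_fullDet
  have h : (zero matTwo).IsHom (1 - 1) detTwo := by
    rw [sub_self]; exact isHom_detTwo
  rw [← cl_fullDet, ← cl_eq (P := (zero matTwo).lin detTwo 1 h) (Q := fullDet) ⟨e, he, ?_⟩]
  · exact (cl_lin_of_isClosed (IsClosed.quot (zero matTwo) detTwo isHom_detTwo) 1 h).symm
  · rw [← hf]
    simp

theorem toMot_cl_glTwo : toMot (cl (zero glTwo)) = mot (MuVar.gl 2) := by
  rw [toMot_apply, phi_zero]
  refine congr_arg (algebraMap MuVar.K0 Mot) (MuVar.cl_eq (X := glTwo.push QZ.mk)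
    (Y := MuVar.gl 2) ⟨AlgEquiv.refl, isGr_of_isHom_zero (fun a => ?_) fun a =>
      MuVar.isHom_triv finiteType_glTwo _⟩)
  have := (isHom_glTwo a).push QZ.mk
  rwa [map_zero] at this

/-- The scissor relation for det, multiplied by L, expresses L[GL₂] as L⁵ - (L⁴ + L³ - L²). Since L
is invertible in `Mot`, it may be cancelled. -/
theorem mot_gl_two : mot (MuVar.gl 2) = lef * (lef - 1) * (lef ^ 2 - 1) := by
  have h := congr_arg (fun a => L * a) cl_matTwo
  simp only [mul_add] at h
  rw [L_mul_cl_matTwo, L_mul_cl_detTwo] at h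
  have h1 := congr_arg toMot h
  simp only [map_add, map_sub, map_mul, map_pow, toMot_L, toMot_cl_glTwo] at h1
  refine isUnit_lef.mul_left_cancel ?_
  linear_combination -h1

theorem isUnit_gl_two : IsUnit (mot (MuVar.gl 2)) := by
  rw [mot_gl_two]
  exact (isUnit_lef.mul isUnit_lef_sub).mul isUnit_lef_sq_sub

end PotVar

/-! ### Comparison of the coefficients of t² -/

open PotVar in
-- The factor L⁶ of `cl_weyl` is divided by L⁴ from the normalization and by one L from [GL₂]. The
-- remaining L is distributed over the three terms.
theorem coeff_dtSeries_weyl : PowerSeries.coeff 2 (dtSeries weylPotential_mem) *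
    ((lef ^ 2 - 1) * (lef - 1)) = lef ^ 3 * (lef - 1) + mTilde * lef * (lef ^ 2 - 1) +
      mTilde ^ 2 * lef ^ 2 := by
  have h := congr_arg toMot cl_weyl
  simp only [map_add, map_mul, map_sub, map_pow, map_one, toMot_L, toMot_cubeClass] at h
  rw [toMot_weyl] at h
  rw [dtSeries, PowerSeries.coeff_mk, h]
  have h1 := Ring.inverse_mul_cancel _ isUnit_gl_two
  have h2 := Ring.inverse_mul_cancel _ isUnit_lef
  rw [mot_gl_two] at h1 ⊢
  generalize Ring.inverse lef = u at h2 ⊢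
  generalize Ring.inverse (lef * (lef - 1) * (lef ^ 2 - 1)) = v at h1 ⊢
  -- The exponent is n² = 4 for n = 2.
  have h3 : (u ^ 2 ^ 2) * lef ^ 4 = 1 := by
    norm_num
    rw [← mul_pow, h2, one_pow]
  have h4 : v * (lef * ((lef ^ 2 - 1) * (lef - 1))) = 1 := by linear_combination h1
  calc _ = (u ^ 2 ^ 2 * lef ^ 4) * (v * (lef * ((lef ^ 2 - 1) * (lef - 1)))) *
        (lef ^ 3 * (lef - 1) + mTilde * lef * (lef ^ 2 - 1) + mTilde ^ 2 * lef ^ 2) := by ring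
    _ = _ := by rw [h3, h4, one_mul, one_mul]

/-- Since `Ring.inverse` is zero on non-units, it must first be known that 1 - t is a unit; the
geometric series provides the inverse. -/
theorem inverse_one_sub_X {R : Type*} [CommRing R] :
    Ring.inverse (1 - PowerSeries.X : PowerSeries R) = PowerSeries.mk 1 := by
  have h := PowerSeries.mk_one_mul_one_sub_eq_one R
  have hu : IsUnit (1 - PowerSeries.X : PowerSeries R) := .of_mul_eq_one_right _ h
  exact hu.mul_left_injective ((Ring.inverse_mul_cancel _ hu).trans h.symm)

theorem coeff_geometric {R : Type*} [CommRing R] (α : R) (n : ℕ) :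
    PowerSeries.coeff (n + 1) (PowerSeries.C α *
      (PowerSeries.X * Ring.inverse (1 - PowerSeries.X))) = α := by
  rw [inverse_one_sub_X, PowerSeries.coeff_C_mul, PowerSeries.coeff_succ_X_mul,
    PowerSeries.coeff_mk, Pi.one_apply, mul_one]

/-- The quadratic term of the factor for n = 1 and the linear term of the factor for n = 2 are all
that reaches t²; every other product of non-constant terms has order at least 3. -/
theorem expCoeffTwo_eq (F : PowerSeries Mot) : expCoeffTwo F =
    sigma2 (PowerSeries.coeff 1 F) + PowerSeries.coeff 2 F := by
  have h : Finset.Icc 1 2 = {1, 2} := rfl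
  rw [expCoeffTwo, h, Finset.prod_pair (by norm_num)]
  generalize PowerSeries.coeff 1 F = a
  generalize PowerSeries.coeff 2 F = b
  simp only [sigmaSeries, pow_one]
  -- The terms of order at least 3 are collected in a multiple of t³.
  have e : (1 + PowerSeries.C a * PowerSeries.X + PowerSeries.C (sigma2 a) * PowerSeries.X ^ 2) *
      (1 + PowerSeries.C b * PowerSeries.X ^ 2 +
        PowerSeries.C (sigma2 b) * (PowerSeries.X ^ 2) ^ 2) =
      1 + PowerSeries.C a * PowerSeries.X ^ 1 + PowerSeries.C (sigma2 a + b) * PowerSeries.X ^ 2 +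
      (PowerSeries.C (a * b) + PowerSeries.C (sigma2 a * b + sigma2 b) * PowerSeries.X +
        PowerSeries.C (a * sigma2 b) * PowerSeries.X ^ 2 +
        PowerSeries.C (sigma2 a * sigma2 b) * PowerSeries.X ^ 3) * PowerSeries.X ^ 3 := by
    simp only [map_add, map_mul]
    ring
  rw [e]
  simp only [map_add (PowerSeries.coeff 2), PowerSeries.coeff_one,
    PowerSeries.coeff_mul_X_pow']
  norm_num

open PotVar in
-- By `sigma2_div` and `sigma2_mTilde`, (L² - 1)σ²(α) = L³ + α L M with M for `mTilde`.
-- Multiplication by L - 1 replaces the remaining occurrences of α by L M.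
theorem expCoeffTwo_weyl (α : Mot) (h : (lef - 1) * α = lef * mTilde) :
    (sigma2 α + α) * ((lef ^ 2 - 1) * (lef - 1)) = lef ^ 3 * (lef - 1) +
      mTilde * lef * (lef ^ 2 - 1) + mTilde ^ 2 * lef ^ 2 := by
  have h1 := sigma2_div α _ h
  rw [sigma2_lef_mul, sigma2_mTilde] at h1
  linear_combination (lef - 1) * h1 + (lef ^ 2 - 1 + lef * mTilde) * h

end

end Motivic

theorem mainTheorem4 :
    (IsUnit Motivic.lef ∧ IsUnit (Motivic.lef - 1) ∧ IsUnit (Motivic.lef ^ 2 - 1) ∧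
      IsUnit (Motivic.mot (Motivic.MuVar.gl 2))) ∧
    PowerSeries.coeff 2 (Motivic.dtSeries Motivic.weylPotential_mem) =
      (Motivic.lef ^ 3 * (Motivic.lef - 1) +
          Motivic.mTilde * Motivic.lef * (Motivic.lef ^ 2 - 1) +
          Motivic.mTilde ^ 2 * Motivic.lef ^ 2) *
        Ring.inverse ((Motivic.lef ^ 2 - 1) * (Motivic.lef - 1)) ∧
    PowerSeries.coeff 2 (Motivic.dtSeries Motivic.weylPotential_mem) =
      Motivic.expCoeffTwo
        (PowerSeries.C (Motivic.lef * Motivic.mTilde * Ring.inverse (Motivic.lef - 1)) *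
          (PowerSeries.X * Ring.inverse (1 - PowerSeries.X))) := by
  open Motivic Motivic.PotVar in
  -- Both equalities are verified after multiplication by this unit, where no inverses remain.
  have hu : IsUnit ((lef ^ 2 - 1) * (lef - 1)) := isUnit_lef_sq_sub.mul isUnit_lef_sub
  have hα : (lef - 1) * (lef * mTilde * Ring.inverse (lef - 1)) = lef * mTilde := by
    rw [mul_left_comm, Ring.mul_inverse_cancel _ isUnit_lef_sub, mul_one]
  refine ⟨⟨isUnit_lef, isUnit_lef_sub, isUnit_lef_sq_sub, isUnit_gl_two⟩, ?_, ?_⟩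
  · refine hu.mul_right_cancel ?_
    rw [coeff_dtSeries_weyl, mul_assoc _ (Ring.inverse _), Ring.inverse_mul_cancel _ hu, mul_one]
  · refine hu.mul_right_cancel ?_
    rw [coeff_dtSeries_weyl, expCoeffTwo_eq, coeff_geometric _ 0, coeff_geometric _ 1,
      expCoeffTwo_weyl _ hα]
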